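/- Let $s\in\mathbb N$, $s\ge 1$, and $T,L>0$. Let $\mathbf s=(s_0,s_1,s_2,s_3):\mathbb R\to\mathbb R^4$ be smooth with $\|\mathbf s\|_{L^\infty}+\|\mathbf s'\|_{H^s(\mathbb R,\mathbb R^4)}<\infty$, let $\gamma$ be a Hermitian $2\times2$ matrix and let $g\in C^\infty(\mathbb R,\mathbb R)$. Write $\sigma_0,\dots,\sigma_3$ for the Pauli matrices ($\sigma_0$ the identity), $\mathbf s\cdot\sigma=\sum_{\alpha=0}^3 s_\alpha\sigma_\alpha$, $\langle z,w\rangle=\sum_{j=1,2}z_j\bar w_j$ on $\mathbb C^2$, $H^k=H^k(\mathbb R,\mathbb C^2)$ and $\|u\|_{H^k}^2=\sum_{j=0}^k\|\partial_x^ju\|_{L^2}^2$. *Nonlinear Dirac equation.* For $a\in H^s$ let $U_{\rm Dirac}(\cdot)a\in C([0,T],H^s)$ denote the solution $u$ (if it exists) of $$i\partial_tu=-i\sigma_3\partial_xu+\mathbf s\cdot\sigma\,u+g(\langle u,\gamma u\rangle)\gamma u,\qquad u(0)=a,$$ the equation being understood in $L^2$. The pair $(T,L)$ satisfies $(\mathrm{Lip})_s$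 if there is $C>0$ such that for all $a,b\in H^s$ with $\|a\|_{H^s},\|b\|_{H^s}\le L$ the solutions $U_{\rm Dirac}(\cdot)a,\,U_{\rm Dirac}(\cdot)b\in C([0,T],H^s)$ exist and $\sup_{0\le t\le T}\|U_{\rm Dirac}(t)a-U_{\rm Dirac}(t)b\|_{H^s}\le C\|a-b\|_{H^s}$. *Nonlinear quantum walk.* For $\delta>0$ and $v=(v_1,v_2)\in\ell^2(\delta\mathbb Z,\mathbb C^2)$ put, for $x\in\delta\mathbb Z$, $$(S_\delta v)(x)=(v_1(x-\delta),v_2(x+\delta)),\quad (C_\delta v)(x)=e^{-i\delta\,\mathbf s(x)\cdot\sigma}v(x),\quad (N_\delta v)(x)=e^{-i\delta g(\langle v(x),\gamma v(x)\rangle)\gamma}v(x),$$ and let $\mathcal U_\delta(m)=(S_\delta C_\delta N_\delta)^m$ be the $m$-fold iterate of $S_\delta\circ C_\delta\circ N_\delta$. *Interpolation.* Let $F$ be the unitary Fourier transform $Fu(\xi)=\frac1{\sqrt{2\pi}}\int_{\mathbb R}e^{-ix\xi}u(x)\,dx$ on $L^2(\mathbb R,\mathbb C^2)$, let $j_\delta=F^{-1}\chi_{[-\pi/\delta,\pi/\delta]}F$,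 and let $\mathfrak I_\delta:\ell^2(\delta\mathbb Z,\mathbb C^2)\to L^2(\mathbb R,\mathbb C^2)$ be Shannon interpolation, $F(\mathfrak I_\delta v)(\xi)=\chi_{[-\pi/\delta,\pi/\delta]}(\xi)\frac{\delta}{\sqrt{2\pi}}\sum_{x\in\delta\mathbb Z}e^{-ix\xi}v(x)$, which is a bijection onto the range of $j_\delta$. Assume that $(T,L)$ satisfies $(\mathrm{Lip})_s$. Then there are $C>0$ and $\delta_0>0$ such that for every $u_0\in H^{s+1}$ with $\|u_0\|_{H^{s+1}}\le L$ and every $\delta\in(0,\delta_0]$, $$\sup_{m\in\mathbb Z,\ 0\le m\delta\le T}\big\|\mathfrak I_\delta\,\mathcal U_\delta(m)\,\mathfrak I_\delta^{-1}j_\delta u_0-U_{\rm Dirac}(m\delta)u_0\big\|_{H^s}\le C\,\delta .$$ Here $C$ and $\delta_0$ may depend on $s,T,L,\mathbf s,\gamma,g$, but not on $u_0$, $\delta$ or $m$. -/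

import Mathlib

open MeasureTheory Filter Topology
open scoped FourierTransform SchwartzMap LineDeriv ENNReal ContDiff Matrix

namespace NLQW

noncomputable section

/-- `ℂ²` with its Euclidean norm. -/
abbrev C2 : Type := EuclideanSpace ℂ (Fin 2)

/-- `2 × 2` complex matrices. -/
abbrev Mat2 : Type := Matrix (Fin 2) (Fin 2) ℂ

/-- `L²(ℝ, ℂ²)`. -/
abbrev L2 : Type := Lp C2 2 (volume : Measure ℝ)

/-- The lattice space `ℓ²(δℤ, ℂ²)`. A function on `δℤ` is written as a function of `n : ℤ`, its
value at the site `x = δ n` being the value at `n`. (The norm on `δℤ` is `√δ` times the norm here;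
only membership in the space is used.) -/
abbrev Lattice : Type := lp (fun _ : ℤ => C2) 2

/-- The action of a matrix on `ℂ²`. -/
def act (M : Mat2) (z : C2) : C2 := Matrix.toEuclideanCLM (n := Fin 2) (𝕜 := ℂ) M z

/-! ### Sobolev spaces -/

/-- `v ∈ L²` is the distributional derivative of `u ∈ L²`. -/
def IsWeakDeriv (u v : L2) : Prop :=
  ∂_{(1 : ℝ)} (u : 𝓢'(ℝ, C2)) = (v : 𝓢'(ℝ, C2))

open Classical in
/-- The distributional derivative of `u` if it belongs to `L²` (and `0` otherwise). -/
def weakDeriv (u : L2) : L2 := if h : ∃ v, IsWeakDeriv u v then h.choose else 0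

/-- `u ∈ H^k(ℝ, ℂ²)`: the distributional derivatives up to order `k` belong to `L²`. -/
def MemH : ℕ → L2 → Prop
  | 0, _ => True
  | k + 1, u => ∃ v, IsWeakDeriv u v ∧ MemH k v

/-- `‖u‖_{H^k} = (∑_{j ≤ k} ‖∂ₓʲ u‖²_{L²})^{1/2}`, meaningful for `u ∈ H^k`. -/
def normH (k : ℕ) (u : L2) : ℝ :=
  Real.sqrt (∑ j ∈ Finset.range (k + 1), ‖weakDeriv^[j] u‖ ^ 2)

/-! ### Coins and the nonlinear quantum walk -/

/-- The Pauli matrices `σ₀, σ₁, σ₂, σ₃`. -/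
def pauli : Fin 4 → Mat2 :=
  ![!![1, 0; 0, 1], !![0, 1; 1, 0], !![0, -Complex.I; Complex.I, 0], !![1, 0; 0, -1]]

/-- `p · σ = ∑_α p_α σ_α` for `p ∈ ℝ⁴`. -/
def pauliComb (p : EuclideanSpace ℝ (Fin 4)) : Mat2 := ∑ α, (p α : ℂ) • pauli α

/-- The real number `⟨z, γ z⟩_{ℂ²}` (`γ` Hermitian), where `⟨u, v⟩ = ∑ⱼ uⱼ v̄ⱼ`. -/
def quad (γ : Mat2) (z : C2) : ℝ := (∑ j, z j * star (act γ z j)).re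

/-- `e^{-i t M}`. -/
def expI (t : ℝ) (M : Mat2) : Mat2 := NormedSpace.exp ((-(Complex.I * (t : ℂ))) • M)

theorem norm_act_expI (t : ℝ) {M : Mat2} (hM : M.IsHermitian) (z : C2) :
    ‖act (expI t M) z‖ = ‖z‖ := by
  have h1 : (expI t M)ᴴ * expI t M = 1 := by
    unfold expI
    rw [← Matrix.exp_conjTranspose, Matrix.conjTranspose_smul, hM.eq,
      ← Matrix.exp_add_of_commute _ _ ((Commute.refl M).smul_left _ |>.smul_right _), ← add_smul]
    simp
  have h2 : ContinuousLinearMap.adjoint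
        (Matrix.toEuclideanCLM (n := Fin 2) (𝕜 := ℂ) (expI t M)) ∘L
      (Matrix.toEuclideanCLM (n := Fin 2) (𝕜 := ℂ) (expI t M)) = 1 := by
    rw [← ContinuousLinearMap.star_eq_adjoint, ← map_star, ← ContinuousLinearMap.mul_def,
      ← map_mul, Matrix.star_eq_conjTranspose, h1, map_one]
  exact (ContinuousLinearMap.norm_map_iff_adjoint_comp_self _).2 h2 z

theorem isHermitian_pauliComb (p : EuclideanSpace ℝ (Fin 4)) : (pauliComb p).IsHermitian := by
  ext i j
  fin_cases i <;> fin_cases j <;>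
    simp [pauliComb, pauli, Fin.sum_univ_four, Matrix.conjTranspose_apply]

theorem isHermitian_smul {γ : Mat2} (hγ : γ.IsHermitian) (r : ℝ) : ((r : ℂ) • γ).IsHermitian := by
  rw [Matrix.IsHermitian, Matrix.conjTranspose_smul, hγ.eq]
  simp

theorem memℓp_of_norm_le {f h : ℤ → C2} (hh : Memℓp h 2) (hf : ∀ n, ‖f n‖ ≤ ‖h n‖) :
    Memℓp f 2 := by
  refine memℓp_gen (Summable.of_nonneg_of_le (fun n => by positivity) (fun n => ?_)
    (hh.summable (by norm_num)))
  exact Real.rpow_le_rpow (norm_nonneg _) (hf n) (by norm_num)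

theorem memℓp_comp {h : ℤ → C2} (hh : Memℓp h 2) (e : ℤ ≃ ℤ) : Memℓp (fun n => h (e n)) 2 :=
  memℓp_gen ((e.summable_iff (f := fun n => ‖h n‖ ^ (2 : ℝ≥0∞).toReal)).2
    (hh.summable (by norm_num)))

theorem memℓp_shift (v : Lattice) : Memℓp (fun n : ℤ => (!₂[v (n - 1) 0, v (n + 1) 1] : C2)) 2 := by
  have hA : Memℓp (fun n : ℤ => (!₂[v (n - 1) 0, 0] : C2)) 2 := by
    refine memℓp_of_norm_le (memℓp_comp (lp.memℓp v) (Equiv.subRight 1)) fun n => ?_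
    simpa [EuclideanSpace.norm_eq] using Real.sqrt_le_sqrt
      (show ‖v (n - 1) 0‖ ^ 2 ≤ ‖v (n - 1) 0‖ ^ 2 + ‖v (n - 1) 1‖ ^ 2 by nlinarith [sq_nonneg ‖v (n - 1) 1‖])
  have hB : Memℓp (fun n : ℤ => (!₂[0, v (n + 1) 1] : C2)) 2 := by
    refine memℓp_of_norm_le (memℓp_comp (lp.memℓp v) (Equiv.addRight 1)) fun n => ?_
    simpa [EuclideanSpace.norm_eq] using Real.sqrt_le_sqrt
      (show ‖v (n + 1) 1‖ ^ 2 ≤ ‖v (n + 1) 0‖ ^ 2 + ‖v (n + 1) 1‖ ^ 2 by nlinarith [sq_nonneg ‖v (n + 1) 0‖])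
  convert hA.add hB using 1
  ext n i
  fin_cases i <;> simp

/-- The shift: the first component moves by `+δ`, the second by `-δ`. -/
def shift (v : Lattice) : Lattice := ⟨fun n => !₂[v (n - 1) 0, v (n + 1) 1], memℓp_shift v⟩

/-- The linear coin `(C v)(x) = e^{-iδ p(x)·σ} v(x)`, `x = δ n`. -/
def coin (δ : ℝ) (p : ℝ → EuclideanSpace ℝ (Fin 4)) (v : Lattice) : Lattice :=
  ⟨fun n => act (expI δ (pauliComb (p (δ * n)))) (v n),
    memℓp_of_norm_le (lp.memℓp v) fun n => (norm_act_expI δ (isHermitian_pauliComb _) (v n)).le⟩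

/-- The nonlinear coin `(N v)(x) = e^{-iδ g(⟨v(x), γ v(x)⟩) γ} v(x)`. -/
def nonlinearCoin (δ : ℝ) (γ : Mat2) (hγ : γ.IsHermitian) (g : ℝ → ℝ) (v : Lattice) : Lattice :=
  ⟨fun n => act (expI δ ((g (quad γ (v n)) : ℂ) • γ)) (v n),
    memℓp_of_norm_le (lp.memℓp v) fun n => (norm_act_expI δ (isHermitian_smul hγ _) (v n)).le⟩

/-- `m` steps of the nonlinear quantum walk, each step being shift ∘ coin ∘ nonlinear coin. -/
def walk (δ : ℝ) (p : ℝ → EuclideanSpace ℝ (Fin 4)) (γ : Mat2) (hγ : γ.IsHermitian) (g : ℝ → ℝ)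
    (m : ℕ) (v : Lattice) : Lattice :=
  (fun w => shift (coin δ p (nonlinearCoin δ γ hγ g w)))^[m] v

/-! ### Band limiting and Shannon interpolation

The Fourier transform `𝓕` on `L²` is Mathlib's, with kernel `e^{-2πi x ξ}`. With this
normalization the frequency band `[-π/δ, π/δ]` reads `[-1/(2δ), 1/(2δ)]`. -/

/-- The frequency band. -/
def band (δ : ℝ) : Set ℝ := Set.Icc (-(1 / (2 * δ))) (1 / (2 * δ))

theorem measurableSet_band (δ : ℝ) : MeasurableSet (band δ) := measurableSet_Icc

/-- The band-limiting projection `j_δ = 𝓕⁻¹ χ_{band} 𝓕`. -/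
def bandLimit (δ : ℝ) (u : L2) : L2 :=
  𝓕⁻ (((Lp.memLp (𝓕 u : L2)).indicator (measurableSet_band δ)).toLp)

/-- `ξ ↦ χ_{band}(ξ) δ e^{-2πi δ n ξ} c`, the contribution of the site `x = δ n` carrying the
value `c` to the lattice Fourier series. -/
def bandWaveFun (δ : ℝ) (n : ℤ) (c : C2) : ℝ → C2 :=
  (band δ).indicator fun ξ =>
    ((δ : ℂ) * Complex.exp (-(2 * Real.pi * (δ * n) * ξ : ℝ) * Complex.I)) • c

theorem memLp_bandWaveFun (δ : ℝ) (n : ℤ) (c : C2) :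
    MemLp (bandWaveFun δ n c) 2 (volume : Measure ℝ) := by
  unfold bandWaveFun
  rw [memLp_indicator_iff_restrict (measurableSet_band δ)]
  have : IsFiniteMeasure ((volume : Measure ℝ).restrict (band δ)) :=
    ⟨by simp [band]⟩
  refine MemLp.of_bound (C := |δ| * ‖c‖) ?_ (ae_of_all _ fun ξ => ?_)
  · exact Continuous.aestronglyMeasurable (by fun_prop)
  · rw [norm_smul, norm_mul, Complex.norm_real, ← Complex.ofReal_neg,
      Complex.norm_exp_ofReal_mul_I, mul_one, Real.norm_eq_abs]

/-- The lattice Fourier transform `ξ ↦ δ ∑_{x ∈ δℤ} e^{-2πi x ξ} v(x)` (convergent in `L²` of the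
band), extended by zero outside the band. -/
def latticeFourier (δ : ℝ) (v : Lattice) : L2 :=
  ∑' n : ℤ, (memLp_bandWaveFun δ n (v n)).toLp

/-- Shannon interpolation `𝔍_δ : ℓ²(δℤ, ℂ²) → L²(ℝ, ℂ²)`. -/
def shannon (δ : ℝ) (v : Lattice) : L2 := 𝓕⁻ (latticeFourier δ v)

/-- The inverse of Shannon interpolation (a bijection onto the band-limited functions). -/
def shannonInv (δ : ℝ) : L2 → Lattice := Function.invFun (shannon δ)

/-! ### The nonlinear Dirac equation -/

/-- `u ∈ C([0,T], H^k)` solves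
`i ∂ₜ u = -i σ₃ ∂ₓ u + p·σ u + g(⟨u, γ u⟩) γ u`, `u(0) = a`.
For `k ≥ 1` the right hand side is a continuous function of time with values in `L²`, so the
equation is understood in `L²`. -/
structure IsDiracSolution (k : ℕ) (p : ℝ → EuclideanSpace ℝ (Fin 4)) (γ : Mat2) (g : ℝ → ℝ)
    (T : ℝ) (a : L2) (u : ℝ → L2) : Prop where
  initial : u 0 = a
  mem : ∀ t ∈ Set.Icc 0 T, MemH k (u t)
  cont : ∀ t ∈ Set.Icc 0 T,
    Tendsto (fun τ => normH k (u τ - u t)) (𝓝[Set.Icc 0 T] t) (𝓝 0)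
  eqn : ∀ t ∈ Set.Icc 0 T, ∃ d : L2, HasDerivWithinAt u d (Set.Icc 0 T) t ∧
    ∀ᵐ x ∂(volume : Measure ℝ),
      Complex.I • d x = -(Complex.I • act (pauli 3) (weakDeriv (u t) x))
        + act (pauliComb (p x)) (u t x)
        + (g (quad γ (u t x)) : ℂ) • act γ (u t x)

/-- The uniform Lipschitz well-posedness condition for `(T, L)` in `H^k`: the Dirac equation has a
solution flow `a ↦ U(·) a ∈ C([0,T], H^k)` on the ball of radius `L` of `H^k`, which is Lipschitz in
`H^k` uniformly on `[0,T]`. -/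
def LipCondition (k : ℕ) (p : ℝ → EuclideanSpace ℝ (Fin 4)) (γ : Mat2) (g : ℝ → ℝ)
    (T L : ℝ) : Prop :=
  ∃ C : ℝ, 0 < C ∧ ∃ U : ℝ → L2 → L2,
    (∀ a, MemH k a → normH k a ≤ L → IsDiracSolution k p γ g T a (fun t => U t a)) ∧
    ∀ a b, MemH k a → normH k a ≤ L → MemH k b → normH k b ≤ L →
      ∀ t ∈ Set.Icc 0 T, normH k (U t a - U t b) ≤ C * normH k (a - b)

end

end NLQW

open NLQW

/-!
The shift of the lattice transports the two components of `shannon δ a` by `± δ`, so it is the free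
Dirac group `prop δ` exactly. Hence one step of the walk takes `f = shannon δ a` to
`prop δ (f + δ • shannon δ b)`, where `b` samples `x ↦ K (δ, p x, f x)` for a smooth `K` which
vanishes at `f x = 0` and is `-i` times the zeroth-order part of the Dirac equation when `δ = 0`.
Sampling and interpolating a function costs one derivative and gives an error `O(δ)`, so Duhamel's
formula for the solution yields a local error `O(δ²)` in `H^s`, as long as the walk stays bounded in
`H^s` and its `H^(s+1)` norm is under control. The latter holds since the `H^(s+1)` norm of a
superposition is linear in that of `f` with a constant depending on the `H^s` norm only. Discrete
Gronwall closes both bounds together, starting from `‖u₀ - j_δ u₀‖ = O(δ)`.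

This gives the error bound for any solution bounded in `H^s`. In particular two solutions with the
same data in `H^(s+1)` are both limits of the same walk and coincide, so that every solution with
such data inherits the bound which the Lipschitz condition provides for one of them.
-/

universe u

namespace NLQW

open scoped NNReal

noncomputable section

/-! ### Hadamard's lemma -/

theorem hasFDerivAt_intervalIntegral_of_contDiff {E F : Type*}
    [NormedAddCommGroup E] [NormedSpace ℝ E] [FiniteDimensional ℝ E]
    [NormedAddCommGroup F] [NormedSpace ℝ F] {f : E × ℝ → F} (hf : ContDiff ℝ 1 f) (y : E) :
    HasFDerivAt (fun y => ∫ r in (0 : ℝ)..1, f (y, r))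
      (∫ r in (0 : ℝ)..1, (fderiv ℝ f (y, r)).comp (.inl ℝ E ℝ)) y := by
  have hf' : Continuous fun q : E × ℝ => (fderiv ℝ f q).comp (.inl ℝ E ℝ) :=
    (hf.continuous_fderiv one_ne_zero).clm_comp continuous_const
  have slice (z : E) : Continuous fun r : ℝ => (z, r) := by fun_prop
  obtain ⟨M, hM⟩ := ((isCompact_closedBall y 1).prod
    (isCompact_Icc (a := (0 : ℝ)) (b := 1))).exists_bound_of_continuousOn hf'.continuousOn
  refine intervalIntegral.hasFDerivAt_integral_of_dominated_of_fderiv_le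
    (F := fun y r => f (y, r)) (F' := fun y r => (fderiv ℝ f (y, r)).comp (.inl ℝ E ℝ))
    (bound := fun _ => M) (Metric.closedBall_mem_nhds y one_pos)
    (.of_forall fun z => (hf.continuous.comp (slice z)).aestronglyMeasurable)
    ((hf.continuous.comp (slice y)).intervalIntegrable _ _)
    (hf'.comp (slice y)).aestronglyMeasurable
    (ae_of_all _ fun r hr z hz => hM (z, r) ⟨hz, ?_⟩) intervalIntegrable_const
    (ae_of_all _ fun r _ z _ => ?_)
  · rw [Set.uIoc_of_le zero_le_one] at hr
    exact Set.Ioc_subset_Icc_self hr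
  · exact (hf.differentiable one_ne_zero _).hasFDerivAt.comp z
      ((hasFDerivAt_id z).prodMk (hasFDerivAt_const r z))

theorem contDiff_nat_intervalIntegral (n : ℕ) {E F : Type u}
    [NormedAddCommGroup E] [NormedSpace ℝ E] [FiniteDimensional ℝ E]
    [NormedAddCommGroup F] [NormedSpace ℝ F] {f : E × ℝ → F} (hf : ContDiff ℝ n f) :
    ContDiff ℝ n fun y => ∫ r in (0 : ℝ)..1, f (y, r) := by
  induction n generalizing F with
  | zero =>
    rw [Nat.cast_zero, contDiff_zero] at hf ⊢
    exact intervalIntegral.continuous_parametric_intervalIntegral_of_continuous'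
      (f := fun y r => f (y, r)) hf 0 1
  | succ n ih =>
    rw [Nat.cast_add, Nat.cast_one] at hf
    rw [Nat.cast_add, Nat.cast_one, contDiff_succ_iff_hasFDerivAt]
    exact ⟨_, ih ((hf.fderiv_right le_rfl).clm_comp contDiff_const),
      hasFDerivAt_intervalIntegral_of_contDiff (hf.of_le le_add_self)⟩

theorem contDiff_infty_intervalIntegral {E F : Type u}
    [NormedAddCommGroup E] [NormedSpace ℝ E] [FiniteDimensional ℝ E]
    [NormedAddCommGroup F] [NormedSpace ℝ F] {f : E × ℝ → F} (hf : ContDiff ℝ ∞ f) :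
    ContDiff ℝ ∞ fun y => ∫ r in (0 : ℝ)..1, f (y, r) :=
  contDiff_infty.2 fun n => contDiff_nat_intervalIntegral n (contDiff_infty.1 hf n)

theorem exists_contDiff_sub_eq_clm_apply {E F : Type u}
    [NormedAddCommGroup E] [NormedSpace ℝ E] [FiniteDimensional ℝ E]
    [NormedAddCommGroup F] [NormedSpace ℝ F] [CompleteSpace F] {H : E → F}
    (hH : ContDiff ℝ ∞ H) :
    ∃ B : E × E → (E →L[ℝ] F), ContDiff ℝ ∞ B ∧ ∀ a b, H a - H b = B (a, b) (a - b) := by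
  have hH' : ContDiff ℝ ∞ (fderiv ℝ H) := hH.fderiv_right (m := ∞) (by simp)
  refine ⟨fun q => ∫ r in (0 : ℝ)..1, fderiv ℝ H (q.2 + r • (q.1 - q.2)),
    contDiff_infty_intervalIntegral (f := fun q : (E × E) × ℝ =>
      fderiv ℝ H (q.1.2 + q.2 • (q.1.1 - q.1.2))) (hH'.comp (by fun_prop)), fun a b => ?_⟩
  have segment (r : ℝ) : HasDerivAt (fun r : ℝ => b + r • (a - b)) (a - b) r := by
    simpa using ((hasDerivAt_id r).smul_const (a - b)).const_add b
  have hcont : Continuous fun r : ℝ => fderiv ℝ H (b + r • (a - b)) :=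
    hH'.continuous.comp (by fun_prop)
  calc H a - H b = ∫ r in (0 : ℝ)..1, fderiv ℝ H (b + r • (a - b)) (a - b) := by
        simpa using (intervalIntegral.integral_eq_sub_of_hasDerivAt (a := 0) (b := 1)
          (fun r _ => (hH.differentiable (by simp) _).hasFDerivAt.comp_hasDerivAt r (segment r))
          ((hcont.clm_apply continuous_const).intervalIntegrable _ _)).symm
    _ = _ := (ContinuousLinearMap.intervalIntegral_apply (hcont.intervalIntegrable _ _) _).symm

/-! ### Local estimates on the line -/

theorem eLpNorm_two_sq {α E : Type*} [MeasurableSpace α] [NormedAddCommGroup E] (f : α → E)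
    (μ : Measure α) : eLpNorm f 2 μ ^ 2 = ∫⁻ x, ‖f x‖ₑ ^ 2 ∂μ := by
  simpa using eLpNorm_nnreal_pow_eq_lintegral (f := f) (μ := μ) (p := 2) two_ne_zero

theorem ennreal_add_sq_le (a b : ℝ≥0∞) : (a + b) ^ 2 ≤ 2 * (a ^ 2 + b ^ 2) := by
  have h := ENNReal.rpow_add_le_mul_rpow_add_rpow a b (p := 2) one_le_two
  norm_num at h
  exact_mod_cast h

section Local

variable {E : Type*} [NormedAddCommGroup E] {f : ℝ → E}

theorem lintegral_Ioc_enorm_sq_le (hf : Continuous f) (x δ : ℝ) :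
    (∫⁻ y in Set.Ioc x (x + δ), ‖f y‖ₑ) ^ 2
      ≤ ENNReal.ofReal δ * ∫⁻ y in Set.Ioc x (x + δ), ‖f y‖ₑ ^ 2 := by
  have h := eLpNorm_le_eLpNorm_mul_rpow_measure_univ (f := f) (p := 1) (q := 2)
    (μ := volume.restrict (Set.Ioc x (x + δ))) one_le_two hf.aestronglyMeasurable
  rw [eLpNorm_one_eq_lintegral_enorm] at h
  refine (pow_le_pow_left' h 2).trans (le_of_eq ?_)
  rw [mul_pow, eLpNorm_two_sq, mul_comm, ← ENNReal.rpow_natCast, ← ENNReal.rpow_mul]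
  norm_num

variable [NormedSpace ℝ E] [CompleteSpace E]

theorem enorm_sub_le_lintegral_deriv (hf : ContDiff ℝ 1 f) {x y : ℝ} (hxy : x ≤ y) :
    ‖f y - f x‖ₑ ≤ ∫⁻ z in Set.Ioc x y, ‖deriv f z‖ₑ := by
  rw [← intervalIntegral.integral_eq_sub_of_hasDerivAt
    (fun z _ => (hf.differentiable one_ne_zero z).hasDerivAt)
    (hf.continuous_deriv_one.intervalIntegrable _ _), intervalIntegral.integral_of_le hxy]
  exact enorm_integral_le_lintegral_enorm _

theorem enorm_sub_sq_le_lintegral_deriv (hf : ContDiff ℝ 1 f) (x : ℝ) {δ : ℝ} (hδ : 0 ≤ δ) :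
    ‖f (x + δ) - f x‖ₑ ^ 2
      ≤ ENNReal.ofReal δ * ∫⁻ y in Set.Ioc x (x + δ), ‖deriv f y‖ₑ ^ 2 :=
  (pow_le_pow_left' (enorm_sub_le_lintegral_deriv hf (by linarith)) 2).trans
    (lintegral_Ioc_enorm_sq_le hf.continuous_deriv_one x δ)

theorem enorm_sq_le_lintegral_add_deriv (hf : ContDiff ℝ 1 f) (x δ : ℝ) :
    ENNReal.ofReal δ * ‖f x‖ₑ ^ 2
      ≤ 2 * ((∫⁻ y in Set.Ioc x (x + δ), ‖f y‖ₑ ^ 2)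
        + ENNReal.ofReal δ ^ 2 * ∫⁻ y in Set.Ioc x (x + δ), ‖deriv f y‖ₑ ^ 2) := by
  have pointwise : ∀ y ∈ Set.Ioc x (x + δ), ‖f x‖ₑ ^ 2 ≤ 2 * (‖f y‖ₑ ^ 2 +
      ENNReal.ofReal δ * ∫⁻ y in Set.Ioc x (x + δ), ‖deriv f y‖ₑ ^ 2) := fun y hy => calc
    ‖f x‖ₑ ^ 2 = ‖f y - (f y - f x)‖ₑ ^ 2 := by rw [sub_sub_cancel]
    _ ≤ (‖f y‖ₑ + ∫⁻ z in Set.Ioc x (x + δ), ‖deriv f z‖ₑ) ^ 2 := by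
      gcongr
      exact enorm_sub_le.trans <| add_le_add_right
        ((enorm_sub_le_lintegral_deriv hf hy.1.le).trans
          (lintegral_mono_set (Set.Ioc_subset_Ioc_right hy.2))) _
    _ ≤ _ := (ennreal_add_sq_le _ _).trans <| by
      gcongr
      exact lintegral_Ioc_enorm_sq_le hf.continuous_deriv_one x δ
  have hvol : volume (Set.Ioc x (x + δ)) = ENNReal.ofReal δ := by simp
  have h := setLIntegral_mono' (μ := volume) measurableSet_Ioc pointwise
  rw [setLIntegral_const, hvol, mul_comm, lintegral_const_mul' _ _ ENNReal.ofNat_ne_top,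
    lintegral_add_right' _ aemeasurable_const, setLIntegral_const, hvol] at h
  exact h.trans (le_of_eq (by ring))

theorem norm_le_of_eLpNorm_deriv_le {r : ℝ≥0} (hf : ContDiff ℝ 1 f)
    (h : eLpNorm f 2 volume ≤ r) (h' : eLpNorm (deriv f) 2 volume ≤ r) (x : ℝ) :
    ‖f x‖ ≤ (2 * r : ℝ≥0) := by
  have hlocal (g : ℝ → E) (hg : eLpNorm g 2 volume ≤ r) :
      ∫⁻ y in Set.Ioc x (x + 1), ‖g y‖ₑ ^ 2 ≤ (r : ℝ≥0∞) ^ 2 := by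
    refine (setLIntegral_le_lintegral _ _).trans ?_
    rw [← eLpNorm_two_sq]
    gcongr
  have hsq : ‖f x‖ₑ ^ 2 ≤ ((2 * r : ℝ≥0) : ℝ≥0∞) ^ 2 := by
    have h1 := enorm_sq_le_lintegral_add_deriv hf x 1
    simp only [ENNReal.ofReal_one, one_mul, one_pow] at h1
    calc ‖f x‖ₑ ^ 2 ≤ 2 * ((r : ℝ≥0∞) ^ 2 + (r : ℝ≥0∞) ^ 2) :=
          h1.trans (by gcongr <;> exact hlocal _ ‹_›)
      _ = _ := by push_cast; ring
  exact_mod_cast enorm_le_coe.1 ((ENNReal.pow_le_pow_left_iff two_ne_zero).1 hsq)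

end Local

/-! ### Sobolev bounds for smooth functions -/

section SmoothBounds

variable {E F G : Type*} [NormedAddCommGroup E] [NormedSpace ℝ E] [NormedAddCommGroup F]
  [NormedSpace ℝ F] [NormedAddCommGroup G] [NormedSpace ℝ G]

/-- `f` is smooth and its derivatives of order at most `k` are bounded by `r` in `L²`: the
quantitative form of `f ∈ C^∞ ∩ H^k`. -/
structure SmoothSobolevLE (k : ℕ) (r : ℝ≥0) (f : ℝ → E) : Prop where
  contDiff : ContDiff ℝ ∞ f
  eLpNorm_iteratedDeriv_le : ∀ j ≤ k, eLpNorm (iteratedDeriv j f) 2 volume ≤ r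

/-- `f` is smooth and bounded by `R`, and its derivatives of order `1, …, k` are bounded by `R` in
`L²`. These functions, which need not decay, act on `H^k` by multiplication. -/
structure SmoothCoeffLE (k : ℕ) (R : ℝ≥0) (f : ℝ → E) : Prop where
  contDiff : ContDiff ℝ ∞ f
  norm_le : ∀ x, ‖f x‖ ≤ R
  eLpNorm_iteratedDeriv_le : ∀ j < k, eLpNorm (iteratedDeriv (j + 1) f) 2 volume ≤ R

variable {k l : ℕ} {r r' : ℝ≥0} {f : ℝ → E} {g : ℝ → F}

theorem smoothSobolevLE_zero :
    SmoothSobolevLE 0 r f ↔ ContDiff ℝ ∞ f ∧ eLpNorm f 2 volume ≤ r :=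
  ⟨fun h => ⟨h.1, by simpa using h.2⟩, fun h => ⟨h.1, by simpa using h.2⟩⟩

theorem smoothSobolevLE_succ : SmoothSobolevLE (k + 1) r f ↔
    ContDiff ℝ ∞ f ∧ eLpNorm f 2 volume ≤ r ∧ SmoothSobolevLE k r (deriv f) := by
  constructor
  · refine fun h => ⟨h.1, by simpa using h.2 0 (Nat.zero_le _),
      (contDiff_infty_iff_deriv.1 h.1).2, fun j hj => ?_⟩
    rw [← iteratedDeriv_succ']
    exact h.2 (j + 1) (Nat.succ_le_succ hj)
  · refine fun ⟨hf, h0, h1⟩ => ⟨hf, fun j hj => ?_⟩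
    rcases j with _ | j
    · simpa using h0
    · rw [iteratedDeriv_succ']
      exact h1.2 j (Nat.le_of_succ_le_succ hj)

theorem smoothCoeffLE_zero : SmoothCoeffLE 0 r f ↔ ContDiff ℝ ∞ f ∧ ∀ x, ‖f x‖ ≤ r :=
  ⟨fun h => ⟨h.1, h.2⟩, fun h => ⟨h.1, h.2, by simp⟩⟩

theorem smoothCoeffLE_succ : SmoothCoeffLE (k + 1) r f ↔
    ContDiff ℝ ∞ f ∧ (∀ x, ‖f x‖ ≤ r) ∧ SmoothSobolevLE k r (deriv f) := by
  constructor
  · exact fun h => ⟨h.1, h.2, (contDiff_infty_iff_deriv.1 h.1).2, fun j hj => by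
      simpa only [iteratedDeriv_succ'] using h.3 j (Nat.lt_succ_of_le hj)⟩
  · exact fun ⟨hf, h0, h1⟩ => ⟨hf, h0, fun j hj => by
      simpa only [iteratedDeriv_succ'] using h1.2 j (Nat.le_of_lt_succ hj)⟩

theorem SmoothSobolevLE.mono (h : SmoothSobolevLE k r f) (hl : l ≤ k) (hr : r ≤ r') :
    SmoothSobolevLE l r' f :=
  ⟨h.1, fun j hj => (h.2 j (hj.trans hl)).trans (by exact_mod_cast hr)⟩

theorem SmoothCoeffLE.mono (h : SmoothCoeffLE k r f) (hl : l ≤ k) (hr : r ≤ r') :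
    SmoothCoeffLE l r' f :=
  ⟨h.1, fun x => (h.2 x).trans (by exact_mod_cast hr),
    fun j hj => (h.3 j (hj.trans_le hl)).trans (by exact_mod_cast hr)⟩

theorem smoothCoeffLE_const (k : ℕ) (c : E) : SmoothCoeffLE k ‖c‖₊ fun _ : ℝ => c :=
  ⟨contDiff_const, fun _ => le_rfl, fun j _ => by
    have h : iteratedDeriv (j + 1) (fun _ : ℝ => c) = 0 := funext fun x => by
      simp [iteratedDeriv_const]
    simp [h]⟩

theorem SmoothSobolevLE.add {g : ℝ → E} (hf : SmoothSobolevLE k r f)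
    (hg : SmoothSobolevLE k r' g) : SmoothSobolevLE k (r + r') fun x => f x + g x := by
  refine ⟨hf.1.add hg.1, fun j hj => ?_⟩
  have meas {h : ℝ → E} (hh : ContDiff ℝ ∞ h) :
      AEStronglyMeasurable (iteratedDeriv j h) volume :=
    (hh.continuous_iteratedDeriv j (by exact_mod_cast le_top)).aestronglyMeasurable
  have hadd : iteratedDeriv j (fun x => f x + g x) = iteratedDeriv j f + iteratedDeriv j g :=
    funext fun x => iteratedDeriv_fun_add (contDiff_infty.1 hf.1 j).contDiffAt
      (contDiff_infty.1 hg.1 j).contDiffAt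
  rw [hadd, ENNReal.coe_add]
  exact (eLpNorm_add_le (meas hf.1) (meas hg.1) one_le_two).trans
    (add_le_add (hf.2 j hj) (hg.2 j hj))

theorem SmoothSobolevLE.clm_apply (A : E →L[ℝ] F) (hf : SmoothSobolevLE k r f) :
    SmoothSobolevLE k (‖A‖₊ * r) fun x => A (f x) := by
  refine ⟨A.contDiff.comp hf.1, fun j hj => ?_⟩
  have hcomm : iteratedDeriv j (fun x => A (f x)) = fun x => A (iteratedDeriv j f x) :=
    funext fun x => by
      simp only [iteratedDeriv_eq_iteratedFDeriv]
      exact DFunLike.congr_fun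
        (A.iteratedFDeriv_comp_left (contDiff_infty.1 hf.1 j).contDiffAt le_rfl) fun _ => 1
  rw [hcomm]
  refine (eLpNorm_le_nnreal_smul_eLpNorm_of_ae_le_mul (c := ‖A‖₊)
    (ae_of_all _ fun x => A.le_opNNNorm _) 2).trans ?_
  rw [ENNReal.smul_def, smul_eq_mul, ENNReal.coe_mul]
  gcongr
  exact hf.2 j hj

theorem SmoothSobolevLE.prodMk (hf : SmoothSobolevLE k r f) (hg : SmoothSobolevLE k r' g) :
    SmoothSobolevLE k (r + r') fun x => (f x, g x) := by
  have h := (hf.clm_apply (.inl ℝ E F)).add (hg.clm_apply (.inr ℝ E F))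
  simp only [ContinuousLinearMap.inl_apply, ContinuousLinearMap.inr_apply, Prod.mk_add_mk,
    add_zero, zero_add] at h
  exact h.mono le_rfl (add_le_add
    (mul_le_of_le_one_left zero_le (ContinuousLinearMap.norm_inl_le_one ℝ E F))
    (mul_le_of_le_one_left zero_le (ContinuousLinearMap.norm_inr_le_one ℝ E F)))

theorem deriv_prodMk (hf : ContDiff ℝ ∞ f) (hg : ContDiff ℝ ∞ g) :
    deriv (fun x => (f x, g x)) = fun x => (deriv f x, deriv g x) :=
  funext fun x => ((hf.differentiable (by simp) x).hasDerivAt.prodMk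
    (hg.differentiable (by simp) x).hasDerivAt).deriv

theorem SmoothCoeffLE.prodMk (hf : SmoothCoeffLE k r f) (hg : SmoothCoeffLE k r' g) :
    SmoothCoeffLE k (r + r') fun x => (f x, g x) := by
  have hsmooth : ContDiff ℝ ∞ fun x => (f x, g x) := hf.1.prodMk hg.1
  have hbound (x : ℝ) : ‖(f x, g x)‖ ≤ (r + r' : ℝ≥0) := by
    rw [Prod.norm_mk, NNReal.coe_add]
    exact max_le ((hf.2 x).trans (by simp)) ((hg.2 x).trans (by simp))
  rcases k with _ | k
  · exact smoothCoeffLE_zero.2 ⟨hsmooth, hbound⟩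
  · refine smoothCoeffLE_succ.2 ⟨hsmooth, hbound, ?_⟩
    rw [deriv_prodMk hf.1 hg.1]
    exact (smoothCoeffLE_succ.1 hf).2.2.prodMk (smoothCoeffLE_succ.1 hg).2.2

theorem SmoothSobolevLE.norm_le [CompleteSpace E] (hf : SmoothSobolevLE (k + 1) r f) (x : ℝ) :
    ‖f x‖ ≤ (2 * r : ℝ≥0) := by
  obtain ⟨hsmooth, h0, h1⟩ := smoothSobolevLE_succ.1 hf
  exact norm_le_of_eLpNorm_deriv_le (hsmooth.of_le (by simp)) h0
    (by simpa using h1.2 0 (Nat.zero_le k)) x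

theorem SmoothSobolevLE.smoothCoeffLE [CompleteSpace E] (hf : SmoothSobolevLE (k + 1) r f) :
    SmoothCoeffLE (k + 1) (2 * r) f :=
  ⟨hf.1, hf.norm_le, fun j hj => (hf.2 (j + 1) hj).trans
    (by exact_mod_cast le_mul_of_one_le_left zero_le one_le_two)⟩

theorem eLpNorm_two_clm_apply₂_le (B : E →L[ℝ] F →L[ℝ] G) {R : ℝ≥0} (hf : ∀ x, ‖f x‖ ≤ R)
    (hg : eLpNorm g 2 volume ≤ r) :
    eLpNorm (fun x => B (f x) (g x)) 2 volume ≤ (‖B‖₊ * R * r : ℝ≥0) := by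
  refine (eLpNorm_le_nnreal_smul_eLpNorm_of_ae_le_mul (c := ‖B‖₊ * R) (g := g)
    (ae_of_all _ fun x => NNReal.coe_le_coe.1 <| (B.le_opNorm₂ (f x) (g x)).trans ?_) 2).trans ?_
  · simp only [NNReal.coe_mul, coe_nnnorm]
    gcongr
    exact hf x
  · rw [ENNReal.smul_def, smul_eq_mul, ENNReal.coe_mul (_ * _)]
    gcongr

theorem deriv_clm_apply₂ (B : E →L[ℝ] F →L[ℝ] G) (hf : ContDiff ℝ ∞ f) (hg : ContDiff ℝ ∞ g) :
    deriv (fun x => B (f x) (g x)) = fun x => B (f x) (deriv g x) + B (deriv f x) (g x) :=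
  funext fun x => (B.hasDerivAt_of_bilinear (fun _ => (hf.differentiable (by simp) x).hasDerivAt)
    (fun _ => (hg.differentiable (by simp) x).hasDerivAt)).deriv

theorem deriv_comp_contDiff {H : E → F} (hH : ContDiff ℝ ∞ H) (hf : ContDiff ℝ ∞ f) :
    deriv (fun x => H (f x)) = fun x => fderiv ℝ H (f x) (deriv f x) :=
  funext fun x => ((hH.differentiable (by simp) _).hasFDerivAt.comp_hasDerivAt x
    (hf.differentiable (by simp) x).hasDerivAt).deriv

end SmoothBounds

/-! ### Products and superpositions -/

theorem SmoothCoeffLE.clm_apply₂ (k : ℕ) {E F G : Type u} [NormedAddCommGroup E]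
    [NormedSpace ℝ E] [CompleteSpace E] [NormedAddCommGroup F] [NormedSpace ℝ F] [CompleteSpace F]
    [NormedAddCommGroup G] [NormedSpace ℝ G] (B : E →L[ℝ] F →L[ℝ] G) {f : ℝ → E} {g : ℝ → F}
    {R r : ℝ≥0} (hf : SmoothCoeffLE k R f) (hg : SmoothSobolevLE k r g) :
    SmoothSobolevLE k (3 ^ k * (‖B‖₊ * R * r)) fun x => B (f x) (g x) := by
  have hsmooth : ContDiff ℝ ∞ fun x => B (f x) (g x) :=
    B.isBoundedBilinearMap.contDiff.comp (hf.1.prodMk hg.1)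
  induction k generalizing E F R r with
  | zero =>
    rw [smoothSobolevLE_zero] at hg ⊢
    simpa using ⟨hsmooth, eLpNorm_two_clm_apply₂_le B hf.2 hg.2⟩
  | succ k ih =>
    obtain ⟨-, hR, hf'⟩ := smoothCoeffLE_succ.1 hf
    obtain ⟨-, hr, hg'⟩ := smoothSobolevLE_succ.1 hg
    rw [smoothSobolevLE_succ, deriv_clm_apply₂ B hf.1 hg.1]
    refine ⟨hsmooth, (eLpNorm_two_clm_apply₂_le B hR hr).trans ?_, ?_⟩
    · exact ENNReal.coe_le_coe.2 (le_mul_of_one_le_left zero_le (one_le_pow₀ (by norm_num)))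
    · have h1 := ih B (hf.mono k.le_succ le_rfl) hg'
        (B.isBoundedBilinearMap.contDiff.comp (hf.1.prodMk hg'.1))
      have h2 := ih B.flip (hg.smoothCoeffLE.mono k.le_succ le_rfl) hf'
        (B.flip.isBoundedBilinearMap.contDiff.comp (hg.1.prodMk hf'.1))
      refine (h1.add h2).mono le_rfl (le_of_eq ?_)
      rw [show ‖B.flip‖₊ = ‖B‖₊ from NNReal.eq B.opNorm_flip]
      ring

theorem exists_nnnorm_le_of_continuous {E F : Type*} [NormedAddCommGroup E] [ProperSpace E]
    [NormedAddCommGroup F] {H : E → F} (hH : Continuous H) (R : ℝ≥0) :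
    ∃ M : ℝ≥0, ∀ x, ‖x‖ ≤ R → ‖H x‖ ≤ M := by
  obtain ⟨M, hM⟩ := (isCompact_closedBall (0 : E) R).exists_bound_of_continuousOn hH.continuousOn
  exact ⟨M.toNNReal, fun x hx => (hM x (by simpa using hx)).trans (Real.le_coe_toNNReal M)⟩

theorem exists_smoothCoeffLE_comp (k : ℕ) {E F : Type u} [NormedAddCommGroup E] [NormedSpace ℝ E]
    [FiniteDimensional ℝ E] [NormedAddCommGroup F] [NormedSpace ℝ F] [FiniteDimensional ℝ F]
    {H : E → F} (hH : ContDiff ℝ ∞ H) (R : ℝ≥0) :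
    ∃ R' : ℝ≥0, ∀ f : ℝ → E, SmoothCoeffLE k R f → SmoothCoeffLE k R' fun x => H (f x) := by
  have : ProperSpace E := .of_locallyCompactSpace ℝ
  induction k generalizing F with
  | zero =>
    obtain ⟨M, hM⟩ := exists_nnnorm_le_of_continuous hH.continuous R
    exact ⟨M, fun f hf => smoothCoeffLE_zero.2 ⟨hH.comp hf.1, fun x => hM _ (hf.2 x)⟩⟩
  | succ k ih =>
    have hH' : ContDiff ℝ ∞ (fderiv ℝ H) := hH.fderiv_right (m := ∞) (by simp)
    obtain ⟨M, hM⟩ := exists_nnnorm_le_of_continuous hH.continuous R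
    obtain ⟨R₁, hR₁⟩ := ih hH'
    have : CompleteSpace (E →L[ℝ] F) := FiniteDimensional.complete ℝ _
    refine ⟨M + 3 ^ k * (‖ContinuousLinearMap.id ℝ (E →L[ℝ] F)‖₊ * R₁ * R), fun f hf =>
      smoothCoeffLE_succ.2 ⟨hH.comp hf.1, fun x => (hM _ (hf.2 x)).trans ?_, ?_⟩⟩
    · exact_mod_cast le_self_add
    · rw [deriv_comp_contDiff hH hf.1]
      exact ((hR₁ f (hf.mono k.le_succ le_rfl)).clm_apply₂ k (.id ℝ (E →L[ℝ] F))
        (smoothCoeffLE_succ.1 hf).2.2).mono le_rfl le_add_self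

section Superposition

variable {E F G : Type u} [NormedAddCommGroup E] [NormedSpace ℝ E] [FiniteDimensional ℝ E]
  [NormedAddCommGroup F] [NormedSpace ℝ F] [FiniteDimensional ℝ F]
  [NormedAddCommGroup G] [NormedSpace ℝ G] [FiniteDimensional ℝ G] {H : E × F → G}

theorem exists_smoothSobolevLE_superposition_sub (hH : ContDiff ℝ ∞ H) (k : ℕ) (R : ℝ≥0) :
    ∃ C : ℝ≥0, ∀ (q : ℝ → E) (y z : ℝ → F),
      SmoothCoeffLE k R q → SmoothCoeffLE k R y → SmoothCoeffLE k R z → ∀ r : ℝ≥0,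
      SmoothSobolevLE k r (fun x => y x - z x) →
      SmoothSobolevLE k (C * r) fun x => H (q x, y x) - H (q x, z x) := by
  have : CompleteSpace (E × F) := FiniteDimensional.complete ℝ _
  have : CompleteSpace G := FiniteDimensional.complete ℝ _
  have : CompleteSpace (E × F →L[ℝ] G) := FiniteDimensional.complete ℝ _
  obtain ⟨B, hB, hsub⟩ := exists_contDiff_sub_eq_clm_apply hH
  obtain ⟨R', hR'⟩ := exists_smoothCoeffLE_comp k hB (R + R + (R + R))
  refine ⟨3 ^ k * (‖ContinuousLinearMap.id ℝ (E × F →L[ℝ] G)‖₊ * R' *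
    ‖ContinuousLinearMap.inr ℝ E F‖₊), fun q y z hq hy hz r hr => ?_⟩
  have h := (hR' _ ((hq.prodMk hy).prodMk (hq.prodMk hz))).clm_apply₂ k
    (.id ℝ (E × F →L[ℝ] G)) (hr.clm_apply (.inr ℝ E F))
  simp only [ContinuousLinearMap.id_apply, ContinuousLinearMap.inr_apply] at h
  simp only [hsub, Prod.mk_sub_mk, sub_self]
  exact h.mono le_rfl (le_of_eq (by ring))

theorem exists_smoothSobolevLE_superposition (hH : ContDiff ℝ ∞ H) (hH0 : ∀ q, H (q, 0) = 0)
    (k : ℕ) (R : ℝ≥0) :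
    ∃ C : ℝ≥0, ∀ (q : ℝ → E) (z : ℝ → F), SmoothCoeffLE k R q → SmoothCoeffLE k R z →
      ∀ r : ℝ≥0, SmoothSobolevLE k r z → SmoothSobolevLE k (C * r) fun x => H (q x, z x) := by
  obtain ⟨C, hC⟩ := exists_smoothSobolevLE_superposition_sub hH k R
  refine ⟨C, fun q z hq hz r hr => ?_⟩
  simpa [hH0] using hC q z (fun _ => 0) hq hz ((smoothCoeffLE_const k 0).mono le_rfl (by simp)) r
    (by simpa using hr)

-- Tame: the norm of order `k + 1` enters linearly, the constant sees only the order `k`.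
theorem exists_smoothSobolevLE_superposition_tame (hH : ContDiff ℝ ∞ H)
    (hH0 : ∀ q, H (q, 0) = 0) (k : ℕ) (R : ℝ≥0) :
    ∃ C : ℝ≥0, ∀ (q : ℝ → E) (z : ℝ → F), SmoothCoeffLE (k + 1) R q → SmoothCoeffLE k R z →
      ∀ r : ℝ≥0, SmoothSobolevLE (k + 1) r z →
      SmoothSobolevLE (k + 1) (C * (1 + r)) fun x => H (q x, z x) := by
  have : CompleteSpace (E × F) := FiniteDimensional.complete ℝ _
  have : CompleteSpace (E × F →L[ℝ] G) := FiniteDimensional.complete ℝ _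
  obtain ⟨C₀, hC₀⟩ := exists_smoothSobolevLE_superposition hH hH0 0 R
  have hH' : ContDiff ℝ ∞ (fderiv ℝ H) := hH.fderiv_right (m := ∞) (by simp)
  obtain ⟨R', hR'⟩ := exists_smoothCoeffLE_comp k hH' (R + R)
  set D := 3 ^ k * (‖ContinuousLinearMap.id ℝ (E × F →L[ℝ] G)‖₊ * R') with hD
  refine ⟨C₀ + D * (R + 1), fun q z hq hz r hr => ?_⟩
  obtain ⟨-, -, hq'⟩ := smoothCoeffLE_succ.1 hq
  obtain ⟨-, hz0, hz'⟩ := smoothSobolevLE_succ.1 hr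
  rw [smoothSobolevLE_succ]
  refine ⟨hH.comp (hq.1.prodMk hz.1), ?_, ?_⟩
  · refine (smoothSobolevLE_zero.1 (hC₀ q z (hq.mono (Nat.zero_le _) le_rfl)
      (hz.mono (Nat.zero_le _) le_rfl) r (smoothSobolevLE_zero.2 ⟨hz.1, hz0⟩))).2.trans ?_
    exact_mod_cast mul_le_mul' le_self_add le_add_self
  · rw [deriv_comp_contDiff (f := fun x => (q x, z x)) hH (hq.1.prodMk hz.1),
      deriv_prodMk hq.1 hz.1]
    refine ((hR' _ ((hq.mono k.le_succ le_rfl).prodMk hz)).clm_apply₂ k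
      (.id ℝ (E × F →L[ℝ] G)) (hq'.prodMk hz')).mono le_rfl ?_
    calc 3 ^ k * (‖ContinuousLinearMap.id ℝ (E × F →L[ℝ] G)‖₊ * R' * (R + r))
        = D * (R + r) := by rw [hD]; ring
      _ ≤ D * (R + r) + (C₀ * (1 + r) + D * (R * r + 1)) := le_self_add
      _ = (C₀ + D * (R + 1)) * (1 + r) := by ring

end Superposition

/-! ### Weak derivatives -/

theorem toTemperedDistribution_injective :
    Function.Injective fun u : L2 => (u : 𝓢'(ℝ, C2)) :=
  LinearMap.ker_eq_bot.1
    (Lp.ker_toTemperedDistributionCLM_eq_bot (F := C2) (μ := (volume : Measure ℝ)) (p := 2))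

theorem IsWeakDeriv.weakDeriv_eq {u v : L2} (h : IsWeakDeriv u v) : weakDeriv u = v := by
  have hex : ∃ v, IsWeakDeriv u v := ⟨v, h⟩
  rw [weakDeriv, dif_pos hex]
  exact toTemperedDistribution_injective (hex.choose_spec.symm.trans h)

theorem ae_eq_of_integral_schwartz_smul_eq {E : Type*} [NormedAddCommGroup E] [NormedSpace ℂ E]
    [CompleteSpace E] {f g : ℝ → E} (hf : LocallyIntegrable f volume)
    (hg : LocallyIntegrable g volume)
    (h : ∀ φ : 𝓢(ℝ, ℂ), ∫ x, φ x • f x = ∫ x, φ x • g x) : f =ᵐ[volume] g := by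
  refine ae_eq_of_integral_contDiff_smul_eq hf hg fun φ hφ hc => ?_
  have hcompact : HasCompactSupport (Complex.ofRealCLM ∘ φ) := hc.comp_left rfl
  have hsmooth : ContDiff ℝ ∞ (Complex.ofRealCLM ∘ φ) := by fun_prop
  simpa using h (hcompact.toSchwartzMap hsmooth)

theorem locallyIntegrable_coe_L2 (u : L2) : LocallyIntegrable u volume :=
  (Lp.memLp u).locallyIntegrable one_le_two

theorem isWeakDeriv_iff_fourier {u v : L2} : IsWeakDeriv u v ↔
    ((𝓕 v : L2) : ℝ → C2) =ᵐ[volume] fun ξ => (2 * Real.pi * Complex.I * ξ) • (𝓕 u : L2) ξ := by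
  have hgrowth : (fun x : ℝ => ((inner ℝ x (1 : ℝ) : ℝ) : ℂ)).HasTemperateGrowth := by fun_prop
  have hfourier : IsWeakDeriv u v ↔ 𝓕 (∂_{(1 : ℝ)} (u : 𝓢'(ℝ, C2))) = 𝓕 (v : 𝓢'(ℝ, C2)) := by
    refine ⟨congrArg _, fun h => ?_⟩
    unfold IsWeakDeriv
    simpa only [FourierTransform.fourierInv_fourier_eq] using
      congrArg (fun w : 𝓢'(ℝ, C2) => 𝓕⁻ w) h
  have hmul (φ : 𝓢(ℝ, ℂ)) : ((2 * Real.pi * Complex.I) •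
      TemperedDistribution.smulLeftCLM C2 (fun x : ℝ => ((inner ℝ x (1 : ℝ) : ℝ) : ℂ))
        ((𝓕 u : L2) : 𝓢'(ℝ, C2))) φ
      = ∫ ξ, φ ξ • ((2 * Real.pi * Complex.I * ξ) • (𝓕 u : L2) ξ) := by
    change (2 * Real.pi * Complex.I) • (TemperedDistribution.smulLeftCLM C2
      (fun x : ℝ => ((inner ℝ x (1 : ℝ) : ℝ) : ℂ)) ((𝓕 u : L2) : 𝓢'(ℝ, C2))) φ = _
    rw [TemperedDistribution.smulLeftCLM_apply_apply, Lp.toTemperedDistribution_apply,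
      ← integral_smul]
    refine integral_congr_ae (ae_of_all _ fun ξ => ?_)
    simp only [SchwartzMap.smulLeftCLM_apply_apply hgrowth, smul_smul]
    congr 1
    simp
    ring
  rw [hfourier, TemperedDistribution.fourier_lineDerivOp_eq, Lp.fourier_toTemperedDistribution_eq,
    Lp.fourier_toTemperedDistribution_eq]
  constructor
  · refine fun h => ae_eq_of_integral_schwartz_smul_eq (locallyIntegrable_coe_L2 _)
      ((locallyIntegrable_coe_L2 (𝓕 u)).continuous_smul
        (g := fun ξ : ℝ => (2 * Real.pi * Complex.I * ξ : ℂ)) (by fun_prop)) fun φ => ?_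
    rw [← hmul, h, Lp.toTemperedDistribution_apply]
  · intro h
    ext1 φ
    rw [hmul, Lp.toTemperedDistribution_apply]
    exact integral_congr_ae (h.mono fun ξ hξ => congrArg (φ ξ • ·) hξ.symm)

theorem lineDerivOp_one_apply (φ : 𝓢(ℝ, ℂ)) (x : ℝ) : (∂_{(1 : ℝ)} φ) x = deriv φ x := by
  rw [SchwartzMap.lineDerivOp_apply_eq_fderiv, fderiv_apply_one_eq_deriv]

theorem isWeakDeriv_iff_integral {u v : L2} : IsWeakDeriv u v ↔
    ∀ φ : 𝓢(ℝ, ℂ), ∫ x, φ x • v x = -∫ x, deriv φ x • u x := by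
  have key (φ : 𝓢(ℝ, ℂ)) : (∂_{(1 : ℝ)} (u : 𝓢'(ℝ, C2))) φ = -∫ x, deriv φ x • u x := by
    rw [TemperedDistribution.lineDerivOp_apply_apply, Lp.toTemperedDistribution_apply,
      ← integral_neg]
    exact integral_congr_ae (ae_of_all _ fun x => by
      simp only [_root_.neg_apply, lineDerivOp_one_apply, neg_smul])
  constructor
  · intro h φ
    rw [← key, h, Lp.toTemperedDistribution_apply]
  · intro h
    ext1 φ
    rw [key, ← h, Lp.toTemperedDistribution_apply]

theorem integrable_smul_of_memLp_two {E : Type*} [NormedAddCommGroup E] [NormedSpace ℂ E]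
    {f : ℝ → ℂ} {g : ℝ → E} (hf : MemLp f 2 volume) (hg : MemLp g 2 volume) :
    Integrable (fun x => f x • g x) volume :=
  memLp_one_iff_integrable.1 (hg.smul hf)

theorem isWeakDeriv_of_contDiff {f : ℝ → C2} (hf : ContDiff ℝ ∞ f) {u v : L2}
    (hu : u =ᵐ[volume] f) (hv : v =ᵐ[volume] deriv f) : IsWeakDeriv u v := by
  have hf₂ : MemLp f 2 volume := (memLp_congr_ae hu).1 (Lp.memLp u)
  have hf₂' : MemLp (deriv f) 2 volume := (memLp_congr_ae hv).1 (Lp.memLp v)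
  refine isWeakDeriv_iff_integral.2 fun φ => ?_
  have hφ' : MemLp (deriv φ) 2 volume := by
    simpa only [funext (lineDerivOp_one_apply φ)] using (∂_{(1 : ℝ)} φ).memLp 2 volume
  calc ∫ x, φ x • v x = ∫ x, φ x • deriv f x :=
        integral_congr_ae (hv.mono fun x hx => congrArg (φ x • ·) hx)
    _ = -∫ x, deriv φ x • f x :=
        integral_bilinear_hasDerivAt_right_eq_neg_left_of_integrable
          (L := ContinuousLinearMap.lsmul ℝ ℂ) (fun x _ => (φ.differentiable x).hasDerivAt)
          (fun x _ => (hf.differentiable (by simp) x).hasDerivAt)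
          (integrable_smul_of_memLp_two (φ.memLp 2 volume) hf₂')
          (integrable_smul_of_memLp_two hφ' hf₂)
          (integrable_smul_of_memLp_two (φ.memLp 2 volume) hf₂)
    _ = -∫ x, deriv φ x • u x := by
        rw [integral_congr_ae (hu.mono fun x hx => congrArg (deriv φ x • ·) hx)]

theorem IsWeakDeriv.ae_eq_deriv {f : ℝ → C2} (hf : ContDiff ℝ ∞ f) {u v : L2}
    (h : IsWeakDeriv u v) (hu : u =ᵐ[volume] f) : v =ᵐ[volume] deriv f := by
  have hf' : Continuous (deriv f) := hf.continuous_deriv (by simp)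
  refine ae_eq_of_integral_contDiff_smul_eq (locallyIntegrable_coe_L2 v)
    hf'.locallyIntegrable fun φ hφ hc => ?_
  have hcompact : HasCompactSupport (Complex.ofRealCLM ∘ φ) := hc.comp_left rfl
  have hsmooth : ContDiff ℝ ∞ (Complex.ofRealCLM ∘ φ) := by fun_prop
  have hφ' (x : ℝ) : HasDerivAt φ (deriv φ x) x := (hφ.differentiable (by simp) x).hasDerivAt
  have hderiv (x : ℝ) : deriv (Complex.ofRealCLM ∘ φ) x = ((deriv φ x : ℝ) : ℂ) :=
    (hφ' x).ofReal_comp.deriv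
  calc ∫ x, φ x • v x = ∫ x, (Complex.ofRealCLM ∘ φ) x • v x := by simp
    _ = -∫ x, deriv (Complex.ofRealCLM ∘ φ) x • u x :=
        isWeakDeriv_iff_integral.1 h (hcompact.toSchwartzMap hsmooth)
    _ = -∫ x, deriv φ x • f x := by
        refine congrArg Neg.neg (integral_congr_ae ?_)
        filter_upwards [hu] with x hx
        rw [hderiv, hx, Complex.coe_smul]
    _ = ∫ x, φ x • deriv f x :=
        (integral_bilinear_hasDerivAt_right_eq_neg_left_of_integrable
          (L := ContinuousLinearMap.lsmul ℝ ℝ) (fun x _ => hφ' x)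
          (fun x _ => (hf.differentiable (by simp) x).hasDerivAt)
          ((hφ.continuous.smul hf').integrable_of_hasCompactSupport hc.smul_right)
          (((hφ.continuous_deriv (by simp)).smul hf.continuous).integrable_of_hasCompactSupport
            hc.deriv.smul_right)
          ((hφ.continuous.smul hf.continuous).integrable_of_hasCompactSupport hc.smul_right)).symm

/-! ### Multiplication operators -/

section Multiplication

variable {α 𝕜 E F : Type*} [MeasurableSpace α] {μ : Measure α} [NontriviallyNormedField 𝕜]
  [NormedAddCommGroup E] [NormedSpace 𝕜 E] [NormedAddCommGroup F] [NormedSpace 𝕜 F]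
  {m : α → E →L[𝕜] F}

/-- The bounded operator of pointwise multiplication by an essentially bounded operator-valued
function, from `L²` to `L²`. -/
def mulOp (m : α → E →L[𝕜] F) (hm : MemLp m ∞ μ) : Lp E 2 μ →L[𝕜] Lp F 2 μ :=
  (ContinuousLinearMap.id 𝕜 (E →L[𝕜] F)).holderL μ ∞ 2 2 hm.toLp

theorem coeFn_mulOp (hm : MemLp m ∞ μ) (f : Lp E 2 μ) :
    mulOp m hm f =ᵐ[μ] fun x => m x (f x) := by
  filter_upwards [(ContinuousLinearMap.id 𝕜 (E →L[𝕜] F)).coeFn_holder (r := 2) hm.toLp f,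
    hm.coeFn_toLp] with x h₁ h₂
  rw [mulOp, ContinuousLinearMap.holderL_apply_apply, h₁, h₂, ContinuousLinearMap.id_apply]

theorem memLp_top_smul_id {a : α → 𝕜} (ha : AEStronglyMeasurable a μ) {C : ℝ}
    (hC : ∀ x, ‖a x‖ ≤ C) :
    MemLp (fun x => a x • ContinuousLinearMap.id 𝕜 E) ∞ μ :=
  memLp_top_of_bound (ha.smul_const _) C <| ae_of_all _ fun x =>
    ContinuousLinearMap.opNorm_le_bound _ ((norm_nonneg _).trans (hC x)) fun z => by
      rw [_root_.smul_apply, ContinuousLinearMap.id_apply, norm_smul]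
      exact mul_le_mul_of_nonneg_right (hC x) (norm_nonneg z)

end Multiplication

theorem norm_le_add_of_ae_le_add {α E F G : Type*} [MeasurableSpace α] {μ : Measure α}
    [NormedAddCommGroup E] [NormedAddCommGroup F] [NormedAddCommGroup G] {p : ℝ≥0∞}
    [hp : Fact (1 ≤ p)] {f : Lp E p μ} {g : Lp F p μ} {h : Lp G p μ}
    (hle : ∀ᵐ x ∂μ, ‖f x‖ ≤ ‖g x‖ + ‖h x‖) : ‖f‖ ≤ ‖g‖ + ‖h‖ := by
  have hadd : eLpNorm f p μ ≤ eLpNorm g p μ + eLpNorm h p μ := by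
    rw [← eLpNorm_norm g, ← eLpNorm_norm h]
    exact (eLpNorm_mono_ae_real hle).trans <| eLpNorm_add_le (Lp.aestronglyMeasurable g).norm
      (Lp.aestronglyMeasurable h).norm hp.out
  rw [Lp.norm_def, Lp.norm_def, Lp.norm_def,
    ← ENNReal.toReal_add (Lp.eLpNorm_ne_top g) (Lp.eLpNorm_ne_top h)]
  exact ENNReal.toReal_mono
    (ENNReal.add_ne_top.2 ⟨Lp.eLpNorm_ne_top g, Lp.eLpNorm_ne_top h⟩) hadd

/-! ### Sobolev bounds on the Fourier side -/

/-- The Fourier weight `(1 + 2π|ξ|)^k` of `H^k`. -/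
def weight (k : ℕ) (ξ : ℝ) : ℝ := (1 + 2 * Real.pi * |ξ|) ^ k

theorem one_le_weight (k : ℕ) (ξ : ℝ) : 1 ≤ weight k ξ :=
  one_le_pow₀ (le_add_of_nonneg_right (by positivity))

theorem weight_nonneg (k : ℕ) (ξ : ℝ) : 0 ≤ weight k ξ := zero_le_one.trans (one_le_weight k ξ)

theorem weight_succ (k : ℕ) (ξ : ℝ) :
    weight (k + 1) ξ = weight k ξ + 2 * Real.pi * |ξ| * weight k ξ := by
  unfold weight
  ring

theorem continuous_weight (k : ℕ) : Continuous (weight k) := by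
  unfold weight
  fun_prop

theorem norm_weight (k : ℕ) (ξ : ℝ) : ‖(weight k ξ : ℂ)‖ = weight k ξ :=
  Complex.norm_of_nonneg (weight_nonneg k ξ)

theorem norm_two_pi_I_mul (ξ : ℝ) : ‖(2 * Real.pi * Complex.I * ξ : ℂ)‖ = 2 * Real.pi * |ξ| := by
  simp [abs_of_pos Real.pi_pos]

/-- The weight cut off at the frequencies `|ξ| ≤ N`, so that multiplication by it is bounded on
`L²`. -/
def truncWeight (k N : ℕ) (ξ : ℝ) : ℂ := if |ξ| ≤ N then (weight k ξ : ℂ) else 0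

theorem norm_truncWeight (k N : ℕ) (ξ : ℝ) :
    ‖truncWeight k N ξ‖ = if |ξ| ≤ N then weight k ξ else 0 := by
  rw [truncWeight, apply_ite norm, norm_weight, norm_zero]

theorem norm_truncWeight_le (k N : ℕ) (ξ : ℝ) : ‖truncWeight k N ξ‖ ≤ weight k ξ := by
  rw [norm_truncWeight]
  split_ifs
  exacts [le_rfl, weight_nonneg k ξ]

theorem norm_truncWeight_le_weight (k N : ℕ) (ξ : ℝ) : ‖truncWeight k N ξ‖ ≤ weight k N := by
  rw [norm_truncWeight]
  split_ifs with h
  · unfold weight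
    refine pow_le_pow_left₀ (by positivity) (add_le_add le_rfl ?_) k
    exact mul_le_mul_of_nonneg_left (h.trans (le_abs_self _)) Real.two_pi_pos.le
  · exact weight_nonneg k N

theorem measurable_truncWeight (k N : ℕ) : Measurable (truncWeight k N) :=
  Measurable.ite (measurableSet_le (by fun_prop) measurable_const)
    (Complex.measurable_ofReal.comp (continuous_weight k).measurable) measurable_const

/-- Multiplication by the truncated weight on `L²`. -/
def weightOp (k N : ℕ) : L2 →L[ℂ] L2 :=
  mulOp _ (memLp_top_smul_id (measurable_truncWeight k N).aestronglyMeasurable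
    (norm_truncWeight_le_weight k N))

theorem coeFn_weightOp (k N : ℕ) (f : L2) :
    weightOp k N f =ᵐ[volume] fun ξ => truncWeight k N ξ • f ξ :=
  coeFn_mulOp _ f

/-- `w` lies in `H^k` with `‖(1 + 2π|ξ|)^k 𝓕 w‖_{L²} ≤ r`, expressed through the truncated weights
to stay among bounded operators. -/
def SobolevLE (k : ℕ) (r : ℝ) (w : L2) : Prop := ∀ N, ‖weightOp k N (𝓕 w)‖ ≤ r

theorem fourier_sub (u v : L2) : (𝓕 (u - v) : L2) = 𝓕 u - 𝓕 v :=
  (Lp.fourierTransformₗᵢ ℝ C2).map_sub u v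

section SobolevLE

variable {k l : ℕ} {r r' : ℝ} {w w' : L2}

theorem SobolevLE.nonneg (h : SobolevLE k r w) : 0 ≤ r := (norm_nonneg _).trans (h 0)

theorem SobolevLE.mono (h : SobolevLE k r w) (hr : r ≤ r') : SobolevLE k r' w :=
  fun N => (h N).trans hr

theorem SobolevLE.of_fourier_le {c : ℝ} (hc : 0 ≤ c) (h : SobolevLE l r w')
    (hle : ∀ᵐ ξ, weight k ξ * ‖(𝓕 w : L2) ξ‖ ≤ c * (weight l ξ * ‖(𝓕 w' : L2) ξ‖)) :
    SobolevLE k (c * r) w := fun N => by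
  refine (Lp.norm_le_mul_norm_of_ae_le_mul (g := weightOp l N (𝓕 w')) ?_).trans
    (mul_le_mul_of_nonneg_left (h N) hc)
  filter_upwards [coeFn_weightOp k N (𝓕 w), coeFn_weightOp l N (𝓕 w'), hle] with ξ h₁ h₂ hξ
  rw [h₁, h₂, norm_smul, norm_smul, norm_truncWeight, norm_truncWeight]
  split_ifs
  · exact hξ
  · simp only [zero_mul, mul_zero, le_refl]

theorem SobolevLE.of_norm_fourier_le (h : SobolevLE k r w')
    (hle : ∀ᵐ ξ, ‖(𝓕 w : L2) ξ‖ ≤ ‖(𝓕 w' : L2) ξ‖) : SobolevLE k r w := by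
  simpa only [one_mul] using h.of_fourier_le (k := k) (w := w) zero_le_one <| hle.mono fun ξ hξ =>
    (mul_le_mul_of_nonneg_left hξ (weight_nonneg k ξ)).trans_eq (one_mul _).symm

theorem SobolevLE.mono_order (h : SobolevLE k r w) (hl : l ≤ k) : SobolevLE l r w := by
  simpa only [one_mul] using h.of_fourier_le (k := l) (w := w) zero_le_one <|
    ae_of_all _ fun ξ => by
    rw [one_mul]
    refine mul_le_mul_of_nonneg_right ?_ (norm_nonneg _)
    exact pow_le_pow_right₀ (le_add_of_nonneg_right (by positivity)) hl

theorem SobolevLE.add (h : SobolevLE k r w) (h' : SobolevLE k r' w') :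
    SobolevLE k (r + r') (w + w') := fun N => by
  rw [FourierTransform.fourier_add, map_add]
  exact (norm_add_le _ _).trans (add_le_add (h N) (h' N))

theorem SobolevLE.smul (h : SobolevLE k r w) (c : ℂ) : SobolevLE k (‖c‖ * r) (c • w) := fun N => by
  rw [FourierTransform.fourier_smul, map_smul, norm_smul]
  exact mul_le_mul_of_nonneg_left (h N) (norm_nonneg _)

theorem SobolevLE.neg (h : SobolevLE k r w) : SobolevLE k r (-w) := by
  simpa using h.smul (-1)

theorem SobolevLE.sub (h : SobolevLE k r w) (h' : SobolevLE k r' w') :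
    SobolevLE k (r + r') (w - w') := by
  rw [sub_eq_add_neg]
  exact h.add h'.neg

theorem sobolevLE_zero_right (k : ℕ) : SobolevLE k 0 0 := fun N => by
  rw [← sub_self (0 : L2), fourier_sub, sub_self, map_zero, norm_zero]

theorem SobolevLE.of_tendsto {u : ℕ → L2} (h : ∀ n, SobolevLE k r (u n))
    (hu : Tendsto u atTop (𝓝 w)) : SobolevLE k r w := fun N => by
  have hc : Continuous fun f : L2 => ‖weightOp k N (𝓕 f : L2)‖ :=
    ((weightOp k N).continuous.comp (Lp.fourierTransformₗᵢ ℝ C2).continuous).norm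
  exact le_of_tendsto ((hc.tendsto w).comp hu) (Eventually.of_forall fun n => h n N)

theorem SobolevLE.eLpNorm_le (h : SobolevLE k r w) :
    eLpNorm (fun ξ => (weight k ξ : ℂ) • (𝓕 w : L2) ξ) 2 volume ≤ ENNReal.ofReal r := by
  have hlim : ∀ᵐ ξ : ℝ, Tendsto (fun N : ℕ => weightOp k N (𝓕 w) ξ) atTop
      (𝓝 ((weight k ξ : ℂ) • (𝓕 w : L2) ξ)) := by
    filter_upwards [ae_all_iff.2 fun N => coeFn_weightOp k N (𝓕 w)] with ξ hξ
    refine tendsto_const_nhds.congr' ?_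
    filter_upwards [eventually_ge_atTop ⌈|ξ|⌉₊] with N hN
    rw [hξ, truncWeight, if_pos (Nat.ceil_le.1 hN)]
  calc eLpNorm (fun ξ => (weight k ξ : ℂ) • (𝓕 w : L2) ξ) 2 volume
      ≤ liminf (fun N => eLpNorm (weightOp k N (𝓕 w)) 2 volume) atTop :=
        Lp.eLpNorm_lim_le_liminf_eLpNorm (fun N => Lp.aestronglyMeasurable _) _ hlim
    _ ≤ liminf (fun _ : ℕ => ENNReal.ofReal r) atTop :=
        liminf_le_liminf (Eventually.of_forall fun N =>
          (ENNReal.le_ofReal_iff_toReal_le (Lp.eLpNorm_ne_top _) h.nonneg).2 (h N))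
    _ = ENNReal.ofReal r := liminf_const _

theorem SobolevLE.norm_le (h : SobolevLE k r w) : ‖w‖ ≤ r := by
  rw [← Lp.norm_fourier_eq, Lp.norm_def]
  refine ENNReal.toReal_le_of_le_ofReal h.nonneg ((eLpNorm_mono fun ξ => ?_).trans h.eLpNorm_le)
  rw [norm_smul, norm_weight]
  exact le_mul_of_one_le_left (norm_nonneg _) (one_le_weight k ξ)

theorem SobolevLE.eLpNorm_coe_le (h : SobolevLE k r w) : eLpNorm w 2 volume ≤ ENNReal.ofReal r :=
  (ENNReal.le_ofReal_iff_toReal_le (Lp.eLpNorm_ne_top w) h.nonneg).2 h.norm_le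

theorem sobolevLE_zero_order (w : L2) : SobolevLE 0 ‖w‖ w := fun N => by
  rw [← Lp.norm_fourier_eq w, ← one_mul ‖𝓕 w‖]
  refine Lp.norm_le_mul_norm_of_ae_le_mul ?_
  filter_upwards [coeFn_weightOp 0 N (𝓕 w)] with ξ hξ
  rw [hξ, norm_smul]
  refine mul_le_mul_of_nonneg_right ((norm_truncWeight_le 0 N ξ).trans_eq ?_) (norm_nonneg _)
  simp only [weight, pow_zero]

theorem SobolevLE.exists_isWeakDeriv (h : SobolevLE (k + 1) r w) :
    ∃ v, IsWeakDeriv w v ∧ SobolevLE k r v := by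
  have hle (ξ : ℝ) : weight k ξ * ‖(2 * Real.pi * Complex.I * ξ : ℂ)‖ ≤ weight (k + 1) ξ := by
    rw [norm_two_pi_I_mul, weight_succ, mul_comm]
    exact le_add_of_nonneg_left (weight_nonneg k ξ)
  have hm : MemLp (fun ξ : ℝ => (2 * Real.pi * Complex.I * ξ : ℂ) • (𝓕 w : L2) ξ) 2 volume := by
    have hw : MemLp (fun ξ => (weight (k + 1) ξ : ℂ) • (𝓕 w : L2) ξ) 2 volume :=
      ⟨((Complex.continuous_ofReal.comp (continuous_weight _)).aestronglyMeasurable).smul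
        (Lp.aestronglyMeasurable _), h.eLpNorm_le.trans_lt ENNReal.ofReal_lt_top⟩
    have hξ : Continuous fun ξ : ℝ => (2 * Real.pi * Complex.I * ξ : ℂ) := by fun_prop
    refine hw.mono (hξ.aestronglyMeasurable.smul (Lp.aestronglyMeasurable _))
      (ae_of_all _ fun ξ => ?_)
    rw [norm_smul, norm_smul, norm_weight]
    refine mul_le_mul_of_nonneg_right (le_trans ?_ (hle ξ)) (norm_nonneg _)
    exact le_mul_of_one_le_left (norm_nonneg _) (one_le_weight k ξ)
  have hF : ((𝓕 (𝓕⁻ hm.toLp : L2) : L2) : ℝ → C2) =ᵐ[volume]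
      fun ξ => (2 * Real.pi * Complex.I * ξ : ℂ) • (𝓕 w : L2) ξ := by
    rw [FourierTransform.fourier_fourierInv_eq]
    exact hm.coeFn_toLp
  refine ⟨𝓕⁻ hm.toLp, isWeakDeriv_iff_fourier.2 hF, ?_⟩
  simpa only [one_mul] using h.of_fourier_le (k := k) (w := 𝓕⁻ hm.toLp) zero_le_one <|
    hF.mono fun ξ hξ => by
      rw [hξ, norm_smul, one_mul, ← mul_assoc]
      exact mul_le_mul_of_nonneg_right (hle ξ) (norm_nonneg _)

theorem SobolevLE.succ {v : L2} (hv : IsWeakDeriv w v) (h : SobolevLE k r w)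
    (h' : SobolevLE k r' v) : SobolevLE (k + 1) (r + r') w := fun N => by
  refine (norm_le_add_of_ae_le_add ?_).trans (add_le_add (h N) (h' N))
  filter_upwards [isWeakDeriv_iff_fourier.1 hv, coeFn_weightOp (k + 1) N (𝓕 w),
    coeFn_weightOp k N (𝓕 w), coeFn_weightOp k N (𝓕 v)] with ξ h₁ h₂ h₃ h₄
  rw [h₂, h₃, h₄, h₁, norm_smul, norm_smul, norm_smul, norm_smul, norm_two_pi_I_mul,
    norm_truncWeight, norm_truncWeight]
  split_ifs
  · rw [weight_succ]
    exact le_of_eq (by ring)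
  · simp only [zero_mul, add_zero, le_refl]

theorem SobolevLE.memH (h : SobolevLE k r w) : MemH k w := by
  induction k generalizing w with
  | zero => trivial
  | succ k ih =>
    obtain ⟨v, hv, hk⟩ := h.exists_isWeakDeriv
    exact ⟨v, hv, ih hk⟩

theorem SobolevLE.norm_iterate_weakDeriv_le (h : SobolevLE k r w) {j : ℕ} (hj : j ≤ k) :
    ‖weakDeriv^[j] w‖ ≤ r := by
  induction j generalizing w k with
  | zero => exact h.norm_le
  | succ j ih =>
    obtain ⟨k, rfl⟩ : ∃ i, k = i + 1 := ⟨k - 1, by omega⟩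
    obtain ⟨v, hv, hk⟩ := h.exists_isWeakDeriv
    rw [Function.iterate_succ_apply, hv.weakDeriv_eq]
    exact ih hk (by omega)

theorem SobolevLE.normH_le (h : SobolevLE k r w) : normH k w ≤ (k + 1) * r := by
  have hr := h.nonneg
  refine Real.sqrt_le_iff.2 ⟨by positivity, ?_⟩
  calc ∑ j ∈ Finset.range (k + 1), ‖weakDeriv^[j] w‖ ^ 2
      ≤ ∑ _j ∈ Finset.range (k + 1), r ^ 2 := Finset.sum_le_sum fun j hj => by
        have := h.norm_iterate_weakDeriv_le (Finset.mem_range_succ_iff.1 hj)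
        gcongr
    _ = (k + 1) * r ^ 2 := by simp
    _ ≤ (k + 1) ^ 2 * r ^ 2 := by
        gcongr
        exact le_self_pow₀ (by simp) two_ne_zero
    _ = ((k + 1) * r) ^ 2 := (mul_pow _ _ 2).symm

theorem MemH.of_succ (hw : MemH (k + 1) w) : MemH k w := by
  induction k generalizing w with
  | zero => trivial
  | succ k ih =>
    obtain ⟨v, hv, hk⟩ := hw
    exact ⟨v, hv, ih hk⟩

theorem MemH.sobolevLE (hw : MemH k w) (h : ∀ j ≤ k, ‖weakDeriv^[j] w‖ ≤ r) :
    SobolevLE k (2 ^ k * r) w := by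
  induction k generalizing w with
  | zero => simpa using (sobolevLE_zero_order w).mono (h 0 le_rfl)
  | succ k ih =>
    have hw' : SobolevLE k (2 ^ k * r) w := ih hw.of_succ fun j hj => h j (by omega)
    obtain ⟨v, hv, hk⟩ := hw
    have hv' : SobolevLE k (2 ^ k * r) v := ih hk fun j hj => by
      simpa only [Function.iterate_succ_apply, hv.weakDeriv_eq] using h (j + 1) (by omega)
    exact (hw'.succ hv hv').mono (by rw [pow_succ]; linarith)

theorem norm_iterate_weakDeriv_le_normH (w : L2) {j : ℕ} (hj : j ≤ k) :
    ‖weakDeriv^[j] w‖ ≤ normH k w :=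
  Real.le_sqrt_of_sq_le <|
    Finset.single_le_sum (f := fun j => ‖weakDeriv^[j] w‖ ^ 2) (fun _ _ => sq_nonneg _)
      (Finset.mem_range_succ_iff.2 hj)

theorem MemH.sobolevLE_normH (hw : MemH k w) : SobolevLE k (2 ^ k * normH k w) w :=
  hw.sobolevLE fun _ hj => norm_iterate_weakDeriv_le_normH w hj

end SobolevLE

/-! ### Sobolev bounds of smooth functions -/

section Smooth

variable {k : ℕ} {r : ℝ≥0} {f : ℝ → C2} {w : L2}

theorem SmoothSobolevLE.exists_ae_eq (h : SmoothSobolevLE k r f) : ∃ w : L2, w =ᵐ[volume] f := by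
  have hm : MemLp f 2 volume := ⟨h.contDiff.continuous.aestronglyMeasurable,
    (smoothSobolevLE_zero.1 (h.mono k.zero_le le_rfl)).2.trans_lt ENNReal.coe_lt_top⟩
  exact ⟨hm.toLp, hm.coeFn_toLp⟩

theorem SmoothSobolevLE.sobolevLE (h : SmoothSobolevLE k r f) (hw : w =ᵐ[volume] f) :
    SobolevLE k (2 ^ k * r) w := by
  induction k generalizing w f with
  | zero =>
    simpa using (sobolevLE_zero_order w).mono <| by
      rw [Lp.norm_def, eLpNorm_congr_ae hw]
      exact ENNReal.toReal_le_coe_of_le_coe (smoothSobolevLE_zero.1 h).2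
  | succ k ih =>
    have h' := (smoothSobolevLE_succ.1 h).2.2
    obtain ⟨v, hv⟩ := h'.exists_ae_eq
    refine ((ih (h.mono (Nat.le_succ k) le_rfl) hw).succ
      (isWeakDeriv_of_contDiff h.contDiff hw hv) (ih h' hv)).mono (le_of_eq ?_)
    ring

theorem SobolevLE.smoothSobolevLE (h : SobolevLE k r w) (hf : ContDiff ℝ ∞ f)
    (hw : w =ᵐ[volume] f) : SmoothSobolevLE k r f := by
  have hf₂ : eLpNorm f 2 volume ≤ r := by
    simpa only [eLpNorm_congr_ae hw, ENNReal.ofReal_coe_nnreal] using h.eLpNorm_coe_le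
  induction k generalizing w f with
  | zero => exact smoothSobolevLE_zero.2 ⟨hf, hf₂⟩
  | succ k ih =>
    obtain ⟨v, hv, h'⟩ := h.exists_isWeakDeriv
    have hvf := hv.ae_eq_deriv hf hw
    have hf' : eLpNorm (deriv f) 2 volume ≤ r := by
      simpa only [eLpNorm_congr_ae hvf, ENNReal.ofReal_coe_nnreal] using h'.eLpNorm_coe_le
    exact smoothSobolevLE_succ.2 ⟨hf, hf₂, ih h' (contDiff_infty_iff_deriv.1 hf).2 hvf hf'⟩

end Smooth

/-! ### Band-limited functions -/

/-- The Fourier transform of `w` vanishes outside the band. -/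
def BandLimited (δ : ℝ) (w : L2) : Prop := ∀ᵐ ξ, ξ ∉ band δ → (𝓕 w : L2) ξ = 0

theorem isFiniteMeasure_restrict_band (δ : ℝ) :
    IsFiniteMeasure ((volume : Measure ℝ).restrict (band δ)) :=
  ⟨by simp [band]⟩

section BandLimited

variable {k : ℕ} {r δ : ℝ} {w : L2}

theorem BandLimited.integrable_pow_mul (hw : BandLimited δ w) (n : ℕ) :
    Integrable (fun ξ : ℝ => ‖ξ‖ ^ n * ‖(𝓕 w : L2) ξ‖) volume := by
  have hband : IntegrableOn (fun ξ : ℝ => ‖(𝓕 w : L2) ξ‖) (band δ) volume := by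
    have := isFiniteMeasure_restrict_band δ
    exact (((Lp.memLp (𝓕 w : L2)).restrict (band δ)).integrable one_le_two).norm
  have hpow : IntegrableOn (fun ξ : ℝ => ‖ξ‖ ^ n * ‖(𝓕 w : L2) ξ‖) (band δ) volume :=
    hband.continuousOn_mul_of_subset (K := band δ)
      (Continuous.continuousOn (f := fun ξ : ℝ => ‖ξ‖ ^ n) (by fun_prop))
      isCompact_Icc (measurableSet_band δ) subset_rfl
  refine (hpow.integrable_indicator (measurableSet_band δ)).congr ?_
  filter_upwards [hw] with ξ hξ
  by_cases h : ξ ∈ band δ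
  · rw [Set.indicator_of_mem h]
  · rw [Set.indicator_of_notMem h, hξ h, norm_zero, mul_zero]

theorem BandLimited.integrable_fourier (hw : BandLimited δ w) :
    Integrable (𝓕 w : L2) volume :=
  (integrable_norm_iff (Lp.aestronglyMeasurable _)).1 <| by
    simpa only [pow_zero, one_mul] using hw.integrable_pow_mul 0

theorem BandLimited.contDiff_fourierInv (hw : BandLimited δ w) :
    ContDiff ℝ ∞ (𝓕⁻ ((𝓕 w : L2) : ℝ → C2)) := by
  rw [funext (Real.fourierInv_eq_fourier_neg _)]
  exact (Real.contDiff_fourier (N := ⊤) fun n _ => hw.integrable_pow_mul n).comp contDiff_neg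

theorem BandLimited.ae_eq_fourierInv (hw : BandLimited δ w) :
    w =ᵐ[volume] 𝓕⁻ ((𝓕 w : L2) : ℝ → C2) := by
  refine ae_eq_of_integral_schwartz_smul_eq (locallyIntegrable_coe_L2 w)
    hw.contDiff_fourierInv.continuous.locallyIntegrable fun φ => ?_
  have hflip : ∫ ξ, 𝓕 (φ : ℝ → ℂ) ξ • (𝓕 w : L2) (-ξ)
      = ∫ x, φ x • 𝓕 (fun ξ => (𝓕 w : L2) (-ξ)) x := by
    simpa using! VectorFourier.integral_fourierIntegral_smul_eq_flip (L := innerₗ ℝ)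
      (μ := volume) (ν := volume) Real.continuous_fourierChar continuous_inner φ.integrable
      hw.integrable_fourier.comp_neg
  calc ∫ x, φ x • w x = ∫ ξ, (𝓕⁻ φ) ξ • (𝓕 w : L2) ξ := by
        rw [← Lp.toTemperedDistribution_apply, ← Lp.toTemperedDistribution_apply,
          ← TemperedDistribution.fourierInv_apply, Lp.fourierInv_toTemperedDistribution_eq,
          FourierTransform.fourierInv_fourier_eq]
    _ = ∫ ξ, 𝓕 (φ : ℝ → ℂ) ξ • (𝓕 w : L2) (-ξ) := by
        rw [← integral_neg_eq_self]
        simp only [SchwartzMap.fourierInv_coe, Real.fourierInv_eq_fourier_neg, neg_neg]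
    _ = ∫ x, φ x • 𝓕⁻ ((𝓕 w : L2) : ℝ → C2) x := by
        rw [hflip, Real.fourierInv_eq_fourier_comp_neg]

theorem coeFn_fourier_bandLimit (δ : ℝ) (u : L2) :
    ((𝓕 (bandLimit δ u) : L2) : ℝ → C2) =ᵐ[volume] (band δ).indicator (𝓕 u : L2) := by
  rw [bandLimit, FourierTransform.fourier_fourierInv_eq]
  exact MemLp.coeFn_toLp _

theorem bandLimited_bandLimit (δ : ℝ) (u : L2) : BandLimited δ (bandLimit δ u) := by
  filter_upwards [coeFn_fourier_bandLimit δ u] with ξ h₁ h₂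
  rw [h₁, Set.indicator_of_notMem h₂]

theorem SobolevLE.bandLimit (h : SobolevLE k r w) (δ : ℝ) : SobolevLE k r (bandLimit δ w) :=
  h.of_norm_fourier_le <| (coeFn_fourier_bandLimit δ w).mono fun ξ hξ => by
    rw [hξ]
    exact norm_indicator_le_norm_self _ ξ

theorem lt_abs_of_notMem_band (hδ : 0 < δ) {ξ : ℝ} (hξ : ξ ∉ band δ) : 1 < 2 * δ * |ξ| := by
  have hlt : 1 / (2 * δ) < |ξ| := lt_of_not_ge fun hle => hξ (abs_le.1 hle)
  rwa [div_lt_iff₀' (by positivity)] at hlt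

theorem SobolevLE.sub_bandLimit (hδ : 0 < δ) (h : SobolevLE (k + 1) r w) :
    SobolevLE k (δ * r) (w - NLQW.bandLimit δ w) := by
  refine h.of_fourier_le hδ.le ?_
  rw [fourier_sub]
  filter_upwards [coeFn_fourier_bandLimit δ w,
    Lp.coeFn_sub (𝓕 w : L2) (𝓕 (NLQW.bandLimit δ w) : L2)] with ξ h₁ h₂
  rw [h₂, Pi.sub_apply, h₁]
  by_cases hξ : ξ ∈ band δ
  · rw [Set.indicator_of_mem hξ, sub_self, norm_zero, mul_zero]
    have := weight_nonneg (k + 1) ξ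
    positivity
  · rw [Set.indicator_of_notMem hξ, sub_zero, weight_succ, ← mul_assoc]
    refine mul_le_mul_of_nonneg_right ?_ (norm_nonneg _)
    have hhigh : 1 ≤ δ * (2 * Real.pi * |ξ|) := by
      nlinarith [lt_abs_of_notMem_band hδ hξ, Real.pi_gt_three, mul_nonneg hδ.le (abs_nonneg ξ)]
    have hk := weight_nonneg k ξ
    nlinarith [mul_nonneg hδ.le hk]

theorem SobolevLE.tendsto_bandLimit (h : SobolevLE 1 r w) :
    Tendsto (fun n : ℕ => NLQW.bandLimit (1 / ((n : ℝ) + 1)) w) atTop (𝓝 w) := by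
  rw [tendsto_iff_norm_sub_tendsto_zero]
  refine squeeze_zero (fun _ => norm_nonneg _) (fun n => ?_)
    (by simpa only [zero_mul] using
      (tendsto_one_div_add_atTop_nhds_zero_nat (𝕜 := ℝ)).mul_const r)
  have hn : (0 : ℝ) < 1 / ((n : ℝ) + 1) := by positivity
  rw [norm_sub_rev]
  exact (h.sub_bandLimit hn).norm_le

end BandLimited

/-! ### The free Dirac group -/

/-- The projection of `ℂ²` on its `i`-th coordinate axis. -/
def compProj (i : Fin 2) : C2 →L[ℂ] C2 :=
  (EuclideanSpace.proj i : C2 →L[ℂ] ℂ).smulRight (EuclideanSpace.single i (1 : ℂ))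

theorem compProj_apply (i j : Fin 2) (z : C2) : compProj i z j = if j = i then z i else 0 := by
  simp [compProj, PiLp.single_apply]

/-- The diagonal matrix with entries `a`, `b`, as an operator on `ℂ²`. -/
def diagCLM (a b : ℂ) : C2 →L[ℂ] C2 := a • compProj 0 + b • compProj 1

@[simp]
theorem diagCLM_apply_zero (a b : ℂ) (z : C2) : diagCLM a b z 0 = a * z 0 := by
  simp [diagCLM, compProj_apply]

@[simp]
theorem diagCLM_apply_one (a b : ℂ) (z : C2) : diagCLM a b z 1 = b * z 1 := by
  simp [diagCLM, compProj_apply]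

theorem C2.ext {z w : C2} (h₀ : z 0 = w 0) (h₁ : z 1 = w 1) : z = w := by
  ext i
  fin_cases i
  exacts [h₀, h₁]

theorem C2.norm_sq (z : C2) : ‖z‖ ^ 2 = ‖z 0‖ ^ 2 + ‖z 1‖ ^ 2 := by
  rw [EuclideanSpace.norm_sq_eq, Fin.sum_univ_two]

theorem norm_diagCLM_apply_le {a b : ℂ} {c : ℝ} (ha : ‖a‖ ≤ c) (hb : ‖b‖ ≤ c) (z : C2) :
    ‖diagCLM a b z‖ ≤ c * ‖z‖ := by
  have hc : 0 ≤ c := (norm_nonneg _).trans ha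
  refine le_of_sq_le_sq ?_ (by positivity)
  rw [mul_pow, C2.norm_sq, C2.norm_sq, diagCLM_apply_zero, diagCLM_apply_one, norm_mul, norm_mul,
    mul_pow, mul_pow, mul_add]
  gcongr

theorem norm_exp_mul_I_sub_one_le (θ : ℝ) : ‖Complex.exp (θ * Complex.I) - 1‖ ≤ |θ| := by
  rw [mul_comm]
  exact Real.norm_exp_I_mul_ofReal_sub_one_le

theorem norm_exp_mul_I_sub_one_sub_le (θ : ℝ) :
    ‖Complex.exp (θ * Complex.I) - 1 - θ * Complex.I‖ ≤ 2 * θ ^ 2 := by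
  have hnorm : ‖(θ * Complex.I : ℂ)‖ = |θ| := by simp
  rcases le_total |θ| 1 with hθ | hθ
  · have h := Complex.norm_exp_sub_one_sub_id_le (hnorm.trans_le hθ)
    rw [hnorm, sq_abs] at h
    nlinarith [sq_nonneg θ]
  · calc ‖Complex.exp (θ * Complex.I) - 1 - θ * Complex.I‖ ≤ |θ| + |θ| :=
          (norm_sub_le _ _).trans (add_le_add (norm_exp_mul_I_sub_one_le θ) hnorm.le)
      _ ≤ 2 * θ ^ 2 := by nlinarith [sq_abs θ]

/-- `σ₃` as an operator. -/
def sigmaThree : C2 →L[ℂ] C2 := diagCLM 1 (-1)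

theorem norm_sigmaThree_apply_le (z : C2) : ‖sigmaThree z‖ ≤ ‖z‖ :=
  (norm_diagCLM_apply_le norm_one.le (by rw [norm_neg, norm_one]) z).trans_eq (one_mul _)

/-- The Fourier symbol `diag(e^{-2πiτξ}, e^{2πiτξ})` of the free Dirac group at time `τ`. -/
def propSymbol (τ ξ : ℝ) : C2 →L[ℂ] C2 :=
  diagCLM (Complex.exp ((-(2 * Real.pi * τ * ξ) : ℝ) * Complex.I))
    (Complex.exp ((2 * Real.pi * τ * ξ : ℝ) * Complex.I))

section PropSymbol

variable (τ σ ξ : ℝ) (z : C2)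

theorem norm_propSymbol_apply : ‖propSymbol τ ξ z‖ = ‖z‖ := by
  rw [← sq_eq_sq₀ (norm_nonneg _) (norm_nonneg _), C2.norm_sq, C2.norm_sq z, propSymbol,
    diagCLM_apply_zero, diagCLM_apply_one, norm_mul, norm_mul, Complex.norm_exp_ofReal_mul_I,
    Complex.norm_exp_ofReal_mul_I, one_mul, one_mul]

theorem propSymbol_propSymbol :
    propSymbol τ ξ (propSymbol σ ξ z) = propSymbol (τ + σ) ξ z := by
  refine C2.ext ?_ ?_ <;>
  · simp only [propSymbol, diagCLM_apply_zero, diagCLM_apply_one]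
    rw [← mul_assoc, ← Complex.exp_add]
    congr 2
    push_cast
    ring

theorem propSymbol_zero : propSymbol 0 ξ z = z :=
  C2.ext (by simp [propSymbol]) (by simp [propSymbol])

theorem continuous_propSymbol : Continuous (propSymbol τ) := by
  unfold propSymbol diagCLM
  fun_prop

theorem norm_propSymbol_sub_self_le :
    ‖propSymbol τ ξ z - z‖ ≤ |τ| * (2 * Real.pi * |ξ|) * ‖z‖ := by
  have habs : |2 * Real.pi * τ * ξ| = |τ| * (2 * Real.pi * |ξ|) := by
    rw [abs_mul, abs_mul, abs_of_pos Real.two_pi_pos]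
    ring
  have hdiag : propSymbol τ ξ z - z =
      diagCLM (Complex.exp ((-(2 * Real.pi * τ * ξ) : ℝ) * Complex.I) - 1)
        (Complex.exp ((2 * Real.pi * τ * ξ : ℝ) * Complex.I) - 1) z := by
    refine C2.ext ?_ ?_ <;>
    · simp only [propSymbol, PiLp.sub_apply, diagCLM_apply_zero, diagCLM_apply_one]
      ring
  rw [hdiag, ← habs]
  exact norm_diagCLM_apply_le ((norm_exp_mul_I_sub_one_le _).trans_eq (abs_neg _))
    (norm_exp_mul_I_sub_one_le _) z

theorem norm_propSymbol_sub_self_add_le :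
    ‖propSymbol τ ξ z - z + (τ * (2 * Real.pi * Complex.I * ξ)) • sigmaThree z‖
      ≤ 2 * (2 * Real.pi * |ξ|) ^ 2 * τ ^ 2 * ‖z‖ := by
  set θ : ℝ := 2 * Real.pi * τ * ξ with hθ
  have hsq : 2 * θ ^ 2 = 2 * (2 * Real.pi * |ξ|) ^ 2 * τ ^ 2 := by
    rw [hθ, mul_pow (2 * Real.pi) |ξ|, sq_abs]
    ring
  have hdiag : propSymbol τ ξ z - z + (τ * (2 * Real.pi * Complex.I * ξ)) • sigmaThree z =
      diagCLM (Complex.exp ((-θ : ℝ) * Complex.I) - 1 - (-θ : ℝ) * Complex.I)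
        (Complex.exp (θ * Complex.I) - 1 - θ * Complex.I) z := by
    refine C2.ext ?_ ?_ <;>
    · simp only [propSymbol, sigmaThree, PiLp.sub_apply, PiLp.add_apply, PiLp.smul_apply,
        diagCLM_apply_zero, diagCLM_apply_one, smul_eq_mul, ← hθ]
      rw [hθ]
      push_cast
      ring
  rw [hdiag, ← hsq]
  exact norm_diagCLM_apply_le ((norm_exp_mul_I_sub_one_sub_le _).trans_eq (by rw [neg_sq]))
    (norm_exp_mul_I_sub_one_sub_le _) z

theorem memLp_propSymbol : MemLp (propSymbol τ) ∞ volume :=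
  memLp_top_of_bound (continuous_propSymbol τ).aestronglyMeasurable 1 <| ae_of_all _ fun ξ =>
    ContinuousLinearMap.opNorm_le_bound _ zero_le_one fun z => by
      rw [norm_propSymbol_apply, one_mul]

end PropSymbol

/-- The free Dirac group `e^{-τ σ₃ ∂ₓ}` on the Fourier side. -/
def propOp (τ : ℝ) : L2 →L[ℂ] L2 := mulOp (propSymbol τ) (memLp_propSymbol τ)

theorem coeFn_propOp (τ : ℝ) (f : L2) : propOp τ f =ᵐ[volume] fun ξ => propSymbol τ ξ (f ξ) :=
  coeFn_mulOp _ f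

theorem propOp_propOp (τ σ : ℝ) (f : L2) : propOp τ (propOp σ f) = propOp (τ + σ) f := by
  refine Lp.ext ?_
  filter_upwards [coeFn_propOp τ (propOp σ f), coeFn_propOp σ f, coeFn_propOp (τ + σ) f]
    with ξ h₁ h₂ h₃
  rw [h₁, h₂, h₃, propSymbol_propSymbol]

theorem propOp_zero (f : L2) : propOp 0 f = f := by
  refine Lp.ext ?_
  filter_upwards [coeFn_propOp 0 f] with ξ h
  rw [h, propSymbol_zero]

theorem norm_propOp_apply (τ : ℝ) (f : L2) : ‖propOp τ f‖ = ‖f‖ := by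
  rw [Lp.norm_def, Lp.norm_def]
  refine congrArg ENNReal.toReal (eLpNorm_congr_norm_ae ?_)
  filter_upwards [coeFn_propOp τ f] with ξ h
  rw [h, norm_propSymbol_apply]

/-- The free Dirac group `e^{-τ σ₃ ∂ₓ}`. -/
def prop (τ : ℝ) (w : L2) : L2 := 𝓕⁻ (propOp τ (𝓕 w))

theorem fourier_prop (τ : ℝ) (w : L2) : (𝓕 (prop τ w) : L2) = propOp τ (𝓕 w) :=
  FourierTransform.fourier_fourierInv_eq _

theorem coeFn_fourier_prop (τ : ℝ) (w : L2) :
    ((𝓕 (prop τ w) : L2) : ℝ → C2) =ᵐ[volume] fun ξ => propSymbol τ ξ ((𝓕 w : L2) ξ) := by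
  rw [fourier_prop]
  exact coeFn_propOp τ _

theorem prop_prop (τ σ : ℝ) (w : L2) : prop τ (prop σ w) = prop (τ + σ) w := by
  rw [prop, fourier_prop, propOp_propOp, prop]

theorem prop_zero (w : L2) : prop 0 w = w := by
  rw [prop, propOp_zero, FourierTransform.fourierInv_fourier_eq]

theorem prop_sub (τ : ℝ) (w w' : L2) : prop τ (w - w') = prop τ w - prop τ w' := by
  simp only [prop, fourier_sub, map_sub]
  exact (Lp.fourierTransformₗᵢ ℝ C2).symm.map_sub _ _

section FreeGroup

variable {k : ℕ} {r : ℝ} {w : L2}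

theorem SobolevLE.prop (h : SobolevLE k r w) (τ : ℝ) : SobolevLE k r (prop τ w) :=
  h.of_norm_fourier_le <| (coeFn_fourier_prop τ w).mono fun ξ hξ => by
    rw [hξ, norm_propSymbol_apply]

theorem SobolevLE.prop_sub_self (h : SobolevLE (k + 1) r w) (τ : ℝ) :
    SobolevLE k (|τ| * r) (NLQW.prop τ w - w) := by
  refine h.of_fourier_le (abs_nonneg τ) ?_
  rw [fourier_sub]
  filter_upwards [coeFn_fourier_prop τ w, Lp.coeFn_sub (𝓕 (NLQW.prop τ w) : L2) (𝓕 w : L2)]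
    with ξ h₁ h₂
  rw [h₂, Pi.sub_apply, h₁]
  have hk := weight_nonneg k ξ
  calc weight k ξ * ‖propSymbol τ ξ ((𝓕 w : L2) ξ) - (𝓕 w : L2) ξ‖
      ≤ weight k ξ * (|τ| * (2 * Real.pi * |ξ|) * ‖(𝓕 w : L2) ξ‖) := by
        gcongr
        exact norm_propSymbol_sub_self_le τ ξ _
    _ = |τ| * (2 * Real.pi * |ξ| * weight k ξ * ‖(𝓕 w : L2) ξ‖) := by ring
    _ ≤ |τ| * (weight (k + 1) ξ * ‖(𝓕 w : L2) ξ‖) := by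
        rw [weight_succ]
        gcongr
        exact le_add_of_nonneg_left hk

end FreeGroup

/-! ### Duhamel's formula -/

theorem norm_truncWeight_mul_pow_le (k N n : ℕ) (ξ : ℝ) :
    ‖truncWeight k N ξ‖ * (2 * Real.pi * |ξ|) ^ n ≤ weight k N * (2 * Real.pi * N) ^ n := by
  have hN := weight_nonneg k N
  by_cases hξ : |ξ| ≤ N
  · gcongr
    exact norm_truncWeight_le_weight k N ξ
  · rw [truncWeight, if_neg hξ, norm_zero, zero_mul]
    positivity

/-- The Fourier symbol of `σ₃ ∂ₓ`, times the truncated Sobolev weight. -/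
def generatorSymbol (k N : ℕ) (ξ : ℝ) : C2 →L[ℂ] C2 :=
  (truncWeight k N ξ * (2 * Real.pi * Complex.I * ξ)) • sigmaThree

theorem memLp_generatorSymbol (k N : ℕ) : MemLp (generatorSymbol k N) ∞ volume := by
  have hmeas : Measurable fun ξ : ℝ => truncWeight k N ξ * (2 * Real.pi * Complex.I * ξ) :=
    (measurable_truncWeight k N).mul (by fun_prop)
  refine memLp_top_of_bound (hmeas.aestronglyMeasurable.smul_const _)
    (weight k N * (2 * Real.pi * N) ^ 1) (ae_of_all _ fun ξ => ?_)
  refine ContinuousLinearMap.opNorm_le_bound _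
    (mul_nonneg (weight_nonneg k N) (by positivity)) fun z => ?_
  rw [generatorSymbol, _root_.smul_apply, norm_smul, norm_mul, norm_two_pi_I_mul]
  exact mul_le_mul (by simpa only [pow_one] using norm_truncWeight_mul_pow_le k N 1 ξ)
    (norm_sigmaThree_apply_le z) (norm_nonneg _)
    (mul_nonneg (weight_nonneg k N) (by positivity))

/-- The operator `σ₃ ∂ₓ` on the Fourier side, times the truncated Sobolev weight. -/
def generatorOp (k N : ℕ) : L2 →L[ℂ] L2 :=
  mulOp (generatorSymbol k N) (memLp_generatorSymbol k N)

theorem coeFn_generatorOp (k N : ℕ) (f : L2) :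
    generatorOp k N f =ᵐ[volume] fun ξ => generatorSymbol k N ξ (f ξ) :=
  coeFn_mulOp _ f

theorem norm_weightOp_propOp_sub_le (k N : ℕ) (τ : ℝ) (f : L2) :
    ‖weightOp k N (propOp (-τ) f) - weightOp k N f - τ • generatorOp k N f‖
      ≤ 2 * (weight k N * (2 * Real.pi * N) ^ 2) * τ ^ 2 * ‖f‖ := by
  refine Lp.norm_le_mul_norm_of_ae_le_mul ?_
  filter_upwards [coeFn_weightOp k N (propOp (-τ) f), coeFn_weightOp k N f,
    coeFn_propOp (-τ) f, coeFn_generatorOp k N f, Lp.coeFn_smul τ (generatorOp k N f),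
    Lp.coeFn_sub (weightOp k N (propOp (-τ) f)) (weightOp k N f),
    Lp.coeFn_sub (weightOp k N (propOp (-τ) f) - weightOp k N f) (τ • generatorOp k N f)]
    with ξ h₁ h₂ h₃ h₄ h₅ h₆ h₇
  have hξ : weightOp k N (propOp (-τ) f) ξ - weightOp k N f ξ - τ • generatorOp k N f ξ
      = truncWeight k N ξ • (propSymbol (-τ) ξ (f ξ) - f ξ
        + ((-τ : ℝ) * (2 * Real.pi * Complex.I * ξ)) • sigmaThree (f ξ)) := by
    rw [h₁, h₂, h₃, h₄, generatorSymbol, _root_.smul_apply, ← Complex.coe_smul]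
    push_cast
    module
  rw [h₇, Pi.sub_apply, h₆, Pi.sub_apply, h₅, Pi.smul_apply, hξ, norm_smul]
  calc ‖truncWeight k N ξ‖ * _
      ≤ ‖truncWeight k N ξ‖ * (2 * (2 * Real.pi * |ξ|) ^ 2 * (-τ) ^ 2 * ‖f ξ‖) := by
        gcongr
        exact norm_propSymbol_sub_self_add_le (-τ) ξ (f ξ)
    _ = 2 * (‖truncWeight k N ξ‖ * (2 * Real.pi * |ξ|) ^ 2) * τ ^ 2 * ‖f ξ‖ := by ring
    _ ≤ 2 * (weight k N * (2 * Real.pi * N) ^ 2) * τ ^ 2 * ‖f ξ‖ := by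
        gcongr ?_ * _ * _
        exact mul_le_mul_of_nonneg_left (norm_truncWeight_mul_pow_le k N 2 ξ) zero_le_two

theorem hasDerivAt_weightOp_comp_propOp (k N : ℕ) (a t : ℝ) :
    HasDerivAt (fun t => weightOp k N ∘L propOp (a - t)) (generatorOp k N ∘L propOp (a - t)) t := by
  rw [hasDerivAt_iff_isLittleO]
  refine (Asymptotics.IsBigO.of_bound (2 * (weight k N * (2 * Real.pi * N) ^ 2)) <|
    Eventually.of_forall fun t' => ?_).trans_isLittleO
      (Asymptotics.isLittleO_pow_sub_sub t one_lt_two)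
  have hN := weight_nonneg k N
  refine ContinuousLinearMap.opNorm_le_bound _ (by positivity) fun f => ?_
  have hgroup : propOp (a - t') f = propOp (-(t' - t)) (propOp (a - t) f) := by
    rw [propOp_propOp]
    ring_nf
  have h := norm_weightOp_propOp_sub_le k N (t' - t) (propOp (a - t) f)
  rw [← hgroup, norm_propOp_apply] at h
  simpa using h

theorem ofReal_smul_L2 (c : ℝ) (w : L2) : (c : ℂ) • w = c • w := by
  refine Lp.ext ?_
  filter_upwards [Lp.coeFn_smul (c : ℂ) w, Lp.coeFn_smul c w] with x h₁ h₂
  rw [h₁, h₂, Pi.smul_apply, Pi.smul_apply, Complex.coe_smul]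

theorem propSymbol_sigmaThree (τ ξ : ℝ) (z : C2) :
    propSymbol τ ξ (sigmaThree z) = sigmaThree (propSymbol τ ξ z) :=
  C2.ext (by simp [propSymbol, sigmaThree]) (by simp [propSymbol, sigmaThree])

/-- `∂ₜ u = -σ₃ ∂ₓ u + h` at one time, with `u' = ∂ₜ u`, on the Fourier side. -/
def DiracRelation (u' u h : L2) : Prop :=
  ((𝓕 u' : L2) : ℝ → C2) =ᵐ[volume] fun ξ =>
    (𝓕 h : L2) ξ - (2 * Real.pi * Complex.I * ξ) • sigmaThree ((𝓕 u : L2) ξ)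

theorem DiracRelation.weightOp_propOp {u' u h : L2} (hu : DiracRelation u' u h) (k N : ℕ) (τ : ℝ) :
    generatorOp k N (propOp τ (𝓕 u)) + weightOp k N (propOp τ (𝓕 u'))
      = weightOp k N (propOp τ (𝓕 h)) := by
  refine Lp.ext ?_
  filter_upwards [hu, Lp.coeFn_add (generatorOp k N (propOp τ (𝓕 u))) (weightOp k N
    (propOp τ (𝓕 u'))), coeFn_generatorOp k N (propOp τ (𝓕 u)), coeFn_propOp τ (𝓕 u),
    coeFn_weightOp k N (propOp τ (𝓕 u')), coeFn_propOp τ (𝓕 u'),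
    coeFn_weightOp k N (propOp τ (𝓕 h)), coeFn_propOp τ (𝓕 h)] with ξ h₀ h₁ h₂ h₃ h₄ h₅ h₆ h₇
  rw [h₁, Pi.add_apply, h₂, h₃, h₄, h₅, h₆, h₇, h₀, generatorSymbol, _root_.smul_apply, map_sub,
    map_smul, propSymbol_sigmaThree]
  module

section Duhamel

variable {u u' h : ℝ → L2} {a b : ℝ}

theorem hasDerivWithinAt_weightOp_propOp
    (hu : ∀ t ∈ Set.Icc a b, HasDerivWithinAt u (u' t) (Set.Icc a b) t)
    (hD : ∀ t ∈ Set.Icc a b, DiracRelation (u' t) (u t) (h t)) (k N : ℕ) {t : ℝ}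
    (ht : t ∈ Set.Icc a b) :
    HasDerivWithinAt (fun t => weightOp k N (propOp (a - t) (𝓕 (u t))))
      (weightOp k N (propOp (a - t) (𝓕 (h t)))) (Set.Icc a b) t := by
  have hF : HasDerivWithinAt (fun t => (𝓕 (u t) : L2)) (𝓕 (u' t) : L2) (Set.Icc a b) t :=
    ((Lp.fourierTransformₗᵢ ℝ C2).toContinuousLinearEquiv.toContinuousLinearMap.restrictScalars
      ℝ).hasFDerivAt.comp_hasDerivWithinAt t (hu t ht)
  refine ((((ContinuousLinearMap.restrictScalarsL ℂ L2 L2 ℝ ℝ).hasFDerivAt.comp_hasDerivAt t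
    (hasDerivAt_weightOp_comp_propOp k N a t)).hasDerivWithinAt
      (s := Set.Icc a b)).clm_apply hF).congr_deriv ?_
  exact (hD t ht).weightOp_propOp k N (a - t)

/- Duhamel's formula, with the mean value inequality for the truncated weights of
`prop (a - t) (u t)` in place of an integral with values in `H^k`. -/
theorem SobolevLE.duhamel {k : ℕ} {r : ℝ} (hab : a ≤ b)
    (hu : ∀ t ∈ Set.Icc a b, HasDerivWithinAt u (u' t) (Set.Icc a b) t)
    (hD : ∀ t ∈ Set.Icc a b, DiracRelation (u' t) (u t) (h t)) {g : L2}
    (hg : ∀ t ∈ Set.Icc a b, SobolevLE k r (NLQW.prop (a - t) (h t) - g)) :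
    SobolevLE k ((b - a) * r) (NLQW.prop (a - b) (u b) - u a - ((b - a : ℝ) : ℂ) • g) := fun N => by
  have hderiv : ∀ t ∈ Set.Icc a b, HasDerivWithinAt
      (fun t => weightOp k N (propOp (a - t) (𝓕 (u t))) - t • weightOp k N (𝓕 g))
      (weightOp k N (𝓕 (NLQW.prop (a - t) (h t) - g))) (Set.Icc a b) t := fun t ht => by
    refine ((hasDerivWithinAt_weightOp_propOp hu hD k N ht).sub
      ((hasDerivAt_id t).smul_const (weightOp k N (𝓕 g))).hasDerivWithinAt).congr_deriv ?_
    rw [fourier_sub, fourier_prop, map_sub, one_smul]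
  have hmean := (convex_Icc a b).norm_image_sub_le_of_norm_hasDerivWithin_le hderiv
    (fun t ht => hg t ht N) (Set.left_mem_Icc.2 hab) (Set.right_mem_Icc.2 hab)
  rw [Real.norm_of_nonneg (sub_nonneg.2 hab), mul_comm] at hmean
  refine (congrArg norm ?_).trans_le hmean
  rw [sub_self, propOp_zero, fourier_sub, fourier_sub, fourier_prop,
    FourierTransform.fourier_smul, map_sub, map_sub, map_smul, ofReal_smul_L2]
  module

end Duhamel

/-! ### Sampling and finite differences -/

theorem tsum_setLIntegral_Ioc {δ : ℝ} (hδ : 0 < δ) (F : ℝ → ℝ≥0∞) :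
    ∑' n : ℤ, ∫⁻ y in Set.Ioc (δ * n) (δ * n + δ), F y = ∫⁻ y, F y := by
  have hcell (n : ℤ) :
      Set.Ioc (δ * n) (δ * n + δ) = Set.Ioc ((0 : ℝ) + n • δ) (0 + (n + 1) • δ) := by
    simp only [zero_add, zsmul_eq_mul, Int.cast_add, Int.cast_one, add_one_mul, mul_comm δ]
  simp_rw [hcell]
  rw [← lintegral_iUnion (fun _ => measurableSet_Ioc) (Set.pairwise_disjoint_Ioc_add_zsmul 0 δ),
    iUnion_Ioc_add_zsmul hδ, Measure.restrict_univ]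

theorem lintegral_setLIntegral_Ioc (δ : ℝ) {F : ℝ → ℝ≥0∞} (hF : Measurable F) :
    ∫⁻ x, ∫⁻ y in Set.Ioc x (x + δ), F y = ENNReal.ofReal δ * ∫⁻ y, F y := by
  have htranslate (x : ℝ) :
      ∫⁻ y in Set.Ioc x (x + δ), F y = ∫⁻ s in Set.Ioc 0 δ, F (x + s) := by
    rw [← lintegral_indicator measurableSet_Ioc, ← lintegral_indicator measurableSet_Ioc,
      ← lintegral_add_left_eq_self _ x]
    simp only [Set.indicator_apply, Set.mem_Ioc, lt_add_iff_pos_right, add_le_add_iff_left]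
  simp_rw [htranslate]
  rw [lintegral_lintegral_swap (by fun_prop)]
  simp_rw [lintegral_add_right_eq_self F]
  rw [setLIntegral_const, Real.volume_Ioc, sub_zero, mul_comm]

section DiffQuot

variable {E : Type*} [NormedAddCommGroup E] [NormedSpace ℝ E] {f : ℝ → E} {δ : ℝ} {k : ℕ} {r : ℝ≥0}

/-- The forward difference quotient with step `δ`. -/
def diffQuot (δ : ℝ) (f : ℝ → E) (x : ℝ) : E := δ⁻¹ • (f (x + δ) - f x)

theorem contDiff_diffQuot (hf : ContDiff ℝ ∞ f) (δ : ℝ) : ContDiff ℝ ∞ (diffQuot δ f) := by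
  unfold diffQuot
  fun_prop

theorem deriv_diffQuot (hf : ContDiff ℝ 1 f) (δ : ℝ) :
    deriv (diffQuot δ f) = diffQuot δ (deriv f) := by
  have hd (y : ℝ) : HasDerivAt f (deriv f y) y :=
    (hf.differentiable one_ne_zero y).hasDerivAt
  ext x
  exact ((((hd (x + δ)).comp_add_const x δ).sub (hd x)).const_smul δ⁻¹).deriv

variable [CompleteSpace E]

theorem enorm_diffQuot_sq_le (hf : ContDiff ℝ 1 f) (hδ : 0 < δ) (x : ℝ) :
    ENNReal.ofReal δ * ‖diffQuot δ f x‖ₑ ^ 2 ≤ ∫⁻ y in Set.Ioc x (x + δ), ‖deriv f y‖ₑ ^ 2 := by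
  have hcancel : ENNReal.ofReal δ * (ENNReal.ofReal δ)⁻¹ = 1 :=
    ENNReal.mul_inv_cancel (by simpa using hδ) ENNReal.ofReal_ne_top
  have hinv : ‖δ⁻¹‖ₑ = (ENNReal.ofReal δ)⁻¹ := by
    rw [Real.enorm_of_nonneg (inv_nonneg.2 hδ.le), ENNReal.ofReal_inv_of_pos hδ]
  calc ENNReal.ofReal δ * ‖diffQuot δ f x‖ₑ ^ 2
      = ENNReal.ofReal δ * ((ENNReal.ofReal δ)⁻¹ ^ 2 * ‖f (x + δ) - f x‖ₑ ^ 2) := by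
        rw [diffQuot, enorm_smul, hinv, mul_pow]
    _ ≤ ENNReal.ofReal δ * ((ENNReal.ofReal δ)⁻¹ ^ 2 *
        (ENNReal.ofReal δ * ∫⁻ y in Set.Ioc x (x + δ), ‖deriv f y‖ₑ ^ 2)) := by
        gcongr
        exact enorm_sub_sq_le_lintegral_deriv hf x hδ.le
    _ = (ENNReal.ofReal δ * (ENNReal.ofReal δ)⁻¹) ^ 2 *
        ∫⁻ y in Set.Ioc x (x + δ), ‖deriv f y‖ₑ ^ 2 := by ring
    _ = ∫⁻ y in Set.Ioc x (x + δ), ‖deriv f y‖ₑ ^ 2 := by rw [hcancel, one_pow, one_mul]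

theorem eLpNorm_diffQuot_le (hf : ContDiff ℝ 1 f) (hδ : 0 < δ) :
    eLpNorm (diffQuot δ f) 2 volume ≤ eLpNorm (deriv f) 2 volume := by
  have hmeas : Measurable fun y => ‖deriv f y‖ₑ ^ 2 :=
    hf.continuous_deriv_one.enorm.measurable.pow_const 2
  have h := lintegral_mono (μ := volume) (enorm_diffQuot_sq_le hf hδ)
  rw [lintegral_const_mul' _ _ ENNReal.ofReal_ne_top, lintegral_setLIntegral_Ioc δ hmeas,
    ENNReal.mul_le_mul_iff_right (by simpa using hδ) ENNReal.ofReal_ne_top, ← eLpNorm_two_sq,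
    ← eLpNorm_two_sq] at h
  exact (ENNReal.pow_le_pow_left_iff two_ne_zero).1 h

theorem SmoothSobolevLE.diffQuot (hδ : 0 < δ) (h : SmoothSobolevLE (k + 1) r f) :
    SmoothSobolevLE k r (NLQW.diffQuot δ f) := by
  induction k generalizing f with
  | zero =>
    obtain ⟨hf, -, hf'⟩ := smoothSobolevLE_succ.1 h
    exact smoothSobolevLE_zero.2 ⟨contDiff_diffQuot hf δ,
      (eLpNorm_diffQuot_le (hf.of_le (by simp)) hδ).trans (smoothSobolevLE_zero.1 hf').2⟩
  | succ k ih =>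
    obtain ⟨hf, -, hf'⟩ := smoothSobolevLE_succ.1 h
    have hf₁ : ContDiff ℝ 1 f := hf.of_le (by simp)
    refine smoothSobolevLE_succ.2 ⟨contDiff_diffQuot hf δ,
      (eLpNorm_diffQuot_le hf₁ hδ).trans (smoothSobolevLE_succ.1 hf').2.1, ?_⟩
    rw [deriv_diffQuot hf₁]
    exact ih hf'

theorem SmoothSobolevLE.iterate_diffQuot (hδ : 0 < δ) (j : ℕ) (h : SmoothSobolevLE (k + j) r f) :
    SmoothSobolevLE k r ((NLQW.diffQuot δ)^[j] f) := by
  induction j generalizing f with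
  | zero => exact h
  | succ j ih =>
    rw [Function.iterate_succ_apply]
    exact ih (h.diffQuot hδ)

theorem tsum_enorm_sample_sq_le (hδ : 0 < δ) (hδ₁ : δ ≤ 1) (h : SmoothSobolevLE 1 r f) :
    ∑' n : ℤ, ENNReal.ofReal δ * ‖f (δ * n)‖ₑ ^ 2 ≤ ((2 * r : ℝ≥0) : ℝ≥0∞) ^ 2 := by
  obtain ⟨hf, hL2, hf'⟩ := smoothSobolevLE_succ.1 h
  have hsq (g : ℝ → E) (hg : eLpNorm g 2 volume ≤ r) : ∫⁻ y, ‖g y‖ₑ ^ 2 ≤ (r : ℝ≥0∞) ^ 2 := by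
    rw [← eLpNorm_two_sq]
    gcongr
  calc ∑' n : ℤ, ENNReal.ofReal δ * ‖f (δ * n)‖ₑ ^ 2
      ≤ ∑' n : ℤ, 2 * ((∫⁻ y in Set.Ioc (δ * n) (δ * n + δ), ‖f y‖ₑ ^ 2)
        + ENNReal.ofReal δ ^ 2 * ∫⁻ y in Set.Ioc (δ * n) (δ * n + δ), ‖deriv f y‖ₑ ^ 2) :=
        ENNReal.tsum_le_tsum fun n => enorm_sq_le_lintegral_add_deriv (hf.of_le (by simp)) _ _
    _ = 2 * ((∫⁻ y, ‖f y‖ₑ ^ 2) + ENNReal.ofReal δ ^ 2 * ∫⁻ y, ‖deriv f y‖ₑ ^ 2) := by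
        rw [ENNReal.tsum_mul_left, ENNReal.tsum_add, ENNReal.tsum_mul_left,
          tsum_setLIntegral_Ioc hδ, tsum_setLIntegral_Ioc hδ]
    _ ≤ 2 * ((r : ℝ≥0∞) ^ 2 + 1 ^ 2 * (r : ℝ≥0∞) ^ 2) := by
        gcongr
        · exact hsq f hL2
        · simpa using hδ₁
        · exact hsq _ (smoothSobolevLE_zero.1 hf').2
    _ = ((2 * r : ℝ≥0) : ℝ≥0∞) ^ 2 := by
        push_cast
        ring

theorem tsum_enorm_sample_diffQuot_sq_le (hδ : 0 < δ) (h : SmoothSobolevLE 1 r f) :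
    ∑' n : ℤ, ENNReal.ofReal δ * ‖NLQW.diffQuot δ f (δ * n)‖ₑ ^ 2 ≤ (r : ℝ≥0∞) ^ 2 := by
  obtain ⟨hf, -, hf'⟩ := smoothSobolevLE_succ.1 h
  calc ∑' n : ℤ, ENNReal.ofReal δ * ‖NLQW.diffQuot δ f (δ * n)‖ₑ ^ 2
      ≤ ∑' n : ℤ, ∫⁻ y in Set.Ioc (δ * n) (δ * n + δ), ‖deriv f y‖ₑ ^ 2 :=
        ENNReal.tsum_le_tsum fun n => enorm_diffQuot_sq_le (hf.of_le (by simp)) hδ _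
    _ = eLpNorm (deriv f) 2 volume ^ 2 := by rw [tsum_setLIntegral_Ioc hδ, eLpNorm_two_sq]
    _ ≤ (r : ℝ≥0∞) ^ 2 := pow_le_pow_left' (smoothSobolevLE_zero.1 hf').2 2

end DiffQuot

theorem exists_lattice_of_tsum_le {δ : ℝ} (hδ : 0 < δ) {a : ℤ → C2} {r : ℝ≥0}
    (h : ∑' n : ℤ, ENNReal.ofReal δ * ‖a n‖ₑ ^ 2 ≤ (r : ℝ≥0∞) ^ 2) :
    ∃ v : Lattice, (∀ n, v n = a n) ∧ √δ * ‖v‖ ≤ r := by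
  have hreal (n : ℤ) : ENNReal.ofReal δ * ‖a n‖ₑ ^ 2 = ENNReal.ofReal (δ * ‖a n‖ ^ 2) := by
    rw [ENNReal.ofReal_mul hδ.le, ENNReal.ofReal_pow (norm_nonneg _), ofReal_norm]
  simp_rw [hreal] at h
  have hsum : Summable fun n => δ * ‖a n‖ ^ 2 :=
    (ENNReal.summable_toReal (h.trans_lt (by simp : (r : ℝ≥0∞) ^ 2 < ⊤)).ne).congr fun n =>
      ENNReal.toReal_ofReal (by positivity)
  have hmem : Memℓp a 2 := memℓp_gen (by simpa using (summable_mul_left_iff hδ.ne').1 hsum)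
  let v : Lattice := ⟨a, hmem⟩
  have hnorm : ‖v‖ ^ 2 = ∑' n, ‖a n‖ ^ 2 := by
    simpa using lp.norm_rpow_eq_tsum (p := 2) (by norm_num) v
  refine ⟨v, fun n => rfl, le_of_sq_le_sq ?_ r.coe_nonneg⟩
  rw [← ENNReal.ofReal_tsum_of_nonneg (fun n => by positivity) hsum, ← ENNReal.coe_pow,
    ← ENNReal.ofReal_coe_nnreal, ENNReal.ofReal_le_ofReal_iff (NNReal.coe_nonneg _)] at h
  rw [mul_pow, Real.sq_sqrt hδ.le, hnorm, ← tsum_mul_left]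
  exact_mod_cast h

/-! ### Shannon interpolation -/

/-- The phase `e^{-2πiδnξ}`, the Fourier symbol of the translation by `n` lattice sites. -/
def phase (δ : ℝ) (n : ℤ) (ξ : ℝ) : ℂ :=
  Complex.exp (-(2 * Real.pi * (δ * n) * ξ : ℝ) * Complex.I)

section Phase

variable (δ : ℝ) (n j : ℤ) (ξ : ℝ)

theorem norm_phase : ‖phase δ n ξ‖ = 1 := by
  unfold phase
  rw [← Complex.ofReal_neg, Complex.norm_exp_ofReal_mul_I]

theorem continuous_phase : Continuous (phase δ n) := by
  unfold phase
  fun_prop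

theorem phase_mul : phase δ n ξ * phase δ j ξ = phase δ (n + j) ξ := by
  unfold phase
  rw [← Complex.exp_add]
  congr 1
  push_cast
  ring

theorem conj_phase : (starRingEnd ℂ) (phase δ n ξ) = phase δ (-n) ξ := by
  unfold phase
  rw [← Complex.exp_conj, map_mul, map_neg, Complex.conj_ofReal, Complex.conj_I]
  congr 1
  push_cast
  ring

theorem propSymbol_eq_phase :
    propSymbol δ ξ = phase δ 1 ξ • compProj 0 + phase δ (-1) ξ • compProj 1 := by
  simp [propSymbol, diagCLM, phase]

end Phase

theorem inv_two_mul_sub_neg (δ : ℝ) : 1 / (2 * δ) - -(1 / (2 * δ)) = δ⁻¹ := by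
  rw [sub_neg_eq_add, one_div, mul_inv]
  ring

theorem integral_band_phase {δ : ℝ} (hδ : 0 < δ) (j : ℤ) :
    ∫ ξ in band δ, phase δ j ξ = if j = 0 then (δ : ℂ)⁻¹ else 0 := by
  have hδ' : (δ : ℂ) ≠ 0 := by exact_mod_cast hδ.ne'
  rw [band, integral_Icc_eq_integral_Ioc,
    ← intervalIntegral.integral_of_le (neg_le_self (by positivity))]
  split_ifs with hj
  · simp only [hj, phase, Int.cast_zero, mul_zero, zero_mul, Complex.ofReal_zero, neg_zero,
      Complex.exp_zero, intervalIntegral.integral_const, inv_two_mul_sub_neg]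
    simp
  · have hc : (-(2 * Real.pi * (δ * j)) * Complex.I : ℂ) ≠ 0 := by
      simp [hδ.ne', hj, Real.pi_ne_zero]
    have hexp (ξ : ℝ) :
        phase δ j ξ = Complex.exp ((-(2 * Real.pi * (δ * j)) * Complex.I : ℂ) * ξ) := by
      unfold phase
      congr 1
      push_cast
      ring
    simp_rw [hexp]
    rw [integral_exp_mul_complex hc, div_eq_zero_iff, sub_eq_zero,
      Complex.exp_eq_exp_iff_exists_int]
    refine Or.inl ⟨-j, ?_⟩
    push_cast
    field_simp
    ring

/-- The scalar factor `χ_{band}(ξ) δ e^{-2πiδnξ}` of the wave of the site `δ n`. -/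
def bandPhase (δ : ℝ) (n : ℤ) : ℝ → ℂ := (band δ).indicator fun ξ => δ * phase δ n ξ

section BandWave

variable {δ : ℝ} {ξ : ℝ}

theorem bandPhase_of_mem (n : ℤ) (hξ : ξ ∈ band δ) : bandPhase δ n ξ = δ * phase δ n ξ :=
  Set.indicator_of_mem hξ _

theorem bandPhase_of_notMem (n : ℤ) (hξ : ξ ∉ band δ) : bandPhase δ n ξ = 0 :=
  Set.indicator_of_notMem hξ _

theorem phase_mul_bandPhase (δ : ℝ) (j n : ℤ) (ξ : ℝ) :
    phase δ j ξ * bandPhase δ n ξ = bandPhase δ (n + j) ξ := by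
  by_cases hξ : ξ ∈ band δ
  · rw [bandPhase_of_mem n hξ, bandPhase_of_mem _ hξ, ← phase_mul]
    ring
  · rw [bandPhase_of_notMem n hξ, bandPhase_of_notMem _ hξ, mul_zero]

theorem bandWaveFun_apply (δ : ℝ) (n : ℤ) (c : C2) (ξ : ℝ) :
    bandWaveFun δ n c ξ = bandPhase δ n ξ • c :=
  Set.indicator_smul_const_apply _ _ _ _

/-- The contribution of the site `δ n` to the lattice Fourier transform, as a linear function of
the value at that site. -/
def bandWave (δ : ℝ) (n : ℤ) : C2 →ₗ[ℂ] L2 where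
  toFun c := (memLp_bandWaveFun δ n c).toLp
  map_add' c c' := by
    rw [← MemLp.toLp_add]
    exact MemLp.toLp_congr _ _ <| ae_of_all _ fun ξ => by
      simp only [Pi.add_apply, bandWaveFun_apply, smul_add]
  map_smul' a c := by
    rw [RingHom.id_apply, ← MemLp.toLp_const_smul]
    exact MemLp.toLp_congr _ _ <| ae_of_all _ fun ξ => by
      simp only [Pi.smul_apply, bandWaveFun_apply, smul_comm a]

theorem coeFn_bandWave (δ : ℝ) (n : ℤ) (c : C2) :
    bandWave δ n c =ᵐ[volume] fun ξ => bandPhase δ n ξ • c :=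
  (memLp_bandWaveFun δ n c).coeFn_toLp.trans <| ae_of_all _ (bandWaveFun_apply δ n c)

theorem inner_bandWave_left (δ : ℝ) (n : ℤ) (c : C2) (f : L2) :
    inner ℂ (bandWave δ n c) f = δ * ∫ ξ in band δ, phase δ (-n) ξ * inner ℂ c (f ξ) := by
  rw [L2.inner_def, ← integral_const_mul, ← integral_indicator (measurableSet_band δ)]
  refine integral_congr_ae ?_
  filter_upwards [coeFn_bandWave δ n c] with ξ h
  rw [h, inner_smul_left]
  by_cases hξ : ξ ∈ band δ
  · rw [Set.indicator_of_mem hξ, bandPhase_of_mem n hξ, map_mul, conj_phase, Complex.conj_ofReal,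
      mul_assoc]
  · rw [Set.indicator_of_notMem hξ, bandPhase_of_notMem n hξ, map_zero, zero_mul]

theorem inner_bandWave_bandWave (hδ : 0 < δ) (n j : ℤ) (c c' : C2) :
    inner ℂ (bandWave δ n c) (bandWave δ j c') = if j = n then (δ : ℂ) * inner ℂ c c' else 0 := by
  have hδ' : (δ : ℂ) ≠ 0 := by exact_mod_cast hδ.ne'
  have hband : ∫ ξ in band δ, phase δ (-n) ξ * inner ℂ c (bandWave δ j c' ξ)
      = ∫ ξ in band δ, (δ * inner ℂ c c') * phase δ (j - n) ξ := by
    refine setIntegral_congr_ae (measurableSet_band δ) ?_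
    filter_upwards [coeFn_bandWave δ j c'] with ξ h hξ
    rw [h, bandPhase_of_mem j hξ, inner_smul_right, sub_eq_add_neg, ← phase_mul]
    ring
  rw [inner_bandWave_left, hband, integral_const_mul, integral_band_phase hδ]
  simp only [sub_eq_zero]
  split_ifs
  · field_simp
  · simp only [mul_zero]

theorem norm_bandWave (hδ : 0 < δ) (n : ℤ) (c : C2) : ‖bandWave δ n c‖ = √δ * ‖c‖ := by
  have hsq : ‖bandWave δ n c‖ ^ 2 = δ * ‖c‖ ^ 2 := by
    have h := inner_bandWave_bandWave hδ n n c c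
    rw [if_pos rfl, inner_self_eq_norm_sq_to_K, inner_self_eq_norm_sq_to_K] at h
    exact Complex.ofReal_injective (by push_cast; exact h)
  rw [← Real.sqrt_sq (norm_nonneg (bandWave δ n c)), hsq, Real.sqrt_mul hδ.le,
    Real.sqrt_sq (norm_nonneg c)]

/-- The wave of the site `δ n`, normalized to be isometric in the value at that site. -/
def bandIsometry (hδ : 0 < δ) (n : ℤ) : C2 →ₗᵢ[ℂ] L2 where
  toLinearMap := (√δ : ℂ)⁻¹ • bandWave δ n
  norm_map' c := by
    have hsqrt : 0 < √δ := Real.sqrt_pos.2 hδ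
    rw [LinearMap.smul_apply, norm_smul, norm_bandWave hδ, norm_inv, Complex.norm_real,
      Real.norm_of_nonneg hsqrt.le, inv_mul_cancel_left₀ hsqrt.ne']

theorem sqrt_smul_bandIsometry (hδ : 0 < δ) (n : ℤ) (c : C2) :
    (√δ : ℂ) • bandIsometry hδ n c = bandWave δ n c :=
  smul_inv_smul₀ (by exact_mod_cast (Real.sqrt_pos.2 hδ).ne') (bandWave δ n c)

theorem orthogonalFamily_bandIsometry (hδ : 0 < δ) :
    OrthogonalFamily ℂ (fun _ : ℤ => C2) (bandIsometry hδ) := by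
  intro n j hnj c c'
  change inner ℂ ((√δ : ℂ)⁻¹ • bandWave δ n c) ((√δ : ℂ)⁻¹ • bandWave δ j c') = 0
  rw [inner_smul_left, inner_smul_right, inner_bandWave_bandWave hδ, if_neg hnj.symm, mul_zero,
    mul_zero]

end BandWave

section Shannon

variable {δ : ℝ}

theorem hasSum_bandWave (hδ : 0 < δ) (v : Lattice) : HasSum (fun n => bandWave δ n (v n))
    ((√δ : ℂ) • (orthogonalFamily_bandIsometry hδ).linearIsometry v) := by
  simpa only [sqrt_smul_bandIsometry] using
    ((orthogonalFamily_bandIsometry hδ).hasSum_linearIsometry v).const_smul (√δ : ℂ)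

theorem latticeFourier_eq (hδ : 0 < δ) (v : Lattice) : latticeFourier δ v =
    (√δ : ℂ) • (orthogonalFamily_bandIsometry hδ).linearIsometry v :=
  (hasSum_bandWave hδ v).tsum_eq

theorem hasSum_latticeFourier (hδ : 0 < δ) (v : Lattice) :
    HasSum (fun n => bandWave δ n (v n)) (latticeFourier δ v) :=
  latticeFourier_eq hδ v ▸ hasSum_bandWave hδ v

theorem norm_latticeFourier (hδ : 0 < δ) (v : Lattice) : ‖latticeFourier δ v‖ = √δ * ‖v‖ := by
  rw [latticeFourier_eq hδ, norm_smul, LinearIsometry.norm_map, Complex.norm_real,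
    Real.norm_of_nonneg (Real.sqrt_nonneg _)]

theorem latticeFourier_sub (hδ : 0 < δ) (v v' : Lattice) :
    latticeFourier δ (v - v') = latticeFourier δ v - latticeFourier δ v' := by
  simp only [latticeFourier_eq hδ, map_sub, smul_sub]

theorem latticeFourier_smul (hδ : 0 < δ) (a : ℂ) (v : Lattice) :
    latticeFourier δ (a • v) = a • latticeFourier δ v := by
  simp only [latticeFourier_eq hδ, map_smul, smul_comm a]

theorem fourier_shannon (δ : ℝ) (v : Lattice) : (𝓕 (shannon δ v) : L2) = latticeFourier δ v :=
  FourierTransform.fourier_fourierInv_eq _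

theorem shannon_sub (hδ : 0 < δ) (v v' : Lattice) :
    shannon δ (v - v') = shannon δ v - shannon δ v' := by
  rw [shannon, latticeFourier_sub hδ]
  exact (Lp.fourierTransformₗᵢ ℝ C2).symm.map_sub _ _

theorem norm_shannon (hδ : 0 < δ) (v : Lattice) : ‖shannon δ v‖ = √δ * ‖v‖ := by
  rw [← Lp.norm_fourier_eq, fourier_shannon, norm_latticeFourier hδ]

theorem shannon_injective (hδ : 0 < δ) : Function.Injective (shannon δ) := fun v v' h => by
  have hnorm : √δ * ‖v - v'‖ = 0 := by
    rw [← norm_shannon hδ, shannon_sub hδ, h, sub_self, norm_zero]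
  exact sub_eq_zero.1 <| norm_eq_zero.1 <|
    (mul_eq_zero.1 hnorm).resolve_left (Real.sqrt_pos.2 hδ).ne'

theorem shannonInv_shannon (hδ : 0 < δ) (v : Lattice) : shannonInv δ (shannon δ v) = v :=
  Function.leftInverse_invFun (shannon_injective hδ) v

/-- Multiplication by `e^{-2πiδjξ} A`, which on lattice Fourier transforms is translation by `j`
sites followed by the sitewise action of `A`. -/
def phaseOp (δ : ℝ) (j : ℤ) (A : C2 →L[ℂ] C2) : L2 →L[ℂ] L2 :=
  mulOp (fun ξ => phase δ j ξ • A) <|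
    memLp_top_of_bound ((continuous_phase δ j).smul continuous_const).aestronglyMeasurable ‖A‖ <|
      ae_of_all _ fun ξ => by rw [norm_smul, norm_phase, one_mul]

theorem coeFn_phaseOp (δ : ℝ) (j : ℤ) (A : C2 →L[ℂ] C2) (f : L2) :
    phaseOp δ j A f =ᵐ[volume] fun ξ => phase δ j ξ • A (f ξ) :=
  coeFn_mulOp _ f

theorem phaseOp_bandWave (δ : ℝ) (j n : ℤ) (A : C2 →L[ℂ] C2) (c : C2) :
    phaseOp δ j A (bandWave δ n c) = bandWave δ (n + j) (A c) := by
  refine Lp.ext ?_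
  filter_upwards [coeFn_phaseOp δ j A (bandWave δ n c), coeFn_bandWave δ n c,
    coeFn_bandWave δ (n + j) (A c)] with ξ h₁ h₂ h₃
  rw [h₁, h₂, h₃, map_smul, smul_smul, phase_mul_bandPhase]

theorem hasSum_phaseOp_latticeFourier (hδ : 0 < δ) (j : ℤ) (A : C2 →L[ℂ] C2) (v : Lattice) :
    HasSum (fun n => bandWave δ n (A (v (n - j)))) (phaseOp δ j A (latticeFourier δ v)) := by
  rw [← (Equiv.addRight j).hasSum_iff]
  refine ((phaseOp δ j A).hasSum (hasSum_latticeFourier hδ v)).congr_fun fun n => ?_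
  simp only [Function.comp_apply, Equiv.coe_addRight, add_sub_cancel_right, phaseOp_bandWave]

theorem latticeFourier_translate (hδ : 0 < δ) (j : ℤ) {v v' : Lattice}
    (h : ∀ n, v' n = v (n - j)) :
    latticeFourier δ v' =ᵐ[volume] fun ξ => phase δ j ξ • latticeFourier δ v ξ := by
  have hsum := hasSum_phaseOp_latticeFourier hδ j (.id ℂ C2) v
  simp only [ContinuousLinearMap.id_apply, ← h] at hsum
  rw [(hasSum_latticeFourier hδ v').unique hsum]
  exact coeFn_phaseOp δ j _ _

theorem bandLimited_shannon (hδ : 0 < δ) (v : Lattice) : BandLimited δ (shannon δ v) := by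
  have hm : MemLp (fun ξ => (band δ)ᶜ.indicator (1 : ℝ → ℂ) ξ • ContinuousLinearMap.id ℂ C2) ∞
      volume :=
    memLp_top_smul_id (C := 1)
      (measurable_one.indicator (measurableSet_band δ).compl).aestronglyMeasurable
      fun ξ => (norm_indicator_le_norm_self _ ξ).trans_eq norm_one
  have hzero : mulOp _ hm (latticeFourier δ v) = 0 := by
    refine ((mulOp _ hm).hasSum (hasSum_latticeFourier hδ v)).unique ?_
    refine hasSum_zero.congr_fun fun n => Lp.ext ?_
    filter_upwards [coeFn_bandWave δ n (v n), coeFn_mulOp hm (bandWave δ n (v n)),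
      Lp.coeFn_zero C2 2 (volume : Measure ℝ)] with ξ h₁ h₂ h₃
    rw [h₂, h₃, h₁]
    by_cases hξ : ξ ∈ band δ
    · simp [hξ]
    · simp [bandPhase_of_notMem n hξ]
  have hmul := coeFn_mulOp hm (latticeFourier δ v)
  rw [hzero] at hmul
  rw [BandLimited, fourier_shannon]
  filter_upwards [hmul, Lp.coeFn_zero C2 2 (volume : Measure ℝ)] with ξ h₁ h₂ hξ
  simpa [h₂, hξ] using h₁.symm

theorem propOp_eq_phaseOp_add (δ : ℝ) (f : L2) :
    propOp δ f = phaseOp δ 1 (compProj 0) f + phaseOp δ (-1) (compProj 1) f := by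
  refine Lp.ext ?_
  filter_upwards [coeFn_propOp δ f, coeFn_phaseOp δ 1 (compProj 0) f,
    coeFn_phaseOp δ (-1) (compProj 1) f,
    Lp.coeFn_add (phaseOp δ 1 (compProj 0) f) (phaseOp δ (-1) (compProj 1) f)]
    with ξ h₁ h₂ h₃ h₄
  rw [h₄, Pi.add_apply, h₁, h₂, h₃, propSymbol_eq_phase]
  rfl

theorem shift_apply (v : Lattice) (n : ℤ) :
    shift v n = compProj 0 (v (n - 1)) + compProj 1 (v (n - -1)) :=
  C2.ext (by simp [shift, compProj_apply]) (by simp [shift, compProj_apply])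

theorem shannon_shift (hδ : 0 < δ) (v : Lattice) : shannon δ (shift v) = prop δ (shannon δ v) := by
  have hsum := (hasSum_phaseOp_latticeFourier hδ 1 (compProj 0) v).add
    (hasSum_phaseOp_latticeFourier hδ (-1) (compProj 1) v)
  simp only [← map_add, ← shift_apply, ← propOp_eq_phaseOp_add] at hsum
  rw [prop, fourier_shannon, shannon, (hasSum_latticeFourier hδ (shift v)).unique hsum]

end Shannon

/-! ### The sampling theorem -/

section Sampling

variable {δ : ℝ} {w : L2}

theorem inner_bandWave_latticeFourier (hδ : 0 < δ) (n : ℤ) (c : C2) (v : Lattice) :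
    inner ℂ (bandWave δ n c) (latticeFourier δ v) = δ * inner ℂ c (v n) := by
  refine ((innerSL ℂ (bandWave δ n c)).hasSum (hasSum_latticeFourier hδ v)).unique ?_
  refine (hasSum_ite_eq n ((δ : ℂ) * inner ℂ c (v n))).congr_fun fun j => ?_
  rw [innerSL_apply_apply, inner_bandWave_bandWave hδ]
  split_ifs with h
  · rw [h]
  · rfl

theorem fourierInv_sample (δ : ℝ) (n : ℤ) (f : ℝ → C2) :
    𝓕⁻ f (δ * n) = ∫ ξ, phase δ (-n) ξ • f ξ := by
  rw [Real.fourierInv_eq']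
  refine integral_congr_ae (ae_of_all _ fun ξ => ?_)
  simp only [phase]
  congr 2
  simp
  ring_nf

theorem inner_bandWave_fourier (hw : BandLimited δ w) (n : ℤ) (c : C2) :
    inner ℂ (bandWave δ n c) (𝓕 w : L2)
      = δ * inner ℂ c (𝓕⁻ ((𝓕 w : L2) : ℝ → C2) (δ * n)) := by
  have hint : Integrable (fun ξ => phase δ (-n) ξ • (𝓕 w : L2) ξ) volume :=
    hw.integrable_fourier.bdd_smul 1 (continuous_phase δ (-n)).aestronglyMeasurable
      (ae_of_all _ fun ξ => (norm_phase δ (-n) ξ).le)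
  rw [inner_bandWave_left, fourierInv_sample, ← integral_inner hint,
    ← integral_indicator (measurableSet_band δ)]
  refine congrArg _ (integral_congr_ae ?_)
  filter_upwards [hw] with ξ h
  by_cases hξ : ξ ∈ band δ
  · rw [Set.indicator_of_mem hξ, inner_smul_right]
  · rw [Set.indicator_of_notMem hξ, h hξ, smul_zero, inner_zero_right]

theorem ae_eq_zero_of_fourierCoeffOn_eq_zero {a b : ℝ} (hab : a < b) {f : ℝ → ℂ}
    (hf : MemLp f 2 (volume.restrict (Set.Ioc a b))) (h : ∀ n, fourierCoeffOn hab f n = 0) :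
    f =ᵐ[volume.restrict (Set.Ioc a b)] 0 := by
  have hsum := hasSum_sq_fourierCoeffOn hab hf
  simp only [h, norm_zero, ne_eq, OfNat.ofNat_ne_zero, not_false_eq_true, zero_pow] at hsum
  have hzero := hsum.unique hasSum_zero
  rw [smul_eq_zero, or_iff_right (inv_ne_zero (sub_pos.2 hab).ne'),
    intervalIntegral.integral_of_le hab.le,
    integral_eq_zero_iff_of_nonneg (fun _ => by positivity)
      (by simpa using hf.integrable_norm_pow (by norm_num))] at hzero
  filter_upwards [hzero] with x hx
  simpa using hx

theorem fourierCoeffOn_band (hδ : 0 < δ) (f : ℝ → ℂ) (n : ℤ) :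
    fourierCoeffOn (neg_lt_self (by positivity : 0 < 1 / (2 * δ))) f n
      = δ * ∫ ξ in band δ, phase δ n ξ * f ξ := by
  rw [fourierCoeffOn_eq_integral, intervalIntegral.integral_of_le (neg_le_self (by positivity)),
    ← integral_Icc_eq_integral_Ioc, inv_two_mul_sub_neg, one_div, inv_inv, Complex.real_smul]
  refine congrArg _ (integral_congr_ae (ae_of_all _ fun ξ => ?_))
  simp only [smul_eq_mul]
  rw [fourier_coe_apply, phase]
  congr 2
  push_cast
  field_simp

theorem eq_zero_of_inner_bandWave_eq_zero (hδ : 0 < δ) {f : L2}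
    (hf : ∀ᵐ ξ, ξ ∉ band δ → f ξ = 0) (h : ∀ n c, inner ℂ (bandWave δ n c) f = 0) : f = 0 := by
  have hcomp (i : Fin 2) : ∀ᵐ ξ, ξ ∈ band δ → f ξ i = 0 := by
    rw [← ae_restrict_iff' (measurableSet_band δ), band, ← restrict_Ioc_eq_restrict_Icc]
    refine ae_eq_zero_of_fourierCoeffOn_eq_zero (neg_lt_self (by positivity))
      (((EuclideanSpace.proj i : C2 →L[ℂ] ℂ).comp_memLp' (Lp.memLp f)).restrict _) fun n => ?_
    have hn := h (-n) (EuclideanSpace.single i 1)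
    simp only [inner_bandWave_left, neg_neg, EuclideanSpace.inner_single_left, map_one,
      one_mul] at hn
    rw [fourierCoeffOn_band hδ]
    exact hn
  refine Lp.ext ?_
  filter_upwards [hcomp 0, hcomp 1, hf, Lp.coeFn_zero C2 2 (volume : Measure ℝ)]
    with ξ h₀ h₁ hout hzero
  rw [hzero]
  by_cases hξ : ξ ∈ band δ
  · exact C2.ext (h₀ hξ) (h₁ hξ)
  · exact hout hξ

theorem BandLimited.shannon_eq (hδ : 0 < δ) (hw : BandLimited δ w) {v : Lattice}
    (hv : ∀ n : ℤ, v n = 𝓕⁻ ((𝓕 w : L2) : ℝ → C2) (δ * n)) : shannon δ v = w := by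
  suffices hF : latticeFourier δ v = 𝓕 w by
    rw [shannon, hF, FourierTransform.fourierInv_fourier_eq]
  rw [← sub_eq_zero]
  refine eq_zero_of_inner_bandWave_eq_zero hδ ?_ fun n c => ?_
  · have hs := bandLimited_shannon hδ v
    rw [BandLimited, fourier_shannon] at hs
    filter_upwards [hs, hw, Lp.coeFn_sub (latticeFourier δ v) (𝓕 w : L2)] with ξ h₁ h₂ h₃ hξ
    rw [h₃, Pi.sub_apply, h₁ hξ, h₂ hξ, sub_zero]
  · rw [inner_sub_right, inner_bandWave_latticeFourier hδ, inner_bandWave_fourier hw, hv, sub_self]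

end Sampling

/-! ### Stability of interpolation in Sobolev norms -/

/-- The Fourier symbol of the forward difference quotient. -/
def diffSymbol (δ ξ : ℝ) : ℂ := (δ : ℂ)⁻¹ * (phase δ (-1) ξ - 1)

section Stability

variable {δ : ℝ}

theorem norm_diffSymbol (hδ : 0 < δ) (ξ : ℝ) :
    ‖diffSymbol δ ξ‖ = δ⁻¹ * (2 * |Real.sin (Real.pi * δ * ξ)|) := by
  have hphase : phase δ (-1) ξ = Complex.exp (Complex.I * ((2 * Real.pi * δ * ξ : ℝ) : ℂ)) := by
    unfold phase
    congr 1
    push_cast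
    ring
  rw [diffSymbol, norm_mul, norm_inv, Complex.norm_real, Real.norm_of_nonneg hδ.le, hphase,
    Complex.norm_exp_I_mul_ofReal_sub_one, Real.norm_eq_abs, abs_mul, abs_two]
  congr 4
  ring

theorem two_pi_mul_abs_le (hδ : 0 < δ) {ξ : ℝ} (hξ : ξ ∈ band δ) :
    2 * Real.pi * |ξ| ≤ 2 * ‖diffSymbol δ ξ‖ := by
  have hle : |ξ| ≤ 1 / (2 * δ) := abs_le.2 hξ
  have habs : |Real.pi * δ * ξ| = Real.pi * δ * |ξ| := by
    rw [abs_mul, abs_of_pos (by positivity)]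
  have hjordan : 2 / Real.pi * |Real.pi * δ * ξ| ≤ |Real.sin (Real.pi * δ * ξ)| := by
    refine Real.mul_abs_le_abs_sin ?_
    calc |Real.pi * δ * ξ| ≤ Real.pi * δ * (1 / (2 * δ)) := by
          rw [habs]
          gcongr
      _ = Real.pi / 2 := by field_simp
  calc 2 * Real.pi * |ξ| ≤ 8 * |ξ| := by nlinarith [Real.pi_le_four, abs_nonneg ξ]
    _ = 2 * (δ⁻¹ * (2 * (2 / Real.pi * |Real.pi * δ * ξ|))) := by
      rw [habs]
      field_simp
      ring
    _ ≤ 2 * ‖diffSymbol δ ξ‖ := by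
      rw [norm_diffSymbol hδ]
      gcongr

theorem weight_le_add_norm_diffSymbol_pow (hδ : 0 < δ) (k : ℕ) {ξ : ℝ} (hξ : ξ ∈ band δ) :
    weight k ξ ≤ 2 ^ k + 4 ^ k * ‖diffSymbol δ ξ‖ ^ k := by
  set d := ‖diffSymbol δ ξ‖
  have hd : 0 ≤ d := norm_nonneg _
  have hbase : 1 + 2 * Real.pi * |ξ| ≤ 2 * max 1 (2 * d) := by
    linarith [two_pi_mul_abs_le hδ hξ, le_max_left 1 (2 * d), le_max_right 1 (2 * d)]
  calc weight k ξ ≤ (2 * max 1 (2 * d)) ^ k := pow_le_pow_left₀ (by positivity) hbase _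
    _ = 2 ^ k * max 1 (2 * d) ^ k := mul_pow _ _ _
    _ ≤ 2 ^ k * (1 + (2 * d) ^ k) := by
        gcongr
        rcases max_choice 1 (2 * d) with hmax | hmax <;> rw [hmax]
        · simpa using pow_nonneg (mul_nonneg zero_le_two hd) k
        · exact le_add_of_nonneg_left zero_le_one
    _ = 2 ^ k + 4 ^ k * d ^ k := by
        rw [mul_add, mul_one, ← mul_pow, ← mul_assoc, mul_pow]
        norm_num

theorem exists_lattice_iterate_diffQuot (hδ : 0 < δ) {f : ℝ → C2} {v : Lattice}
    (hv : ∀ n : ℤ, v n = f (δ * n)) (j : ℕ) :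
    ∃ v' : Lattice, (∀ n : ℤ, v' n = (NLQW.diffQuot δ)^[j] f (δ * n)) ∧
      latticeFourier δ v' =ᵐ[volume] fun ξ => diffSymbol δ ξ ^ j • latticeFourier δ v ξ := by
  induction j with
  | zero => exact ⟨v, hv, by simp⟩
  | succ j ih =>
    obtain ⟨v', hv', hF⟩ := ih
    set τv' : Lattice :=
      ⟨fun n => v' (n - -1), memℓp_comp (lp.memℓp v') (Equiv.subRight (-1))⟩
    refine ⟨(δ : ℂ)⁻¹ • (τv' - v'), fun n => ?_, ?_⟩
    · change (δ : ℂ)⁻¹ • (v' (n - -1) - v' n) = _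
      rw [Function.iterate_succ_apply', NLQW.diffQuot, hv', hv', ← Complex.ofReal_inv,
        Complex.coe_smul]
      congr 3
      push_cast
      ring_nf
    · rw [latticeFourier_smul hδ, latticeFourier_sub hδ]
      filter_upwards [hF, latticeFourier_translate hδ (-1) (v := v') (v' := τv') (fun _ => rfl),
        Lp.coeFn_smul (δ : ℂ)⁻¹ (latticeFourier δ τv' - latticeFourier δ v'),
        Lp.coeFn_sub (latticeFourier δ τv') (latticeFourier δ v')] with ξ h₁ h₂ h₃ h₄
      rw [h₃, Pi.smul_apply, h₄, Pi.sub_apply, h₂, h₁, pow_succ, diffSymbol]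
      module

theorem norm_latticeFourier_le_of_tsum_le (hδ : 0 < δ) {v : Lattice} {r : ℝ≥0}
    (h : ∑' n : ℤ, ENNReal.ofReal δ * ‖v n‖ₑ ^ 2 ≤ (r : ℝ≥0∞) ^ 2) :
    ‖latticeFourier δ v‖ ≤ r := by
  obtain ⟨u, hu, hle⟩ := exists_lattice_of_tsum_le hδ h
  rw [norm_latticeFourier hδ]
  rwa [lp.ext (funext hu)] at hle

theorem SmoothSobolevLE.sobolevLE_shannon {k : ℕ} (hδ : 0 < δ) (hδ₁ : δ ≤ 1) {f : ℝ → C2}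
    {r : ℝ≥0} (h : SmoothSobolevLE (k + 1) r f) {v : Lattice} (hv : ∀ n : ℤ, v n = f (δ * n)) :
    SobolevLE (k + 1) (3 * 4 ^ (k + 1) * r) (shannon δ v) := fun N => by
  obtain ⟨v', hv', hF⟩ := exists_lattice_iterate_diffQuot hδ hv (k + 1)
  have hnorm : ‖latticeFourier δ v‖ ≤ (2 * r : ℝ≥0) := by
    refine norm_latticeFourier_le_of_tsum_le hδ ?_
    simpa only [hv] using tsum_enorm_sample_sq_le hδ hδ₁ (h.mono (Nat.le_add_left 1 k) le_rfl)
  have hnorm' : ‖latticeFourier δ v'‖ ≤ r := by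
    refine norm_latticeFourier_le_of_tsum_le hδ ?_
    simpa only [hv', Function.iterate_succ_apply'] using tsum_enorm_sample_diffQuot_sq_le hδ
      (SmoothSobolevLE.iterate_diffQuot (k := 1) hδ k (by rwa [add_comm]))
  have hle : ‖weightOp (k + 1) N (latticeFourier δ v)‖
      ≤ ‖(2 : ℝ) ^ (k + 1) • latticeFourier δ v‖ + ‖(4 : ℝ) ^ (k + 1) • latticeFourier δ v'‖ := by
    have hband := bandLimited_shannon hδ v
    rw [BandLimited, fourier_shannon] at hband
    refine norm_le_add_of_ae_le_add ?_
    filter_upwards [hF, hband, coeFn_weightOp (k + 1) N (latticeFourier δ v),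
      Lp.coeFn_smul ((2 : ℝ) ^ (k + 1)) (latticeFourier δ v),
      Lp.coeFn_smul ((4 : ℝ) ^ (k + 1)) (latticeFourier δ v')] with ξ h₁ h₂ h₃ h₄ h₅
    rw [h₃, h₄, h₅, Pi.smul_apply, Pi.smul_apply, h₁]
    by_cases hξ : ξ ∈ band δ
    · simp only [norm_smul, norm_pow, Real.norm_ofNat]
      rw [← mul_assoc, ← add_mul]
      exact mul_le_mul_of_nonneg_right ((norm_truncWeight_le _ _ _).trans
        (weight_le_add_norm_diffSymbol_pow hδ (k + 1) hξ)) (norm_nonneg _)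
    · simp only [h₂ hξ, smul_zero, norm_zero, add_zero, le_refl]
  rw [fourier_shannon]
  calc ‖weightOp (k + 1) N (latticeFourier δ v)‖
      ≤ 2 ^ (k + 1) * ‖latticeFourier δ v‖ + 4 ^ (k + 1) * ‖latticeFourier δ v'‖ := by
        simpa only [norm_smul, norm_pow, Real.norm_ofNat] using hle
    _ ≤ 4 ^ (k + 1) * (2 * r : ℝ≥0) + 4 ^ (k + 1) * r := by
        gcongr
        norm_num
    _ = 3 * 4 ^ (k + 1) * r := by
        push_cast
        ring

end Stability

/-! ### The interpolation error -/

/-- The pointwise inverse Fourier transform of `𝓕 w`. If `w` is band-limited, this is the smooth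
representative of `w`, at which samples on the lattice are taken. -/
def smoothRep (w : L2) : ℝ → C2 := 𝓕⁻ ((𝓕 w : L2) : ℝ → C2)

section Interpolation

variable {k : ℕ} {δ : ℝ} {w : L2}

theorem BandLimited.contDiff_smoothRep (hw : BandLimited δ w) : ContDiff ℝ ∞ (smoothRep w) :=
  hw.contDiff_fourierInv

theorem BandLimited.ae_eq_smoothRep (hw : BandLimited δ w) : w =ᵐ[volume] smoothRep w :=
  hw.ae_eq_fourierInv

theorem BandLimited.smoothSobolevLE_smoothRep (hw : BandLimited δ w) {r : ℝ≥0}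
    (h : SobolevLE k r w) : SmoothSobolevLE k r (smoothRep w) :=
  h.smoothSobolevLE hw.contDiff_smoothRep hw.ae_eq_smoothRep

theorem SmoothSobolevLE.exists_sample {f : ℝ → C2} {r : ℝ≥0} (hδ : 0 < δ) (hδ₁ : δ ≤ 1)
    (h : SmoothSobolevLE (k + 1) r f) : ∃ v : Lattice, ∀ n : ℤ, v n = f (δ * n) := by
  obtain ⟨v, hv, -⟩ := exists_lattice_of_tsum_le hδ
    (tsum_enorm_sample_sq_le hδ hδ₁ (h.mono (Nat.le_add_left 1 k) le_rfl))
  exact ⟨v, hv⟩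

theorem smoothRep_shannon (hδ : 0 < δ) (v : Lattice) (n : ℤ) :
    smoothRep (shannon δ v) (δ * n) = v n := by
  refine ext_inner_left ℂ fun c => ?_
  have h := inner_bandWave_latticeFourier hδ n c v
  rw [← fourier_shannon, inner_bandWave_fourier (bandLimited_shannon hδ v)] at h
  exact mul_left_cancel₀ (by exact_mod_cast hδ.ne') h

theorem shannon_smul (hδ : 0 < δ) (c : ℂ) (v : Lattice) :
    shannon δ (c • v) = c • shannon δ v := by
  rw [shannon, latticeFourier_smul hδ, FourierTransform.fourierInv_smul, shannon]

theorem shannon_add (hδ : 0 < δ) (v v' : Lattice) :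
    shannon δ (v + v') = shannon δ v + shannon δ v' := by
  rw [eq_comm, ← eq_sub_iff_add_eq, ← shannon_sub hδ, add_sub_cancel_right]

theorem BandLimited.exists_shannon_eq (hδ : 0 < δ) (hδ₁ : δ ≤ 1) (hw : BandLimited δ w) {r : ℝ}
    (h : SobolevLE (k + 1) r w) : ∃ v : Lattice, shannon δ v = w := by
  lift r to ℝ≥0 using h.nonneg
  obtain ⟨v, hv⟩ := (hw.smoothSobolevLE_smoothRep h).exists_sample hδ hδ₁
  exact ⟨v, hw.shannon_eq hδ hv⟩

/- Interpolation reproduces the band-limited part `b` of `w`, so the error is that of the remainder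
`w - b`, which is of size `δ` in `H^(k + 1)` and on which interpolation is bounded. -/
theorem SmoothSobolevLE.sobolevLE_shannon_sub (hδ : 0 < δ) (hδ₁ : δ ≤ 1) {f : ℝ → C2} {r : ℝ≥0}
    (h : SmoothSobolevLE (k + 2) r f) (hw : w =ᵐ[volume] f) {v : Lattice}
    (hv : ∀ n : ℤ, v n = f (δ * n)) :
    SobolevLE (k + 1) (δ * ((3 * 4 ^ (k + 1) + 1) * 2 ^ (k + 2) * r)) (shannon δ v - w) := by
  lift δ to ℝ≥0 using hδ.le
  have hS := h.sobolevLE hw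
  set b := bandLimit δ w
  have hb : BandLimited δ b := bandLimited_bandLimit δ w
  obtain ⟨vb, hvb⟩ := hb.exists_shannon_eq hδ hδ₁ (hS.bandLimit δ)
  have hrem : SobolevLE (k + 1) (δ * (2 ^ (k + 2) * r) : ℝ≥0) (w - b) := by
    simpa using hS.sub_bandLimit hδ
  have hsmooth : SmoothSobolevLE (k + 1) (δ * (2 ^ (k + 2) * r)) fun x => f x - smoothRep b x := by
    refine hrem.smoothSobolevLE (h.contDiff.sub hb.contDiff_smoothRep) ?_
    filter_upwards [Lp.coeFn_sub w b, hw, hb.ae_eq_smoothRep] with x h₁ h₂ h₃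
    rw [h₁, Pi.sub_apply, h₂, h₃]
  have hinterp := hsmooth.sobolevLE_shannon hδ hδ₁ (v := v - vb) fun n => by
    rw [lp.coeFn_sub, Pi.sub_apply, hv, ← smoothRep_shannon hδ vb, hvb]
  rw [shannon_sub hδ, hvb] at hinterp
  have hdiff := hinterp.sub hrem
  rw [sub_sub_sub_cancel_right] at hdiff
  refine hdiff.mono (le_of_eq ?_)
  push_cast
  ring

end Interpolation

/-! ### Superposition operators on Sobolev classes -/

section Superposition

theorem SobolevLE.ae_norm_le {k : ℕ} {w : L2} {r : ℝ} (h : SobolevLE (k + 1) r w) :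
    ∀ᵐ x, ‖w x‖ ≤ 2 * r := by
  lift r to ℝ≥0 using h.nonneg
  have hlim := (h.mono_order (Nat.le_add_left 1 k)).tendsto_bandLimit
  obtain ⟨ns, -, hns⟩ := (tendstoInMeasure_of_tendsto_Lp hlim).exists_seq_tendsto_ae
  have hbound (n : ℕ) : ∀ᵐ x, ‖NLQW.bandLimit (1 / ((n : ℝ) + 1)) w x‖ ≤ 2 * r := by
    have hbl := bandLimited_bandLimit (1 / ((n : ℝ) + 1)) w
    filter_upwards [hbl.ae_eq_smoothRep] with x hx
    rw [hx]
    exact_mod_cast (hbl.smoothSobolevLE_smoothRep (h.bandLimit _)).norm_le x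
  filter_upwards [hns, ae_all_iff.2 hbound] with x h₁ h₂
  exact le_of_tendsto h₁.norm (Eventually.of_forall fun n => h₂ _)

theorem bandLimit_sub (δ : ℝ) (a b : L2) : bandLimit δ (a - b) = bandLimit δ a - bandLimit δ b := by
  refine (Lp.fourierTransformₗᵢ ℝ C2).injective (Lp.ext ?_)
  change ((𝓕 (bandLimit δ (a - b)) : L2) : ℝ → C2) =ᵐ[volume]
    (𝓕 (bandLimit δ a - bandLimit δ b) : L2)
  rw [fourier_sub]
  filter_upwards [coeFn_fourier_bandLimit δ (a - b), coeFn_fourier_bandLimit δ a,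
    coeFn_fourier_bandLimit δ b, Lp.coeFn_sub (𝓕 a : L2) (𝓕 b : L2),
    Lp.coeFn_sub (𝓕 (bandLimit δ a) : L2) (𝓕 (bandLimit δ b) : L2)] with ξ h₁ h₂ h₃ h₄ h₅
  rw [h₁, h₅, Pi.sub_apply, h₂, h₃, fourier_sub]
  by_cases hξ : ξ ∈ band δ
  · simp only [Set.indicator_of_mem hξ, h₄, Pi.sub_apply]
  · simp only [Set.indicator_of_notMem hξ, sub_zero]

theorem exists_norm_sub_le_of_contDiff {E F : Type u} [NormedAddCommGroup E] [NormedSpace ℝ E]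
    [FiniteDimensional ℝ E] [NormedAddCommGroup F] [NormedSpace ℝ F] [CompleteSpace F]
    {H : E → F} (hH : ContDiff ℝ ∞ H) (R : ℝ≥0) :
    ∃ M : ℝ≥0, ∀ x y, ‖x‖ ≤ R → ‖y‖ ≤ R → ‖H x - H y‖ ≤ M * ‖x - y‖ := by
  have : ProperSpace E := .of_locallyCompactSpace ℝ
  obtain ⟨B, hB, hBeq⟩ := exists_contDiff_sub_eq_clm_apply hH
  obtain ⟨M, hM⟩ := exists_nnnorm_le_of_continuous hB.continuous R
  refine ⟨M, fun x y hx hy => ?_⟩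
  rw [hBeq]
  exact (B (x, y)).le_of_opNorm_le (hM _ (max_le hx hy)) _

variable {Q : Type} [NormedAddCommGroup Q] [NormedSpace ℝ Q] [FiniteDimensional ℝ Q]
  {H : Q × C2 → C2} {q : ℝ → Q} {R : ℝ≥0} {k : ℕ} {a b : L2}

theorem tendsto_superposition_sub (hH : ContDiff ℝ ∞ H) (hq : ∀ x, ‖q x‖ ≤ R)
    {a' b' F : ℕ → L2} {f : L2} (ha : ∀ᵐ x, ‖a x‖ ≤ R) (hb : ∀ᵐ x, ‖b x‖ ≤ R)
    (ha' : ∀ n, ∀ᵐ x, ‖a' n x‖ ≤ R) (hb' : ∀ n, ∀ᵐ x, ‖b' n x‖ ≤ R)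
    (hlima : Tendsto a' atTop (𝓝 a)) (hlimb : Tendsto b' atTop (𝓝 b))
    (hF : ∀ n, F n =ᵐ[volume] fun x => H (q x, a' n x) - H (q x, b' n x))
    (hf : f =ᵐ[volume] fun x => H (q x, a x) - H (q x, b x)) : Tendsto F atTop (𝓝 f) := by
  obtain ⟨M, hM⟩ := exists_norm_sub_le_of_contDiff hH R
  have hLip {x : ℝ} {y z : C2} (hy : ‖y‖ ≤ R) (hz : ‖z‖ ≤ R) :
      ‖H (q x, y) - H (q x, z)‖ ≤ M * ‖y - z‖ := by
    simpa [Prod.norm_def] using hM (q x, y) (q x, z) (max_le (hq x) hy) (max_le (hq x) hz)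
  have hdist (n : ℕ) : ‖F n - f‖ ≤ ‖(M : ℝ) • (a' n - a)‖ + ‖(M : ℝ) • (b' n - b)‖ := by
    refine norm_le_add_of_ae_le_add ?_
    filter_upwards [hF n, hf, Lp.coeFn_sub (F n) f, ha, hb, ha' n, hb' n,
      Lp.coeFn_sub (a' n) a, Lp.coeFn_sub (b' n) b, Lp.coeFn_smul (M : ℝ) (a' n - a),
      Lp.coeFn_smul (M : ℝ) (b' n - b)] with x h₁ h₂ h₃ h₄ h₅ h₆ h₇ h₈ h₉ h₁₀ h₁₁
    rw [h₃, h₁₀, h₁₁, Pi.sub_apply, Pi.smul_apply, Pi.smul_apply, h₁, h₂, h₈, h₉, Pi.sub_apply,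
      Pi.sub_apply, norm_smul, norm_smul, NNReal.norm_eq, sub_sub_sub_comm]
    exact (norm_sub_le _ _).trans (add_le_add (hLip h₆ h₄) (hLip h₇ h₅))
  rw [tendsto_iff_norm_sub_tendsto_zero] at hlima hlimb ⊢
  refine squeeze_zero (fun _ => norm_nonneg _) hdist ?_
  simpa [norm_smul] using (hlima.const_mul (M : ℝ)).add (hlimb.const_mul (M : ℝ))

theorem exists_sobolevLE_superposition_sub_of_bandLimited (hH : ContDiff ℝ ∞ H) (k : ℕ)
    (R ρ : ℝ≥0) :
    ∃ C : ℝ≥0, ∀ (q : ℝ → Q) (a b : L2) (η δ : ℝ), SmoothCoeffLE (k + 1) R q →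
      BandLimited δ a → BandLimited δ b → SobolevLE (k + 1) ρ a → SobolevLE (k + 1) ρ b →
      SobolevLE (k + 1) η (a - b) →
      ∃ F : L2, (F =ᵐ[volume] fun x => H (q x, a x) - H (q x, b x)) ∧
        SobolevLE (k + 1) (C * η) F := by
  obtain ⟨C, hC⟩ := exists_smoothSobolevLE_superposition_sub hH (k + 1) (R + 2 * ρ)
  refine ⟨2 ^ (k + 1) * C, fun q a b η δ hq hba hbb ha hb hab => ?_⟩
  lift η to ℝ≥0 using hab.nonneg
  have hcoeff {c : L2} (hbc : BandLimited δ c) (hc : SobolevLE (k + 1) ρ c) :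
      SmoothCoeffLE (k + 1) (R + 2 * ρ) (smoothRep c) :=
    (hbc.smoothSobolevLE_smoothRep hc).smoothCoeffLE.mono le_rfl le_add_self
  have hsub : SmoothSobolevLE (k + 1) η fun x => smoothRep a x - smoothRep b x := by
    refine hab.smoothSobolevLE (hba.contDiff_smoothRep.sub hbb.contDiff_smoothRep) ?_
    filter_upwards [Lp.coeFn_sub a b, hba.ae_eq_smoothRep, hbb.ae_eq_smoothRep] with x h₁ h₂ h₃
    rw [h₁, Pi.sub_apply, h₂, h₃]
  have hdiff := hC q _ _ (hq.mono le_rfl le_self_add) (hcoeff hba ha) (hcoeff hbb hb) η hsub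
  obtain ⟨F, hF⟩ := hdiff.exists_ae_eq
  refine ⟨F, ?_, (hdiff.sobolevLE hF).mono (le_of_eq ?_)⟩
  · filter_upwards [hF, hba.ae_eq_smoothRep, hbb.ae_eq_smoothRep] with x h₁ h₂ h₃
    rw [h₁, h₂, h₃]
  · push_cast
    ring

theorem exists_sobolevLE_superposition_sub (hH : ContDiff ℝ ∞ H) (k : ℕ) (R ρ : ℝ≥0) :
    ∃ C : ℝ≥0, ∀ (q : ℝ → Q) (a b f : L2) (η : ℝ), SmoothCoeffLE (k + 1) R q →
      SobolevLE (k + 1) ρ a → SobolevLE (k + 1) ρ b → SobolevLE (k + 1) η (a - b) →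
      (f =ᵐ[volume] fun x => H (q x, a x) - H (q x, b x)) → SobolevLE (k + 1) (C * η) f := by
  obtain ⟨C, hC⟩ := exists_sobolevLE_superposition_sub_of_bandLimited hH k R ρ
  refine ⟨C, fun q a b f η hq ha hb hab hf => ?_⟩
  have happrox (n : ℕ) := hC q _ _ η (1 / ((n : ℝ) + 1)) hq (bandLimited_bandLimit _ a)
    (bandLimited_bandLimit _ b) (ha.bandLimit _) (hb.bandLimit _)
    (by rw [← bandLimit_sub]; exact hab.bandLimit _)
  choose F hF hFle using happrox
  have hbound {c : L2} (hc : SobolevLE (k + 1) ρ c) : ∀ᵐ x, ‖c x‖ ≤ (R + 2 * ρ : ℝ≥0) := by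
    filter_upwards [hc.ae_norm_le] with x hx
    push_cast
    exact hx.trans (le_add_of_nonneg_left R.coe_nonneg)
  have hq' (x : ℝ) : ‖q x‖ ≤ (R + 2 * ρ : ℝ≥0) := (hq.norm_le x).trans (by simp)
  refine SobolevLE.of_tendsto hFle (tendsto_superposition_sub hH hq' (hbound ha) (hbound hb)
    (fun n => hbound (ha.bandLimit _)) (fun n => hbound (hb.bandLimit _))
    (ha.mono_order (Nat.le_add_left 1 k)).tendsto_bandLimit
    (hb.mono_order (Nat.le_add_left 1 k)).tendsto_bandLimit hF hf)

end Superposition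

/-! ### The generator of the walk -/

/-- The action `z ↦ M z` of a matrix as a bounded operator on `ℂ²`. It is an algebra homomorphism
in `M`, so that exponentials of matrices become exponentials of operators. -/
abbrev matCLM (M : Mat2) : C2 →L[ℂ] C2 := Matrix.toEuclideanCLM (n := Fin 2) (𝕜 := ℂ) M

theorem matCLM_expI (t : ℝ) (M : Mat2) :
    matCLM (expI t M) = NormedSpace.exp ((t : ℂ) • ((-Complex.I) • matCLM M)) := by
  let : NormedRing Mat2 := Matrix.linftyOpNormedRing
  let : NormedAlgebra ℂ Mat2 := Matrix.linftyOpNormedAlgebra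
  let : NormedAlgebra ℚ Mat2 := NormedAlgebra.restrictScalars ℚ ℂ Mat2
  have hc : Continuous (Matrix.toEuclideanCLM (n := Fin 2) (𝕜 := ℂ)) :=
    LinearMap.continuous_of_finiteDimensional
      (Matrix.toEuclideanCLM (n := Fin 2) (𝕜 := ℂ)).toAlgEquiv.toLinearMap
  refine (NormedSpace.map_exp (Matrix.toEuclideanCLM (n := Fin 2) (𝕜 := ℂ)) hc _).trans ?_
  rw [map_smul, smul_smul]
  congr 2
  ring

theorem matCLM_pauliComb (q : EuclideanSpace ℝ (Fin 4)) :
    matCLM (pauliComb q) = ∑ α, (q α : ℂ) • matCLM (pauli α) := by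
  simp only [matCLM, pauliComb, map_sum, map_smul]

theorem contDiff_exp_clm :
    ContDiff ℝ ∞ (NormedSpace.exp : (C2 →L[ℂ] C2) → (C2 →L[ℂ] C2)) :=
  (contDiff_iff_contDiffAt.2 fun A => (NormedSpace.exp_analytic (𝕂 := ℂ) A).contDiffAt)
    |>.restrict_scalars ℝ

theorem exp_zero_smul_apply (A : C2 →L[ℂ] C2) (z : C2) :
    NormedSpace.exp ((0 : ℂ) • A) z = z := by
  have h : NormedSpace.exp ((0 : ℂ) • A) = ContinuousLinearMap.id ℂ C2 := by
    rw [show (0 : ℂ) • A = 0 by ext z; simp]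
    exact NormedSpace.exp_zero
  rw [h, ContinuousLinearMap.id_apply]

theorem hasDerivAt_exp_smul_apply (A : C2 →L[ℂ] C2) {z : ℝ → C2} {z' : C2}
    (hz : HasDerivAt z z' 0) :
    HasDerivAt (fun t : ℝ => NormedSpace.exp ((t : ℂ) • A) (z t)) (A (z 0) + z') 0 := by
  have hexp := (hasDerivAt_exp_smul_const' (𝕂 := ℂ) A ((0 : ℝ) : ℂ)).scomp (0 : ℝ)
    Complex.ofRealCLM.hasDerivAt
  refine (((ContinuousLinearMap.restrictScalarsL ℂ C2 C2 ℝ ℝ).hasFDerivAt.comp_hasDerivAt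
    (0 : ℝ) hexp).clm_apply hz).congr_deriv ?_
  change ((1 : ℂ) • (A * NormedSpace.exp (((0 : ℝ) : ℂ) • A))) (z 0)
    + NormedSpace.exp (((0 : ℝ) : ℂ) • A) z' = _
  rw [_root_.smul_apply, one_smul, Complex.ofReal_zero, exp_zero_smul_apply]
  change A (NormedSpace.exp ((0 : ℂ) • A) (z 0)) + z' = _
  rw [exp_zero_smul_apply]

theorem contDiff_quad (γ : Mat2) : ContDiff ℝ ∞ (quad γ) := by
  have hproj (j : Fin 2) : ContDiff ℝ ∞ fun z : C2 => z j :=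
    ((EuclideanSpace.proj j : C2 →L[ℂ] ℂ).restrictScalars ℝ).contDiff
  exact Complex.reCLM.contDiff.comp (f := fun z : C2 => ∑ j, z j * star (act γ z j)) <|
    ContDiff.sum fun j _ => (hproj j).mul <| Complex.conjCLE.contDiff.comp <|
      (hproj j).comp ((matCLM γ).restrictScalars ℝ).contDiff

/-- One step of the walk at a single site, without the shift, as a function of the step size, the
value of the coefficient and the value of the field at the site. -/
def localStep (γ : Mat2) (g : ℝ → ℝ) (y : (ℝ × EuclideanSpace ℝ (Fin 4)) × C2) : C2 :=
  act (expI y.1.1 (pauliComb y.1.2)) (act (expI y.1.1 ((g (quad γ y.2) : ℂ) • γ)) y.2)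

theorem localStep_eq (γ : Mat2) (g : ℝ → ℝ) (y : (ℝ × EuclideanSpace ℝ (Fin 4)) × C2) :
    localStep γ g y =
      NormedSpace.exp ((y.1.1 : ℂ) • ((-Complex.I) • matCLM (pauliComb y.1.2)))
        (NormedSpace.exp
          ((y.1.1 : ℂ) • ((-Complex.I) • ((g (quad γ y.2) : ℂ) • matCLM γ))) y.2) := by
  change matCLM _ (matCLM _ y.2) = _
  rw [matCLM_expI, matCLM_expI]
  simp only [matCLM, map_smul]

theorem localStep_apply_zero (γ : Mat2) (g : ℝ → ℝ) (q : ℝ × EuclideanSpace ℝ (Fin 4)) :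
    localStep γ g (q, 0) = 0 := by
  rw [localStep_eq, map_zero, map_zero]

theorem localStep_zero_step (γ : Mat2) (g : ℝ → ℝ) (q : EuclideanSpace ℝ (Fin 4)) (z : C2) :
    localStep γ g ((0, q), z) = z := by
  simp only [localStep_eq, Complex.ofReal_zero, exp_zero_smul_apply]

theorem contDiff_localStep (γ : Mat2) {g : ℝ → ℝ} (hg : ContDiff ℝ ∞ g) :
    ContDiff ℝ ∞ (localStep γ g) := by
  rw [funext (localStep_eq γ g)]
  simp only [matCLM_pauliComb]
  have ht : ContDiff ℝ ∞ fun y : (ℝ × EuclideanSpace ℝ (Fin 4)) × C2 => (y.1.1 : ℂ) :=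
    Complex.ofRealCLM.contDiff.comp <| contDiff_fst.comp contDiff_fst
  have hq (α) : ContDiff ℝ ∞ fun y : (ℝ × EuclideanSpace ℝ (Fin 4)) × C2 => (y.1.2 α : ℂ) :=
    Complex.ofRealCLM.contDiff.comp <|
      (EuclideanSpace.proj α : EuclideanSpace ℝ (Fin 4) →L[ℝ] ℝ).contDiff.comp
        (contDiff_snd.comp contDiff_fst)
  have hgq : ContDiff ℝ ∞ fun y : (ℝ × EuclideanSpace ℝ (Fin 4)) × C2 => (g (quad γ y.2) : ℂ) :=
    Complex.ofRealCLM.contDiff.comp <| hg.comp ((contDiff_quad γ).comp contDiff_snd)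
  have hsmul {c : (ℝ × EuclideanSpace ℝ (Fin 4)) × C2 → ℂ}
      {A : (ℝ × EuclideanSpace ℝ (Fin 4)) × C2 → (C2 →L[ℂ] C2)} (hc : ContDiff ℝ ∞ c)
      (hA : ContDiff ℝ ∞ A) : ContDiff ℝ ∞ fun y => c y • A y := hc.smul hA
  have hexp {A : (ℝ × EuclideanSpace ℝ (Fin 4)) × C2 → (C2 →L[ℂ] C2)}
      {z : (ℝ × EuclideanSpace ℝ (Fin 4)) × C2 → C2} (hA : ContDiff ℝ ∞ A)
      (hz : ContDiff ℝ ∞ z) :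
      ContDiff ℝ ∞ fun y => NormedSpace.exp ((y.1.1 : ℂ) • ((-Complex.I) • A y)) (z y) :=
    ((ContinuousLinearMap.restrictScalarsL ℂ C2 C2 ℝ ℝ).contDiff.comp
      (contDiff_exp_clm.comp (hsmul ht (hsmul contDiff_const hA)))).clm_apply hz
  exact hexp (ContDiff.sum fun α _ => hsmul (hq α) contDiff_const)
    (hexp (hsmul hgq contDiff_const) contDiff_snd)

theorem hasDerivAt_localStep_zero (γ : Mat2) (g : ℝ → ℝ) (q : EuclideanSpace ℝ (Fin 4)) (z : C2) :
    HasDerivAt (fun t => localStep γ g ((t, q), z))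
      (-(Complex.I • (act (pauliComb q) z + (g (quad γ z) : ℂ) • act γ z))) 0 := by
  simp only [localStep_eq]
  refine (hasDerivAt_exp_smul_apply _
    (hasDerivAt_exp_smul_apply _ (hasDerivAt_const 0 z))).congr_deriv ?_
  simp only [Complex.ofReal_zero, exp_zero_smul_apply, add_zero, _root_.smul_apply, neg_smul,
    smul_add, neg_add]
  rfl

theorem exists_contDiff_eq_add_smul {P Z F : Type u} [NormedAddCommGroup P] [NormedSpace ℝ P]
    [FiniteDimensional ℝ P] [NormedAddCommGroup Z] [NormedSpace ℝ Z] [FiniteDimensional ℝ Z]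
    [NormedAddCommGroup F] [NormedSpace ℝ F] [CompleteSpace F] {H : (ℝ × P) × Z → F}
    (hH : ContDiff ℝ ∞ H) (hH0 : ∀ q, H (q, 0) = 0) :
    ∃ K : (ℝ × P) × Z → F, ContDiff ℝ ∞ K ∧ (∀ q, K (q, 0) = 0) ∧
      ∀ t q z, H ((t, q), z) = H ((0, q), z) + t • K ((t, q), z) := by
  obtain ⟨B, hB, hBeq⟩ := exists_contDiff_sub_eq_clm_apply hH
  let K : (ℝ × P) × Z → F := fun y => B (y, ((0, y.1.2), y.2)) ((1, 0), 0)
  have hK : ContDiff ℝ ∞ K := (hB.comp (by fun_prop)).clm_apply contDiff_const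
  have hHK (t q z) : H ((t, q), z) = H ((0, q), z) + t • K ((t, q), z) := by
    rw [← sub_eq_iff_eq_add', hBeq, ← map_smul]
    simp
  refine ⟨fun y => K y - K (y.1, 0), hK.sub (hK.comp (by fun_prop)), fun q => sub_self _,
    fun t q z => ?_⟩
  have h0 := hHK t q 0
  rw [hH0, hH0, zero_add] at h0
  rw [smul_sub, ← h0, sub_zero, ← hHK]

/-- The local step of size `δ` is `z ↦ z + δ K` with a smooth `K`, which for `δ = 0` is `-i` times
the zeroth-order part of the Dirac equation and in general deviates from that by `δ K'`. -/
structure IsGenerator (γ : Mat2) (g : ℝ → ℝ)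
    (K K' : (ℝ × EuclideanSpace ℝ (Fin 4)) × C2 → C2) : Prop where
  contDiff : ContDiff ℝ ∞ K
  contDiff' : ContDiff ℝ ∞ K'
  apply_zero : ∀ q, K (q, 0) = 0
  apply_zero' : ∀ q, K' (q, 0) = 0
  localStep_eq : ∀ t q z, localStep γ g ((t, q), z) = z + t • K ((t, q), z)
  expand : ∀ t q z, K ((t, q), z) = K ((0, q), z) + t • K' ((t, q), z)
  dirac : ∀ q z, Complex.I • K ((0, q), z) = act (pauliComb q) z + (g (quad γ z) : ℂ) • act γ z

theorem exists_isGenerator (γ : Mat2) {g : ℝ → ℝ} (hg : ContDiff ℝ ∞ g) :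
    ∃ K K', IsGenerator γ g K K' := by
  obtain ⟨K, hK, hK0, hKeq⟩ :=
    exists_contDiff_eq_add_smul (contDiff_localStep γ hg) (localStep_apply_zero γ g)
  obtain ⟨K', hK', hK0', hKeq'⟩ := exists_contDiff_eq_add_smul hK hK0
  have hstep (t q z) : localStep γ g ((t, q), z) = z + t • K ((t, q), z) := by
    rw [hKeq, localStep_zero_step]
  refine ⟨K, K', hK, hK', hK0, hK0', hstep, hKeq', fun q z => ?_⟩
  have hderiv : HasDerivAt (fun t => localStep γ g ((t, q), z)) (K ((0, q), z)) 0 := by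
    have hd : Differentiable ℝ fun t : ℝ => K ((t, q), z) :=
      (hK.comp (by fun_prop : ContDiff ℝ ∞ fun t : ℝ => ((t, q), z))).differentiable (by simp)
    simp only [hstep]
    simpa using ((hasDerivAt_id (0 : ℝ)).smul (hd 0).hasDerivAt).const_add z
  rw [hderiv.unique (hasDerivAt_localStep_zero γ g q z), smul_neg, smul_smul, Complex.I_mul_I,
    neg_one_smul, neg_neg]

section Coefficient

variable {E : Type*} [NormedAddCommGroup E]

theorem norm_le_of_memLp_top {p : ℝ → E} (hp : Continuous p) (hp' : MemLp p (∞ : ℝ≥0∞) volume)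
    (x : ℝ) : ‖p x‖ ≤ (eLpNorm p (∞ : ℝ≥0∞) volume).toNNReal := by
  have hae : ∀ᵐ x, ‖p x‖ ≤ (eLpNorm p (∞ : ℝ≥0∞) volume).toNNReal := by
    have htop : eLpNormEssSup p volume ≠ (∞ : ℝ≥0∞) :=
      eLpNorm_exponent_top (f := p) ▸ hp'.eLpNorm_ne_top
    rw [eLpNorm_exponent_top]
    filter_upwards [enorm_ae_le_eLpNormEssSup p volume] with x hx
    rw [← ENNReal.coe_toNNReal htop, enorm_le_coe] at hx
    exact_mod_cast hx
  exact (isClosed_le hp.norm continuous_const).closure_subset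
    ((Measure.dense_of_ae hae).closure_eq ▸ Set.mem_univ x)

variable [NormedSpace ℝ E]

theorem exists_smoothCoeffLE {s : ℕ} {p : ℝ → E} (hp : ContDiff ℝ ∞ p)
    (hp_bdd : MemLp p (∞ : ℝ≥0∞) volume)
    (hp_deriv : ∀ j ≤ s, MemLp (iteratedDeriv j (deriv p)) 2 volume) :
    ∃ R, SmoothCoeffLE (s + 1) R p := by
  let R : ℝ≥0 := ∑ j ∈ Finset.range (s + 1),
    (eLpNorm (iteratedDeriv j (deriv p)) 2 volume).toNNReal
  refine ⟨(eLpNorm p (∞ : ℝ≥0∞) volume).toNNReal + R, hp, fun x => ?_, fun j hj => ?_⟩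
  · exact (norm_le_of_memLp_top hp.continuous hp_bdd x).trans (by simp)
  · rw [iteratedDeriv_succ', ← ENNReal.coe_toNNReal (hp_deriv j (by lia)).eLpNorm_ne_top]
    norm_cast
    refine le_trans ?_ (le_add_self (a := R))
    exact Finset.single_le_sum (f := fun j =>
      (eLpNorm (iteratedDeriv j (deriv p)) 2 volume).toNNReal) (fun _ _ => zero_le)
      (Finset.mem_range.2 hj)

theorem SmoothCoeffLE.const_prodMk {k : ℕ} {R : ℝ≥0} {p : ℝ → E} (hp : SmoothCoeffLE k R p)
    {t : ℝ} (ht : t ∈ Set.Icc (0 : ℝ) 1) : SmoothCoeffLE k (1 + R) fun x => (t, p x) := by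
  refine ((smoothCoeffLE_const k t).mono le_rfl ?_).prodMk hp
  rw [← NNReal.coe_le_coe, coe_nnnorm, Real.norm_of_nonneg ht.1]
  exact ht.2

end Coefficient

/-! ### The Dirac equation on the Fourier side -/

theorem integral_schwartz_smul_fourier (w : L2) (φ : 𝓢(ℝ, ℂ)) :
    ∫ ξ, φ ξ • (𝓕 w : L2) ξ = ∫ x, (𝓕 φ) x • w x := by
  have h := congrArg (fun u : 𝓢'(ℝ, C2) => u φ) (Lp.fourier_toTemperedDistribution_eq w)
  simpa only [TemperedDistribution.fourier_apply, Lp.toTemperedDistribution_apply] using h.symm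

theorem fourier_clm_apply (A : C2 →L[ℂ] C2) {w w' : L2} (h : w' =ᵐ[volume] fun x => A (w x)) :
    ((𝓕 w' : L2) : ℝ → C2) =ᵐ[volume] fun ξ => A ((𝓕 w : L2) ξ) := by
  have hA := coeFn_mulOp (memLp_top_const A) (𝓕 w)
  refine .trans (ae_eq_of_integral_schwartz_smul_eq (locallyIntegrable_coe_L2 _)
    (locallyIntegrable_coe_L2 _) fun φ => ?_) hA
  have hI (u : L2) (φ : 𝓢(ℝ, ℂ)) : ∫ x, φ x • A (u x) = A (∫ x, φ x • u x) := by
    rw [← A.integral_comp_comm (integrable_smul_of_memLp_two (φ.memLp 2 volume) (Lp.memLp u))]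
    simp only [map_smul]
  calc ∫ ξ, φ ξ • (𝓕 w' : L2) ξ = ∫ x, (𝓕 φ) x • w' x := integral_schwartz_smul_fourier w' φ
    _ = ∫ x, (𝓕 φ) x • A (w x) :=
        integral_congr_ae (h.mono fun x hx => by simp only [hx])
    _ = A (∫ ξ, φ ξ • (𝓕 w : L2) ξ) := by rw [hI, integral_schwartz_smul_fourier]
    _ = ∫ ξ, φ ξ • A ((𝓕 w : L2) ξ) := (hI _ φ).symm
    _ = _ := integral_congr_ae (hA.mono fun x hx => by simp only [hx])

theorem act_pauli_three (z : C2) : act (pauli 3) z = sigmaThree z := by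
  refine C2.ext ?_ ?_ <;>
  simp [act, pauli, sigmaThree, Matrix.mulVec, dotProduct, Fin.sum_univ_two]

/-! ### One step of the walk -/

section Step

variable {k : ℕ} {r ε δ : ℝ} {ρ R : ℝ≥0} {γ : Mat2} {g : ℝ → ℝ}
  {K K' : (ℝ × EuclideanSpace ℝ (Fin 4)) × C2 → C2} {p : ℝ → EuclideanSpace ℝ (Fin 4)}

theorem IsGenerator.shannon_step (hK : IsGenerator γ g K K') (hγ : γ.IsHermitian) (hδ : 0 < δ)
    {a b : Lattice}
    (hb : ∀ n : ℤ, b n = K ((δ, p (δ * n)), smoothRep (shannon δ a) (δ * n))) :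
    shannon δ (shift (coin δ p (nonlinearCoin δ γ hγ g a)))
      = prop δ (shannon δ a + (δ : ℂ) • shannon δ b) := by
  rw [shannon_shift hδ, ← shannon_smul hδ, ← shannon_add hδ]
  congr 2
  ext1
  funext n
  change localStep γ g ((δ, p (δ * n)), a n) = a n + (δ : ℂ) • b n
  rw [hK.localStep_eq, hb, smoothRep_shannon hδ, Complex.coe_smul]

theorem IsGenerator.exists_smoothSobolevLE (hK : IsGenerator γ g K K')
    (hp : SmoothCoeffLE (k + 2) R p) (ρ : ℝ≥0) :
    ∃ C : ℝ≥0, ∀ t ∈ Set.Icc (0 : ℝ) 1, ∀ (z : ℝ → C2) (r : ℝ≥0), SmoothSobolevLE (k + 1) ρ z →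
      SmoothSobolevLE (k + 2) r z →
      SmoothSobolevLE (k + 2) (C * (1 + r)) fun x => K ((t, p x), z x) := by
  obtain ⟨C, hC⟩ := exists_smoothSobolevLE_superposition_tame hK.contDiff hK.apply_zero (k + 1)
    (1 + R + 2 * ρ)
  exact ⟨C, fun t ht z r hρ hr => hC _ _ ((hp.const_prodMk ht).mono le_rfl le_self_add)
    (hρ.smoothCoeffLE.mono le_rfl le_add_self) r hr⟩

theorem IsGenerator.exists_smoothSobolevLE' (hK : IsGenerator γ g K K')
    (hp : SmoothCoeffLE (k + 2) R p) (ρ : ℝ≥0) :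
    ∃ C : ℝ≥0, ∀ t ∈ Set.Icc (0 : ℝ) 1, ∀ z : ℝ → C2, SmoothSobolevLE (k + 1) ρ z →
      SmoothSobolevLE (k + 1) C fun x => K' ((t, p x), z x) := by
  obtain ⟨C, hC⟩ := exists_smoothSobolevLE_superposition hK.contDiff' hK.apply_zero' (k + 1)
    (1 + R + 2 * ρ)
  exact ⟨C * ρ, fun t ht z hρ => hC _ _ ((hp.const_prodMk ht).mono (Nat.le_succ _) le_self_add)
    (hρ.smoothCoeffLE.mono le_rfl le_add_self) ρ hρ⟩

theorem IsGenerator.exists_ae_eq_sub_smul (hK : IsGenerator γ g K K') {h : L2} {z : ℝ → C2}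
    {B : ℝ≥0} {t : ℝ} (ht : 0 ≤ t) (hh : h =ᵐ[volume] fun x => K ((0, p x), z x))
    (hB : SmoothSobolevLE k B fun x => K' ((t, p x), z x)) :
    ∃ w : L2, (w =ᵐ[volume] fun x => K ((t, p x), z x)) ∧
      SobolevLE k (t * (2 ^ k * B)) (w - h) := by
  obtain ⟨h', hh'⟩ := hB.exists_ae_eq
  refine ⟨h + (t : ℂ) • h', ?_, ?_⟩
  · filter_upwards [Lp.coeFn_add h ((t : ℂ) • h'), Lp.coeFn_smul (t : ℂ) h', hh, hh']
      with x hadd hsmul hx hx'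
    rw [hadd, Pi.add_apply, hsmul, Pi.smul_apply, hx, hx', Complex.coe_smul, ← hK.expand]
  · simpa [abs_of_nonneg ht] using (hB.sobolevLE hh').smul (t : ℂ)

/- In the highest norm the increment may grow, but only linearly; one order lower it agrees with the
zeroth-order part of the Dirac equation up to `O(δ)`. -/
theorem IsGenerator.exists_increment (hK : IsGenerator γ g K K') (hp : SmoothCoeffLE (k + 2) R p)
    (ρ : ℝ≥0) :
    ∃ C₁ C₂ C₃ : ℝ≥0, ∀ δ : ℝ, 0 < δ → δ ≤ 1 → ∀ (v : L2) (r : ℝ), BandLimited δ v →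
      SobolevLE (k + 1) ρ v → SobolevLE (k + 2) r v →
      ∃ (b : Lattice) (h : L2), (∀ n : ℤ, b n = K ((δ, p (δ * n)), smoothRep v (δ * n))) ∧
        (h =ᵐ[volume] fun x => K ((0, p x), v x)) ∧
        SobolevLE (k + 2) (C₁ * (1 + r)) (shannon δ b) ∧ SobolevLE (k + 2) (C₂ * (1 + r)) h ∧
        SobolevLE (k + 1) (δ * (C₃ * (1 + r))) (h - shannon δ b) := by
  obtain ⟨A, hA⟩ := hK.exists_smoothSobolevLE hp ρ
  obtain ⟨B, hB⟩ := hK.exists_smoothSobolevLE' hp ρ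
  refine ⟨3 * 4 ^ (k + 2) * A, 2 ^ (k + 2) * A,
    (3 * 4 ^ (k + 1) + 1) * 2 ^ (k + 2) * A + 2 ^ (k + 1) * B, fun δ hδ hδ₁ v r hv hρ hr => ?_⟩
  lift r to ℝ≥0 using hr.nonneg
  have hzρ := hv.smoothSobolevLE_smoothRep hρ
  have hzr := hv.smoothSobolevLE_smoothRep hr
  have hK₀ := hA 0 ⟨le_rfl, zero_le_one⟩ _ r hzρ hzr
  have hKδ := hA δ ⟨hδ.le, hδ₁⟩ _ r hzρ hzr
  obtain ⟨b, hb⟩ := hKδ.exists_sample hδ hδ₁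
  obtain ⟨h, hh⟩ := hK₀.exists_ae_eq
  obtain ⟨w, hw, hwh⟩ := hK.exists_ae_eq_sub_smul hδ.le hh (hB δ ⟨hδ.le, hδ₁⟩ _ hzρ)
  have hdiff := ((hKδ.sobolevLE_shannon_sub hδ hδ₁ hw hb).add hwh).neg
  rw [sub_add_sub_cancel, neg_sub] at hdiff
  refine ⟨b, h, hb, ?_, ?_, ?_, hdiff.mono ?_⟩
  · filter_upwards [hh, hv.ae_eq_smoothRep] with x hx hvx
    rw [hx, hvx]
  · simpa [mul_assoc] using hKδ.sobolevLE_shannon hδ hδ₁ hb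
  · simpa [mul_assoc] using hK₀.sobolevLE hh
  · push_cast
    rw [← mul_add]
    have hB₀ : (2 ^ (k + 1) * B : ℝ) ≤ 2 ^ (k + 1) * B * (1 + r) :=
      le_mul_of_one_le_right (by positivity) (by simp)
    gcongr
    linarith

theorem IsGenerator.exists_sobolevLE_step (hK : IsGenerator γ g K K')
    (hp : SmoothCoeffLE (k + 2) R p) (hγ : γ.IsHermitian) (ρ : ℝ≥0) :
    ∃ C : ℝ≥0, ∀ (δ r : ℝ) (a : Lattice), 0 < δ → δ ≤ 1 → SobolevLE (k + 1) ρ (shannon δ a) →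
      SobolevLE (k + 2) r (shannon δ a) →
      SobolevLE (k + 2) (r + δ * (C * (1 + r)))
        (shannon δ (shift (coin δ p (nonlinearCoin δ γ hγ g a)))) := by
  obtain ⟨C, _, _, hC⟩ := hK.exists_increment hp ρ
  refine ⟨C, fun δ r a hδ hδ₁ hρ hr => ?_⟩
  obtain ⟨b, -, hb, -, hbr, -, -⟩ := hC δ hδ hδ₁ _ r (bandLimited_shannon hδ a) hρ hr
  rw [hK.shannon_step hγ hδ hb]
  simpa [abs_of_pos hδ] using (hr.add (hbr.smul (δ : ℂ))).prop δ

/-! ### Solutions of the Dirac equation -/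

/-- `u` solves `∂ₜ u = -σ₃ ∂ₓ u + h` on `[a, b]` with `h = K ((0, p), u)`, and `u'` is its time
derivative. For a generator `K` of the walk this is the nonlinear Dirac equation. -/
structure IsDiracFlow (K : (ℝ × EuclideanSpace ℝ (Fin 4)) × C2 → C2)
    (p : ℝ → EuclideanSpace ℝ (Fin 4)) (a b : ℝ) (u u' h : ℝ → L2) : Prop where
  hasDerivWithinAt : ∀ t ∈ Set.Icc a b, HasDerivWithinAt u (u' t) (Set.Icc a b) t
  diracRelation : ∀ t ∈ Set.Icc a b, DiracRelation (u' t) (u t) (h t)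
  ae_eq : ∀ t ∈ Set.Icc a b, h t =ᵐ[volume] fun x => K ((0, p x), u t x)

theorem IsDiracSolution.exists_isDiracFlow (hK : IsGenerator γ g K K') {T : ℝ} {u₀ : L2}
    {u : ℝ → L2} (hu : IsDiracSolution (k + 1) p γ g T u₀ u) :
    ∃ u' h : ℝ → L2, IsDiracFlow K p 0 T u u' h := by
  have key (t : ℝ) : ∃ u' h : L2, t ∈ Set.Icc 0 T → HasDerivWithinAt u u' (Set.Icc 0 T) t ∧
      DiracRelation u' (u t) h ∧ h =ᵐ[volume] fun x => K ((0, p x), u t x) := by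
    by_cases ht : t ∈ Set.Icc 0 T
    swap
    · exact ⟨0, 0, fun h => absurd h ht⟩
    obtain ⟨u', hu', heqn⟩ := hu.eqn t ht
    obtain ⟨w, hw, -⟩ := hu.mem t ht
    rw [hw.weakDeriv_eq] at heqn
    set σw := mulOp (fun _ => sigmaThree) (memLp_top_const sigmaThree) w
    have hσw : σw =ᵐ[volume] fun x => sigmaThree (w x) := coeFn_mulOp _ _
    refine ⟨u', u' + σw, fun _ => ⟨hu', ?_, ?_⟩⟩
    · rw [DiracRelation, FourierTransform.fourier_add]
      filter_upwards [Lp.coeFn_add (𝓕 u' : L2) (𝓕 σw : L2), fourier_clm_apply sigmaThree hσw,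
        isWeakDeriv_iff_fourier.1 hw] with ξ hadd hσ hweak
      rw [hadd, Pi.add_apply, hσ, hweak, map_smul, add_sub_cancel_right]
    · filter_upwards [Lp.coeFn_add u' σw, hσw, heqn] with x hadd hσ hx
      rw [act_pauli_three, add_assoc, ← hK.dirac] at hx
      rw [hadd, Pi.add_apply, hσ]
      refine smul_right_injective C2 Complex.I_ne_zero ?_
      simp only [smul_add, hx]
      abel
  choose u' h hdata using key
  exact ⟨u', h, fun t ht => (hdata t ht).1, fun t ht => (hdata t ht).2.1,
    fun t ht => (hdata t ht).2.2⟩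

namespace IsDiracFlow

variable {a b M : ℝ} {u u' h : ℝ → L2} {v w : L2}

theorem mono {a' b' : ℝ} (hu : IsDiracFlow K p a b u u' h) (ha : a ≤ a') (hb : b' ≤ b) :
    IsDiracFlow K p a' b' u u' h := by
  have hsub := Set.Icc_subset_Icc ha hb
  exact ⟨fun t ht => (hu.hasDerivWithinAt t (hsub ht)).mono hsub,
    fun t ht => hu.diracRelation t (hsub ht), fun t ht => hu.ae_eq t (hsub ht)⟩

theorem sobolevLE_sub_prop (hu : IsDiracFlow K p a b u u' h) (hab : a ≤ b)
    (hh : ∀ t ∈ Set.Icc a b, SobolevLE k M (prop (a - t) (h t) - w))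
    (hv : SobolevLE k ε (u a - v)) :
    SobolevLE k ((b - a) * M + ε) (u b - prop (b - a) (v + ((b - a : ℝ) : ℂ) • w)) := by
  have hsum := ((SobolevLE.duhamel hab hu.hasDerivWithinAt hu.diracRelation hh).add hv).prop (b - a)
  rwa [show prop (a - b) (u b) - u a - ((b - a : ℝ) : ℂ) • w + (u a - v)
      = prop (a - b) (u b) - (v + ((b - a : ℝ) : ℂ) • w) by abel, prop_sub, prop_prop,
    sub_add_sub_cancel, sub_self, prop_zero] at hsum

theorem sobolevLE_sub (hu : IsDiracFlow K p a b u u' h) (hab : a ≤ b)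
    (hh : ∀ t ∈ Set.Icc a b, SobolevLE k M (h t)) (hv : SobolevLE k ε (u a - v))
    (hr : SobolevLE (k + 1) r v) : SobolevLE k ((b - a) * M + ε + (b - a) * r) (u b - v) := by
  have hsum := (hu.sobolevLE_sub_prop (w := 0) hab
    (fun t ht => by simpa using (hh t ht).prop (a - t)) hv).add (hr.prop_sub_self (b - a))
  rwa [smul_zero, add_zero, sub_add_sub_cancel, abs_of_nonneg (sub_nonneg.2 hab)] at hsum

end IsDiracFlow

theorem IsGenerator.exists_sobolevLE_sub (hK : IsGenerator γ g K K')
    (hp : SmoothCoeffLE (k + 1) R p) (ρ : ℝ≥0) :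
    ∃ C : ℝ≥0, ∀ (v w f h : L2) (η : ℝ), SobolevLE (k + 1) ρ v → SobolevLE (k + 1) ρ w →
      SobolevLE (k + 1) η (v - w) → (f =ᵐ[volume] fun x => K ((0, p x), v x)) →
      (h =ᵐ[volume] fun x => K ((0, p x), w x)) → SobolevLE (k + 1) (C * η) (f - h) := by
  obtain ⟨C, hC⟩ := exists_sobolevLE_superposition_sub hK.contDiff k (1 + R) ρ
  refine ⟨C, fun v w f h η hv hw hvw hf hh =>
    hC _ v w _ η (hp.const_prodMk ⟨le_rfl, zero_le_one⟩) hv hw hvw ?_⟩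
  filter_upwards [Lp.coeFn_sub f h, hf, hh] with x hsub hfx hhx
  rw [hsub, Pi.sub_apply, hfx, hhx]

theorem IsGenerator.exists_sobolevLE (hK : IsGenerator γ g K K') (hp : SmoothCoeffLE (k + 1) R p)
    (ρ : ℝ≥0) :
    ∃ C : ℝ≥0, ∀ w h : L2, SobolevLE (k + 1) ρ w → (h =ᵐ[volume] fun x => K ((0, p x), w x)) →
      SobolevLE (k + 1) C h := by
  obtain ⟨C, hC⟩ := hK.exists_sobolevLE_sub hp ρ
  refine ⟨C * ρ, fun w h hw hh => ?_⟩
  have hzero : (0 : L2) =ᵐ[volume] fun x => K ((0, p x), (0 : L2) x) :=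
    (Lp.coeFn_zero C2 2 volume).mono fun x hx => by simp only [hx, Pi.zero_apply, hK.apply_zero]
  simpa using hC w 0 h 0 ρ hw ((sobolevLE_zero_right _).mono ρ.coe_nonneg) (by simpa using hw)
    hh hzero

/- By Duhamel's formula the solution stays within `O(ε + δ (1 + r))` of `shannon δ a` during the
step, so the zeroth-order part of the equation stays as close to the increment of the walk. -/
theorem IsGenerator.exists_sobolevLE_sub_step (hK : IsGenerator γ g K K')
    (hp : SmoothCoeffLE (k + 2) R p) (hγ : γ.IsHermitian) (ρ : ℝ≥0) :
    ∃ C : ℝ≥0, ∀ (δ τ r ε : ℝ) (a : Lattice) (u u' h : ℝ → L2), 0 < δ → δ ≤ 1 →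
      IsDiracFlow K p τ (τ + δ) u u' h → (∀ t ∈ Set.Icc τ (τ + δ), SobolevLE (k + 1) ρ (u t)) →
      SobolevLE (k + 1) ρ (shannon δ a) → SobolevLE (k + 2) r (shannon δ a) →
      SobolevLE (k + 1) ε (u τ - shannon δ a) →
      SobolevLE (k + 1) (δ * (C * (ε + δ * (1 + r))) + ε)
        (u (τ + δ) - shannon δ (shift (coin δ p (nonlinearCoin δ γ hγ g a)))) := by
  obtain ⟨_, A₂, A₃, hA⟩ := hK.exists_increment hp ρ
  obtain ⟨B, hB⟩ := hK.exists_sobolevLE_sub (hp.mono (Nat.le_succ _) le_rfl) ρ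
  obtain ⟨D, hD⟩ := hK.exists_sobolevLE (hp.mono (Nat.le_succ _) le_rfl) ρ
  refine ⟨B * (D + 1) + A₂ + A₃, fun δ τ r ε a u u' h hδ hδ₁ hu huρ haρ har hε => ?_⟩
  obtain ⟨b, h₀, hb, hh₀, -, hh₀r, hincr⟩ := hA δ hδ hδ₁ _ r (bandLimited_shannon hδ a) haρ har
  have hr₀ := har.nonneg
  have hε₀ := hε.nonneg
  have hmove (t) (ht : t ∈ Set.Icc τ (τ + δ)) :
      SobolevLE (k + 1) (δ * D + ε + δ * r) (u t - shannon δ a) := by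
    have hδt : t - τ ≤ δ := by linarith [ht.2]
    refine ((hu.mono le_rfl ht.2).sobolevLE_sub ht.1
      (fun t' ht' => have h' := Set.Icc_subset_Icc_right ht.2 ht'
        hD _ _ (huρ t' h') (hu.ae_eq t' h')) hε har).mono ?_
    gcongr
  have hdefect (t) (ht : t ∈ Set.Icc τ (τ + δ)) : SobolevLE (k + 1)
      (B * (δ * D + ε + δ * r) + δ * (A₂ * (1 + r)) + δ * (A₃ * (1 + r)))
      (prop (τ - t) (h t) - shannon δ b) := by
    have hδt : |τ - t| ≤ δ := abs_le.2 ⟨by linarith [ht.2], by linarith [ht.1]⟩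
    have hsum := (((hB _ _ (h t) h₀ _ (huρ t ht) haρ (hmove t ht) (hu.ae_eq t ht) hh₀).prop
      (τ - t)).add (hh₀r.prop_sub_self (τ - t))).add hincr
    rw [prop_sub, sub_add_sub_cancel, sub_add_sub_cancel] at hsum
    refine hsum.mono ?_
    gcongr
  have hstep := hu.sobolevLE_sub_prop (by linarith) hdefect hε
  rw [add_sub_cancel_left, ← hK.shannon_step hγ hδ hb] at hstep
  refine hstep.mono ?_
  push_cast
  gcongr
  have h₁ : (0 : ℝ) ≤ (B * D + A₂ + A₃) * ε := by positivity
  have h₂ : (0 : ℝ) ≤ B * D * (δ * r) + B * δ := by positivity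
  linarith

end Step

/-! ### Convergence for bounded solutions -/

section Convergence

variable {k : ℕ} {T : ℝ} {R M : ℝ≥0} {γ : Mat2} {g : ℝ → ℝ} {u : ℝ → L2} {u₀ : L2}
  {K K' : (ℝ × EuclideanSpace ℝ (Fin 4)) × C2 → C2} {p : ℝ → EuclideanSpace ℝ (Fin 4)}

theorem walk_succ (δ : ℝ) (hγ : γ.IsHermitian) (m : ℕ) (a : Lattice) :
    walk δ p γ hγ g (m + 1) a = shift (coin δ p (nonlinearCoin δ γ hγ g (walk δ p γ hγ g m a))) :=
  Function.iterate_succ_apply' _ _ _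

theorem SobolevLE.shannon_shannonInv_bandLimit {δ r : ℝ} (hδ : 0 < δ) (hδ₁ : δ ≤ 1)
    (h : SobolevLE (k + 1) r u₀) :
    shannon δ (shannonInv δ (NLQW.bandLimit δ u₀)) = NLQW.bandLimit δ u₀ := by
  obtain ⟨v, hv⟩ := (bandLimited_bandLimit δ u₀).exists_shannon_eq hδ hδ₁ (h.bandLimit δ)
  rw [← hv, shannonInv_shannon hδ]

theorem one_add_mul_pow_le_exp {C δ : ℝ} (hC : 0 ≤ C) (hδ : 0 ≤ δ) {m : ℕ} (hm : m * δ ≤ T) :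
    (1 + C * δ) ^ m ≤ Real.exp (C * T) := by
  calc (1 + C * δ) ^ m ≤ Real.exp (C * δ) ^ m := by
        gcongr
        linarith [Real.add_one_le_exp (C * δ)]
    _ = Real.exp (C * (m * δ)) := by rw [← Real.exp_nat_mul]; ring_nf
    _ ≤ Real.exp (C * T) := by gcongr

theorem IsGenerator.exists_sobolevLE_walk_succ (hK : IsGenerator γ g K K')
    (hp : SmoothCoeffLE (k + 2) R p) (hγ : γ.IsHermitian) (M : ℝ≥0) :
    ∃ A B : ℝ≥0, ∀ (T : ℝ) (u u' h : ℝ → L2), IsDiracFlow K p 0 T u u' h →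
      (∀ t ∈ Set.Icc 0 T, SobolevLE (k + 1) M (u t)) →
      ∀ (δ r ε : ℝ) (a : Lattice) (m : ℕ), 0 < δ → δ ≤ 1 → ε ≤ 1 → ((m + 1 : ℕ) : ℝ) * δ ≤ T →
      SobolevLE (k + 2) r (shannon δ (walk δ p γ hγ g m a)) →
      SobolevLE (k + 1) ε (u (m * δ) - shannon δ (walk δ p γ hγ g m a)) →
      SobolevLE (k + 2) (r + δ * (A * (1 + r))) (shannon δ (walk δ p γ hγ g (m + 1) a)) ∧
      SobolevLE (k + 1) (δ * (B * (ε + δ * (1 + r))) + ε)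
        (u ((m + 1 : ℕ) * δ) - shannon δ (walk δ p γ hγ g (m + 1) a)) := by
  obtain ⟨A, hA⟩ := hK.exists_sobolevLE_step hp hγ (M + 1)
  obtain ⟨B, hB⟩ := hK.exists_sobolevLE_sub_step hp hγ (M + 1)
  refine ⟨A, B, fun T u u' h hu huM δ r ε a m hδ hδ₁ hε₁ hm hr hε => ?_⟩
  have hsucc : ((m + 1 : ℕ) : ℝ) * δ = m * δ + δ := by push_cast; ring
  have hm₀ : 0 ≤ (m : ℝ) * δ := by positivity
  rw [hsucc] at hm
  have hwalk : SobolevLE (k + 1) (M + 1 : ℝ≥0) (shannon δ (walk δ p γ hγ g m a)) := by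
    have hsub := (huM (m * δ) ⟨hm₀, by linarith⟩).sub hε
    rw [sub_sub_cancel] at hsub
    exact hsub.mono (by push_cast; gcongr)
  have hsol (t) (ht : t ∈ Set.Icc (m * δ) (m * δ + δ)) : SobolevLE (k + 1) (M + 1 : ℝ≥0) (u t) :=
    (huM t ⟨hm₀.trans ht.1, ht.2.trans hm⟩).mono (by simp)
  rw [walk_succ, hsucc]
  exact ⟨hA δ r _ hδ hδ₁ hwalk hr,
    hB δ _ r ε _ u u' h hδ hδ₁ (hu.mono hm₀ hm) hsol hwalk hr hε⟩

/- Discrete Gronwall argument. The norms `r` and errors `ε` after `m` steps satisfy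
`r + 1 ↦ (1 + A δ) (r + 1)` and `ε + δ W ↦ (1 + B δ) (ε + δ W)`, as `W` bounds `r + 1`. The
smallness of `δ` keeps `ε ≤ 1`, hence the walk in a fixed ball of `H^(k + 1)`. -/
theorem IsGenerator.exists_sobolevLE_walk (hK : IsGenerator γ g K K')
    (hp : SmoothCoeffLE (k + 2) R p) (hγ : γ.IsHermitian) (M : ℝ≥0) :
    ∃ A B : ℝ≥0, ∀ (T : ℝ) (Λ : ℝ≥0) (u u' h : ℝ → L2), IsDiracFlow K p 0 T u u' h →
      (∀ t ∈ Set.Icc 0 T, SobolevLE (k + 1) M (u t)) →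
      ∀ (δ W : ℝ) (a : Lattice), 0 < δ → δ ≤ 1 → Real.exp (A * T) * (1 + Λ) ≤ W →
      Real.exp (B * T) * (δ * (Λ + W)) ≤ 1 → SobolevLE (k + 2) Λ (shannon δ a) →
      SobolevLE (k + 1) (δ * Λ) (u 0 - shannon δ a) → ∀ m : ℕ, (m : ℝ) * δ ≤ T →
      SobolevLE (k + 2) ((1 + A * δ) ^ m * (1 + Λ) - 1) (shannon δ (walk δ p γ hγ g m a)) ∧
      SobolevLE (k + 1) ((1 + B * δ) ^ m * (δ * (Λ + W)) - δ * W)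
        (u (m * δ) - shannon δ (walk δ p γ hγ g m a)) := by
  obtain ⟨A, B, hAB⟩ := hK.exists_sobolevLE_walk_succ hp hγ M
  refine ⟨A, B, fun T Λ u u' h hu huM δ W a hδ hδ₁ hW hδW hΛ hδΛ m => ?_⟩
  have hW₀ : 0 ≤ W := le_trans (by positivity) hW
  induction m with
  | zero =>
    refine fun _ => ⟨by simpa [walk] using hΛ, ?_⟩
    rw [Nat.cast_zero, zero_mul]
    exact hδΛ.mono (le_of_eq (by ring))
  | succ m ih =>
    intro hm
    have hm' : (m : ℝ) * δ ≤ T := le_trans (by gcongr; simp) hm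
    obtain ⟨hr, hε⟩ := ih hm'
    have hrW : (1 + A * δ) ^ m * (1 + Λ) ≤ W :=
      le_trans (by gcongr; exact one_add_mul_pow_le_exp A.coe_nonneg hδ.le hm') hW
    have hε₁ : (1 + B * δ) ^ m * (δ * (Λ + W)) - δ * W ≤ 1 := by
      refine (sub_le_self _ (by positivity)).trans (le_trans ?_ hδW)
      gcongr
      exact one_add_mul_pow_le_exp B.coe_nonneg hδ.le hm'
    obtain ⟨hr', hε'⟩ := hAB T u u' h hu huM δ _ _ a m hδ hδ₁ hε₁ hm hr hε
    refine ⟨hr'.mono (le_of_eq (by ring)), hε'.mono ?_⟩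
    rw [add_sub_cancel]
    calc _ ≤ δ * (B * ((1 + B * δ) ^ m * (δ * (Λ + W)) - δ * W + δ * W))
          + ((1 + B * δ) ^ m * (δ * (Λ + W)) - δ * W) := by gcongr
      _ = _ := by ring

theorem IsGenerator.exists_error_bound (hK : IsGenerator γ g K K')
    (hp : SmoothCoeffLE (k + 2) R p) (hγ : γ.IsHermitian) (T : ℝ) (Λ M : ℝ≥0) :
    ∃ C : ℝ, 0 < C ∧ ∃ δ₀ : ℝ, 0 < δ₀ ∧ ∀ (u₀ : L2) (u : ℝ → L2), SobolevLE (k + 2) Λ u₀ →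
      IsDiracSolution (k + 1) p γ g T u₀ u → (∀ t ∈ Set.Icc 0 T, SobolevLE (k + 1) M (u t)) →
      ∀ δ ∈ Set.Ioc (0 : ℝ) δ₀, ∀ m : ℕ, (m : ℝ) * δ ≤ T →
        SobolevLE (k + 1) (C * δ)
          (shannon δ (walk δ p γ hγ g m (shannonInv δ (bandLimit δ u₀))) - u (m * δ)) := by
  obtain ⟨A, B, hAB⟩ := hK.exists_sobolevLE_walk hp hγ M
  set W : ℝ := Real.exp (A * T) * (1 + Λ)
  set C : ℝ := Real.exp (B * T) * (Λ + W) with hC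
  have hC₀ : 0 < C := by positivity
  refine ⟨C, hC₀, min 1 (1 / C), by positivity, fun u₀ u hu₀ hu huM δ hδ m hm => ?_⟩
  have hδ₁ : δ ≤ 1 := hδ.2.trans (min_le_left _ _)
  have hδC : C * δ ≤ 1 := (le_div_iff₀' hC₀).1 (hδ.2.trans (min_le_right _ _))
  have hδW : Real.exp (B * T) * (δ * (Λ + W)) = C * δ := by rw [hC]; ring
  have hinit := hu₀.shannon_shannonInv_bandLimit hδ.1 hδ₁
  obtain ⟨u', h, hflow⟩ := hu.exists_isDiracFlow hK
  have herr := (hAB T Λ u u' h hflow huM δ W _ hδ.1 hδ₁ le_rfl (hδW.trans_le hδC)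
    (by rw [hinit]; exact hu₀.bandLimit δ)
    (by rw [hinit, hu.initial]; exact hu₀.sub_bandLimit hδ.1) m hm).2.neg
  rw [neg_sub] at herr
  have hδ₀ := hδ.1
  refine herr.mono ((sub_le_self _ (by positivity)).trans (le_trans ?_ hδW.le))
  gcongr
  exact one_add_mul_pow_le_exp B.coe_nonneg hδ₀.le hm

/-! ### Bounds and uniqueness of solutions -/

theorem MemH.sub {u v : L2} (hu : MemH k u) (hv : MemH k v) : MemH k (u - v) :=
  (hu.sobolevLE_normH.sub hv.sobolevLE_normH).memH

theorem normH_le_normH_succ (k : ℕ) (u : L2) : normH k u ≤ normH (k + 1) u :=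
  Real.sqrt_le_sqrt <| Finset.sum_le_sum_of_subset_of_nonneg (Finset.range_mono (by lia))
    fun _ _ _ => by positivity

theorem IsDiracSolution.exists_sobolevLE (hu : IsDiracSolution k p γ g T u₀ u) :
    ∃ M : ℝ≥0, ∀ t ∈ Set.Icc 0 T, SobolevLE k M (u t) := by
  refine isCompact_Icc.induction_on (p := fun S => ∃ M : ℝ≥0, ∀ t ∈ S ∩ Set.Icc 0 T,
    SobolevLE k M (u t)) ⟨0, by simp⟩ ?_ ?_ ?_ |>.imp fun M hM t ht => hM t ⟨ht, ht⟩
  · rintro S S' hS ⟨M, hM⟩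
    exact ⟨M, fun t ht => hM t ⟨hS ht.1, ht.2⟩⟩
  · rintro S S' ⟨M, hM⟩ ⟨M', hM'⟩
    refine ⟨M + M', fun t ht => ?_⟩
    rcases ht.1 with hS | hS'
    · exact (hM t ⟨hS, ht.2⟩).mono (by simp)
    · exact (hM' t ⟨hS', ht.2⟩).mono (by simp)
  · intro t ht
    refine ⟨_, (hu.cont t ht).eventually_lt_const zero_lt_one,
      (2 ^ k * 1 + 2 ^ k * normH k (u t)).toNNReal, fun τ hτ => ?_⟩
    have hτt : normH k (u τ - u t) < 1 := hτ.1
    have hadd := ((hu.mem τ hτ.2).sub (hu.mem t ht)).sobolevLE_normH.add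
      (hu.mem t ht).sobolevLE_normH
    rw [sub_add_cancel] at hadd
    refine hadd.mono (le_trans ?_ (Real.le_coe_toNNReal _))
    gcongr

/- Both solutions are limits of the walk started at `u₀`. -/
theorem IsDiracSolution.eqOn (hK : IsGenerator γ g K K') (hp : SmoothCoeffLE (k + 2) R p)
    (hγ : γ.IsHermitian) {v : ℝ → L2} (hu₀ : MemH (k + 2) u₀)
    (hu : IsDiracSolution (k + 1) p γ g T u₀ u) (hv : IsDiracSolution (k + 1) p γ g T u₀ v) :
    Set.EqOn u v (Set.Icc 0 T) := by
  intro t ht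
  rcases ht.1.eq_or_lt with rfl | ht₀
  · rw [hu.initial, hv.initial]
  obtain ⟨M, hM⟩ := hu.exists_sobolevLE
  obtain ⟨N, hN⟩ := hv.exists_sobolevLE
  have hΛ := hu₀.sobolevLE_normH.mono (Real.le_coe_toNNReal _)
  obtain ⟨C, -, δ₁, hδ₁, herr⟩ := hK.exists_error_bound hp hγ T _ M
  obtain ⟨D, -, δ₂, hδ₂, herr'⟩ := hK.exists_error_bound hp hγ T _ N
  have hlim := tendsto_const_div_atTop_nhds_zero_nat t
  have hdist : ∀ᶠ m : ℕ in atTop, ‖u t - v t‖ ≤ (D + C) * (t / m) := by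
    filter_upwards [hlim.eventually_lt_const (lt_min hδ₁ hδ₂), eventually_gt_atTop 0] with m hm hm₀
    have hmt : (m : ℝ) * (t / m) = t := by field_simp
    have hδ : 0 < t / m := by positivity
    have hwalk := herr u₀ u hΛ hu hM (t / m) ⟨hδ, hm.le.trans (min_le_left _ _)⟩ m
      (hmt.trans_le ht.2)
    have hwalk' := herr' u₀ v hΛ hv hN (t / m) ⟨hδ, hm.le.trans (min_le_right _ _)⟩ m
      (hmt.trans_le ht.2)
    rw [hmt] at hwalk hwalk'
    have hsub := (hwalk'.sub hwalk).norm_le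
    rw [sub_sub_sub_cancel_left] at hsub
    exact hsub.trans (le_of_eq (by ring))
  have hzero : ‖u t - v t‖ ≤ 0 :=
    ge_of_tendsto (by simpa using hlim.const_mul (D + C)) hdist
  exact sub_eq_zero.1 (norm_le_zero_iff.1 hzero)

theorem LipCondition.exists_solution_normH_le {L : ℝ} (hL : 0 ≤ L)
    (hLip : LipCondition k p γ g T L) :
    ∃ M : ℝ, ∀ a, MemH k a → normH k a ≤ L →
      ∃ u, IsDiracSolution k p γ g T a u ∧ ∀ t ∈ Set.Icc 0 T, normH k (u t) ≤ M := by
  obtain ⟨C, hC, U, hU, hUL⟩ := hLip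
  have h₀ : MemH k (0 : L2) := (sobolevLE_zero_right k).memH
  have h₀L : normH k (0 : L2) ≤ L := (sobolevLE_zero_right k).normH_le.trans (by simpa using hL)
  obtain ⟨M, hM⟩ := (hU 0 h₀ h₀L).exists_sobolevLE
  refine ⟨(k + 1) * (M + 2 ^ k * (C * L)), fun a ha haL => ⟨_, hU a ha haL, fun t ht => ?_⟩⟩
  have hdist : normH k (U t a - U t 0) ≤ C * L := by
    refine (hUL a 0 ha haL h₀ h₀L t ht).trans ?_
    rw [sub_zero]
    gcongr
  have hadd := (hM t ht).add
    (((hU a ha haL).mem t ht).sub ((hU 0 h₀ h₀L).mem t ht)).sobolevLE_normH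
  rw [add_sub_cancel] at hadd
  exact hadd.normH_le.trans (by gcongr)

theorem LipCondition.exists_normH_le {s : ℕ} (hs : 1 ≤ s) {L : ℝ} (hL : 0 ≤ L)
    (hp : ContDiff ℝ ∞ p) (hp_bdd : MemLp p (∞ : ℝ≥0∞) volume)
    (hp_deriv : ∀ j ≤ s, MemLp (iteratedDeriv j (deriv p)) 2 volume) (hγ : γ.IsHermitian)
    (hg : ContDiff ℝ ∞ g) (hLip : LipCondition s p γ g T L) :
    ∃ M : ℝ, ∀ u₀, MemH (s + 1) u₀ → normH (s + 1) u₀ ≤ L →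
      ∀ u, IsDiracSolution s p γ g T u₀ u → ∀ t ∈ Set.Icc 0 T, normH s (u t) ≤ M := by
  obtain ⟨k, rfl⟩ := Nat.exists_eq_add_of_le' hs
  obtain ⟨K, K', hK⟩ := exists_isGenerator γ hg
  obtain ⟨R, hR⟩ := exists_smoothCoeffLE hp hp_bdd hp_deriv
  obtain ⟨M, hM⟩ := hLip.exists_solution_normH_le hL
  refine ⟨M, fun u₀ hu₀ huL u hu t ht => ?_⟩
  obtain ⟨v, hv, hvM⟩ := hM u₀ hu₀.of_succ ((normH_le_normH_succ _ _).trans huL)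
  rw [hu.eqOn hK hR hγ hu₀ hv ht]
  exact hvM t ht

end Convergence

end

end NLQW

theorem theorem1_general (s : ℕ) (hs : 1 ≤ s) (T L M : ℝ)
    (p : ℝ → EuclideanSpace ℝ (Fin 4)) (hp : ContDiff ℝ ∞ p)
    (hp_bdd : MemLp p ∞ volume)
    (hp_deriv : ∀ j ≤ s, MemLp (iteratedDeriv j (deriv p)) 2 volume)
    (γ : Mat2) (hγ : γ.IsHermitian) (g : ℝ → ℝ) (hg : ContDiff ℝ ∞ g) :
    ∃ C : ℝ, 0 < C ∧ ∃ δ₀ : ℝ, 0 < δ₀ ∧ ∀ u₀ : L2, MemH (s + 1) u₀ → normH (s + 1) u₀ ≤ L →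
      ∀ u : ℝ → L2, IsDiracSolution s p γ g T u₀ u → (∀ t ∈ Set.Icc 0 T, normH s (u t) ≤ M) →
        ∀ δ ∈ Set.Ioc (0 : ℝ) δ₀, ∀ m : ℕ, (m : ℝ) * δ ≤ T →
          MemH s (shannon δ (walk δ p γ hγ g m (shannonInv δ (bandLimit δ u₀))) - u (m * δ)) ∧
          normH s (shannon δ (walk δ p γ hγ g m (shannonInv δ (bandLimit δ u₀))) - u (m * δ))
            ≤ C * δ := by
  obtain ⟨k, rfl⟩ := Nat.exists_eq_add_of_le' hs
  obtain ⟨K, K', hK⟩ := exists_isGenerator γ hg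
  obtain ⟨R, hR⟩ := exists_smoothCoeffLE hp hp_bdd hp_deriv
  obtain ⟨C, hC, δ₀, hδ₀, herr⟩ :=
    hK.exists_error_bound hR hγ T (2 ^ (k + 2) * L).toNNReal (2 ^ (k + 1) * M).toNNReal
  refine ⟨((k + 1 : ℕ) + 1) * C, by positivity, δ₀, hδ₀, fun u₀ hu₀ huL u hu huM δ hδ m hm => ?_⟩
  have hΛ : SobolevLE (k + 2) (2 ^ (k + 2) * L).toNNReal u₀ :=
    hu₀.sobolevLE_normH.mono (le_trans (by gcongr) (Real.le_coe_toNNReal _))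
  have h := herr u₀ u hΛ hu (fun t ht => (hu.mem t ht).sobolevLE_normH.mono
    (le_trans (by gcongr; exact huM t ht) (Real.le_coe_toNNReal _))) δ hδ m hm
  exact ⟨h.memH, h.normH_le.trans_eq (mul_assoc _ _ _).symm⟩

theorem theorem1 (s : ℕ) (hs : 1 ≤ s) (T L : ℝ) (hT : 0 < T) (hL : 0 < L)
    (p : ℝ → EuclideanSpace ℝ (Fin 4)) (hp : ContDiff ℝ ∞ p)
    (hp_bdd : MemLp p ∞ volume)
    (hp_deriv : ∀ j ≤ s, MemLp (iteratedDeriv j (deriv p)) 2 volume)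
    (γ : Mat2) (hγ : γ.IsHermitian) (g : ℝ → ℝ) (hg : ContDiff ℝ ∞ g)
    (hLip : LipCondition s p γ g T L) :
    ∃ C : ℝ, 0 < C ∧ ∃ δ₀ : ℝ, 0 < δ₀ ∧ ∀ u₀ : L2, MemH (s + 1) u₀ → normH (s + 1) u₀ ≤ L →
      ∀ u : ℝ → L2, IsDiracSolution s p γ g T u₀ u →
        ∀ δ ∈ Set.Ioc (0 : ℝ) δ₀, ∀ m : ℕ, (m : ℝ) * δ ≤ T →
          MemH s (shannon δ (walk δ p γ hγ g m (shannonInv δ (bandLimit δ u₀))) - u (m * δ)) ∧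
          normH s (shannon δ (walk δ p γ hγ g m (shannonInv δ (bandLimit δ u₀))) - u (m * δ))
            ≤ C * δ := by
  obtain ⟨M, hM⟩ := hLip.exists_normH_le hs hL.le hp hp_bdd hp_deriv hγ hg
  obtain ⟨C, hC, δ₀, hδ₀, herr⟩ := theorem1_general s hs T L M p hp hp_bdd hp_deriv γ hγ g hg
  exact ⟨C, hC, δ₀, hδ₀, fun u₀ hu₀ huL u hu => herr u₀ hu₀ huL u hu (hM u₀ hu₀ huL u hu)⟩
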